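/- Let $p\ge 1$. There are constants $C,\kappa>0$ and $m\in\mathbb N$, depending only on $p$, such that the following holds for every finite-dimensional Euclidean space $E$, all $0<L_{p,f}<L_{p,g}$, all $R$, all $\varepsilon>0$ and every $x_0\in E$. There is a deterministic rule (line search, restarts, stopping), depending on these data only, such that for all convex $p$ times continuously differentiable $f,g:E\to\mathbb R$ with $\|D^pf(x)-D^pf(y)\|\le L_{p,f}\|x-y\|$ and $\|D^pg(x)-D^pg(y)\|\le L_{p,g}\|x-y\|$, for which $F=f+g$ has a minimizer $x^*$ with $\|x_0-x^*\|\le R$, the two-level method below, driven by this rule and with $H=H_{p,f}=2L_{p,f}$, $M=\kappa(2L_{p,f}+L_{p,g})$, stops with a point $y$ such that $F(y)-F(x^*)\le\varepsilon$ after at most $$C\,X_f^{\frac{2}{3p+1}}(\log X_f)^m\ \text{ calls for } f\quad\text{and}\quad C\,X_g^{\frac{2}{3p+1}}(\log X_g)^m\ \text{ calls for } g,$$ where $X_f=2+L_{p,f}R^{p+1}/\varepsilon$ and $X_g=2+L_{p,g}R^{p+1}/\varepsilon$; that is, $\tilde O\big((L_{p,f}R^{p+1}/\varepsilon)^{2/(3p+1)}\big)$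 derivative calls for $f$ and $\tilde O\big((L_{p,g}R^{p+1}/\varepsilon)^{2/(3p+1)}\big)$ for $g$. A call for $h\in\{f,g\}$ at $x$ returns $h(x),Dh(x),\dots,D^ph(x)$; all calls are counted, including those of rejected trials; the rule sees only the states and the answers obtained so far. Write $\Omega_p(h,x;y)=\sum_{k=0}^p\frac1{k!}D^kh(x)[y-x]^k$. *Outer method* (composite accelerated Taylor descent). Start with $A_0=0$ and $y_0=x_0$. In step $k$, a trial $\lambda>0$ chosen by the rule gives $$a=\tfrac12\big(\lambda+\sqrt{\lambda^2+4\lambda A_k}\big),\qquad \tilde x=\frac{A_k}{A_k+a}\,y_k+\frac{a}{A_k+a}\,x_k .$$ The derivatives of $f$ are computed at $\tilde x$, and the inner method is run from $\tilde x$ on $$\Phi(y)=\Omega_p(f,\tilde x;y)+\frac{H}{p!}\|y-\tilde x\|^{p+1}+g(y).$$ At any time the rule may choose another $\lambda$, or propose the current candidate $y$ (the point computed last). The proposal is accepted if $$\frac12\le\lambda\,\frac{H\|y-\tilde x\|^{p-1}}{(p-1)!}\le\frac p{p+1}\qquad\text{and}\qquad \|\nabla\Phi(y)\|\le\frac{H}{2\,p!}\|y-\tilde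 x\|^p .$$ In that case $y_{k+1}=y$, $A_{k+1}=A_k+a$ and $x_{k+1}=x_k-a\,(\nabla f(y)+\nabla g(y))$. Testing a proposal costs one call of each oracle. *Inner method* (accelerated Taylor descent applied to $\Phi$, with restarts). It uses the same recursion for its own variables, with $\Phi$ in place of $F$, no composite part, and $M$ in place of $H$. A trial $\mu>0$ gives a centre $\tilde u$, at which the derivatives of $g$ are computed, and the point $v=\operatorname{argmin}_z\{\Omega_p(\Phi,\tilde u;z)+\frac M{p!}\|z-\tilde u\|^{p+1}\}$, which becomes the candidate. The step is carried out if $\frac12\le\mu\frac{M\|v-\tilde u\|^{p-1}}{(p-1)!}\le\frac p{p+1}$, using $\nabla\Phi(v)$ (one more call for $g$), and is rejected otherwise. The rule may restart the inner method at the current candidate. When the rule stops, the method returns the current candidate: this is $y_k$ right after an accepted outer step, and a candidate for $y_{k+1}$ otherwise. -/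

import Mathlib

open scoped Nat

noncomputable section

namespace TensorSplit

variable {E : Type*} [NormedAddCommGroup E] [InnerProductSpace ℝ E]

/-- What one call of the derivative oracle returns: a value and derivatives of orders `1, …, p`
at one point. -/
abbrev Jet (p : ℕ) (E : Type*) [NormedAddCommGroup E] [InnerProductSpace ℝ E] : Type _ :=
  (k : Fin (p + 1)) → E [×(k : ℕ)]→L[ℝ] ℝ

/-- The true derivatives of `h` at `x`, up to order `p`. -/
def jet (p : ℕ) (h : E → ℝ) (x : E) : Jet p E := fun k => iteratedFDeriv ℝ (k : ℕ) h x

/-- Taylor polynomial with centre `x`:  `∑_{k ≤ p} (1 / k!) J_k [y - x]^k`. -/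
def Jet.taylor {p : ℕ} (J : Jet p E) (x y : E) : ℝ :=
  ∑ k : Fin (p + 1), (1 / ((k : ℕ)! : ℝ)) * J k (fun _ => y - x)

/-- The gradient at `x` contained in a jet at `x`. -/
def Jet.grad [CompleteSpace E] {p : ℕ} (J : Jet p E) (x : E) : E :=
  gradient (J.taylor x) x

/-- A global minimizer of `h` (an arbitrary point if there is none). -/
def argmin (h : E → ℝ) : E := Classical.epsilon (fun y => ∀ z, h y ≤ h z)

/-! ### Accelerated Taylor descent -/

/-- The variables `A_k, x_k, y_k` of accelerated Taylor descent. -/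
structure Catd (E : Type*) where
  A : ℝ
  x : E
  y : E

/-- Accelerated Taylor descent started at `z`: `A_0 = 0`, `x_0 = y_0 = z`. -/
def Catd.start (z : E) : Catd E := ⟨0, z, z⟩

/-- `a_{k+1} = (λ + √(λ² + 4 λ A_k)) / 2`. -/
def Catd.a (c : Catd E) (lam : ℝ) : ℝ := (lam + Real.sqrt (lam ^ 2 + 4 * lam * c.A)) / 2

/-- `x̃_k = (A_k / A_{k+1}) y_k + (a_{k+1} / A_{k+1}) x_k` with `A_{k+1} = A_k + a_{k+1}`. -/
def Catd.mid (c : Catd E) (lam : ℝ) : E :=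
  (c.A / (c.A + c.a lam)) • c.y + (c.a lam / (c.A + c.a lam)) • c.x

/-- The update to `A_{k+1}`, `x_{k+1} = x_k - a_{k+1} • grad`, `y_{k+1}`. -/
def Catd.update (c : Catd E) (lam : ℝ) (ynew grad : E) : Catd E :=
  ⟨c.A + c.a lam, c.x - c.a lam • grad, ynew⟩

/-- The step-size condition `1/2 ≤ λ H d^{p-1} / (p-1)! ≤ p/(p+1)`, where `d = ‖y_{k+1} - x̃_k‖`. -/
def StepOK (p : ℕ) (H lam d : ℝ) : Prop :=
  1 / 2 ≤ lam * (H * d ^ (p - 1) / ((p - 1)! : ℝ)) ∧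
    lam * (H * d ^ (p - 1) / ((p - 1)! : ℝ)) ≤ (p : ℝ) / (p + 1)

/-! ### The two-level method -/

/-- The tensor subproblem of an outer step that is being tried: the trial step size `λ`, the centre
`x̃`, the derivatives of `f` at `x̃`, and the variables of the inner accelerated Taylor descent. -/
structure Sub (p : ℕ) (E : Type*) [NormedAddCommGroup E] [InnerProductSpace ℝ E] where
  lam : ℝ
  xt : E
  Jf : Jet p E
  inner : Catd E

/-- The part of the subproblem that does not involve `g`:
`Ω_p(f, x̃; z) + (H / p!) ‖z - x̃‖^{p+1}`. -/
def Sub.known {p : ℕ} (q : Sub p E) (H : ℝ) (z : E) : ℝ :=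
  q.Jf.taylor q.xt z + H / (p ! : ℝ) * ‖z - q.xt‖ ^ (p + 1)

/-- The state of the method. `fLog` and `gLog` list all calls of the two oracles made so far, with
the answers; `cand` is the candidate for the next outer iterate `y_{k+1}`, that is, the point that
was computed last (right after an outer step has been accepted, it is `y_k`). -/
structure State (p : ℕ) (E : Type*) [NormedAddCommGroup E] [InnerProductSpace ℝ E] where
  outer : Catd E
  sub : Option (Sub p E)
  cand : E
  fLog : List (E × Jet p E)
  gLog : List (E × Jet p E)

/-- The initial state; no oracle has been called. -/
def State.init (p : ℕ) (x0 : E) : State p E := ⟨Catd.start x0, none, x0, [], []⟩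

/-- The moves of the method.
* `outerTry λ`: try the outer step with step size `λ`: set up the subproblem centred at `x̃`
  and start the inner method on it at `x̃`;
* `innerTry μ`: try a step of the inner method with step size `μ`;
* `innerRestart`: restart the inner method at the current candidate;
* `outerAccept`: finish the outer step with the current candidate. -/
inductive Move where
  | outerTry (lam : ℝ) (h : 0 < lam)
  | innerTry (mu : ℝ) (h : 0 < mu)
  | innerRestart
  | outerAccept

/-- The point found by a tensor step, centred at `ut` and with regularization `M`, for the
objective `Ω_p(f, x̃; ·) + (H / p!) ‖· - x̃‖^{p+1} + g`, where `Jg` holds the derivatives of `g` at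
`ut`. -/
def innerPoint {p : ℕ} (H M : ℝ) (q : Sub p E) (ut : E) (Jg : Jet p E) : E :=
  argmin fun z =>
    (jet p (q.known H) ut).taylor ut z + Jg.taylor ut z + M / (p ! : ℝ) * ‖z - ut‖ ^ (p + 1)

open Classical in
/-- The effect of a move. The functions `f` and `g` enter only through the oracles `OF` and `OG`,
and each call is recorded. The outer method has regularization `H`, the inner method `M`. An inner
step is carried out if the step-size condition holds, and is otherwise rejected. An outer step is
carried out if the candidate `y` satisfies the step-size condition and the inexactness condition
`‖∇(Ω_p(f, x̃; ·) + (H / p!) ‖· - x̃‖^{p+1} + g)(y)‖ ≤ (H / (2 p!)) ‖y - x̃‖^p`. -/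
def exec [CompleteSpace E] {p : ℕ} (H M : ℝ) (OF OG : E → Jet p E) (s : State p E) :
    Move → State p E
  | .outerTry lam _ =>
      let xt := s.outer.mid lam
      { s with
        sub := some ⟨lam, xt, OF xt, Catd.start xt⟩
        cand := xt
        fLog := (xt, OF xt) :: s.fLog }
  | .innerTry mu _ =>
      match s.sub with
      | none => s
      | some q =>
          let ut := q.inner.mid mu
          let v := innerPoint H M q ut (OG ut)
          if StepOK p M mu ‖v - ut‖ then
            { s with
              sub := some { q with
                inner := q.inner.update mu v (gradient (q.known H) v + (OG v).grad v) }
              cand := v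
              gLog := (v, OG v) :: (ut, OG ut) :: s.gLog }
          else
            { s with
              cand := v
              gLog := (ut, OG ut) :: s.gLog }
  | .innerRestart =>
      match s.sub with
      | none => s
      | some q => { s with sub := some { q with inner := Catd.start s.cand } }
  | .outerAccept =>
      match s.sub with
      | none => s
      | some q =>
          let y := s.cand
          let s' : State p E :=
            { s with
              fLog := (y, OF y) :: s.fLog
              gLog := (y, OG y) :: s.gLog }
          if StepOK p H q.lam ‖y - q.xt‖ ∧
              ‖gradient (q.known H) y + (OG y).grad y‖ ≤
                H / (2 * (p ! : ℝ)) * ‖y - q.xt‖ ^ p then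
            { s' with
              outer := s.outer.update q.lam y ((OF y).grad y + (OG y).grad y)
              sub := none }
          else s'

/-- A rule (line search, restarts, stopping) that drives the method. It chooses each move, and when
to stop, from the states seen so far, hence from the oracle answers received so far; every branch is
finite. -/
inductive Rule (p : ℕ) (E : Type*) [NormedAddCommGroup E] [InnerProductSpace ℝ E] where
  | halt
  | next (m : Move) (k : State p E → Rule p E)

/-- The final state when the method is driven by a rule from the state `s`. -/
def Rule.run [CompleteSpace E] {p : ℕ} (H M : ℝ) (OF OG : E → Jet p E) :
    Rule p E → State p E → State p E
  | .halt, s => s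
  | .next m k, s => (k (exec H M OF OG s m)).run H M OF OG (exec H M OF OG s m)

/-! ### The problem class -/

/-- `h` is convex and `p` times continuously differentiable, and its `p`-th derivative is
`L`-Lipschitz. -/
structure ConvexLip (p : ℕ) (L : ℝ) (h : E → ℝ) : Prop where
  convex : ConvexOn ℝ Set.univ h
  contDiff : ContDiff ℝ (p : ℕ) h
  lip : ∀ x y, ‖iteratedFDeriv ℝ p h x - iteratedFDeriv ℝ p h y‖ ≤ L * ‖x - y‖

end TensorSplit

end

/-! One accelerated method is analysed once, for an objective `h + g` with a Taylor model of `h`,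
and then used at both levels. Throughout, p = q + 1.

Complexity. The energy A_k (F(y_k) - F*) + ½‖x_k - x*‖² loses at least (3/8)(A_{k+1}/λ) d² in a step
of length d (`Catd.energy_step`). Starting at distance at most D and planning N steps, at most N/2
of them can be long in the sense of using up D²/N each. Every other step raises A^{1/(p+1)} by a
fixed amount (`add_pow_le_of_progress`). Hence A reaches D²/(2ε) once N^{3p+1} is of order (H
D^{p+1}/ε)², which is the source of the exponent 2/(3p+1) (`final_weight_ge`).

Line search. The step size is found by bisection. A very short step ends the method, because the
gradient there is already small (`Composite.sum_sub_le_of_short_step`). For longer steps, uniform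
convexity of the regularized model makes the length stable under small changes of the centre, even
with inexact solutions (`Composite.norm_sub_ge_of_center_close`). On a tiny interval the tested
quantity therefore cannot pass from below 1/2 to above p/(p+1), and logarithmically many trials
suffice. For p = 1 these two bounds coincide, and a constant step size works.

Two levels. The subproblem objective Φ is again convex with Lipschitz p-th derivative: the Taylor
polynomial of `f` has constant p-th derivative, so the constant is a multiple of H plus that of `g`
(`Composite.convexLip_model`). Moreover Φ grows like H‖y - z‖^{p+1} around its minimizer z
(`Composite.growth`), so an inner run of about (M/H)^{2/(3p+1)} steps halves the distance to z, and
logarithmically many restarts solve the subproblem. For `g` the outer and inner counts multiply, and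
(L_f R^{p+1}/ε)(L_g/L_f) = L_g R^{p+1}/ε gives the separate bound.

This product is useful only if L_f R^{p+1}/ε is bounded below. If it is at most 1/8, the regularized
model at x_0 exceeds F at x* by at most ε/2, and minimizing that single model with one inner run is
enough (`TwoLevel.singleSubproblem_spec`). -/

namespace TensorSplit

/-! ### Taylor polynomials and their derivatives -/

section Taylor

variable {E : Type*} [NormedAddCommGroup E] [NormedSpace ℝ E]
variable {G : Type*} [NormedAddCommGroup G] [NormedSpace ℝ G]

/-- Taylor polynomial of degree `q` of a vector-valued function. -/
noncomputable def tay (q : ℕ) (ψ : E → G) (x y : E) : G :=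
  ∑ k ∈ Finset.range (q + 1), (1 / (k ! : ℝ)) • iteratedFDeriv ℝ k ψ x (fun _ => y - x)

/-- Only the symmetry needed to differentiate a diagonal is proved. By induction the odd entry moves
to the front of the inner derivative; the two outermost derivatives are then exchanged by symmetry
of the second derivative of y ↦ D^kψ(y)[v, …, v]. -/
theorem iteratedFDeriv_update_const {k : ℕ} {ψ : E → G} (hψ : ContDiff ℝ (k + 1 : ℕ) ψ)
    (x v h : E) (i : Fin (k + 1)) :
    iteratedFDeriv ℝ (k + 1) ψ x (Function.update (fun _ => v) i h) =
      iteratedFDeriv ℝ (k + 1) ψ x (Function.update (fun _ => v) 0 h) := by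
  induction k generalizing x with
  | zero => rw [show i = 0 from Fin.fin_one_eq_zero i]
  | succ k ih =>
    refine Fin.cases rfl (fun j => ?_) i
    have hd : Differentiable ℝ (iteratedFDeriv ℝ (k + 1) ψ) :=
      hψ.differentiable_iteratedFDeriv (by exact_mod_cast Nat.lt_succ_self _)
    have hd' : Differentiable ℝ (iteratedFDeriv ℝ k ψ) :=
      hψ.differentiable_iteratedFDeriv (by exact_mod_cast (by omega : k < k + 1 + 1))
    have hχ : ContDiff ℝ 2 (fun y => iteratedFDeriv ℝ k ψ y (fun _ => v)) := by
      have h1 : ContDiff ℝ 2 (iteratedFDeriv ℝ k ψ) :=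
        hψ.iteratedFDeriv_right (by exact_mod_cast (by omega : 2 + k ≤ k + 1 + 1))
      exact (ContinuousMultilinearMap.apply ℝ (fun _ : Fin k => E) G (fun _ => v)).contDiff.comp h1
    have key : ∀ y w : E, iteratedFDeriv ℝ (k + 1) ψ y (Function.update (fun _ => v) 0 w) =
        fderiv ℝ (fun y => iteratedFDeriv ℝ k ψ y (fun _ => v)) y w := by
      intro y w
      rw [(hd' y).iteratedFDeriv_succ_apply_left']
      congr 2
    have hχ1 : Differentiable ℝ (fderiv ℝ (fun y => iteratedFDeriv ℝ k ψ y (fun _ => v))) :=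
      (hχ.fderiv_right (m := 1) (by norm_num)).differentiable (by norm_num)
    have hsymm := (hχ.contDiffAt (x := x)).isSymmSndFDerivAt (by simp)
    rw [(hd x).iteratedFDeriv_succ_apply_left', (hd x).iteratedFDeriv_succ_apply_left']
    have e1 : (fun y => iteratedFDeriv ℝ (k + 1) ψ y
        (Fin.tail (Function.update (fun _ : Fin (k + 1 + 1) => v) j.succ h))) =
        fun y => fderiv ℝ (fun y => iteratedFDeriv ℝ k ψ y (fun _ => v)) y h := by
      funext y
      rw [Fin.tail_update_succ, ← key, ← ih (hψ.of_le (by exact_mod_cast Nat.le_succ _)) y j]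
      rfl
    have e2 : (fun y => iteratedFDeriv ℝ (k + 1) ψ y
        (Fin.tail (Function.update (fun _ : Fin (k + 1 + 1) => v) 0 h))) =
        fun y => fderiv ℝ (fun y => iteratedFDeriv ℝ k ψ y (fun _ => v)) y v := by
      funext y
      rw [Fin.tail_update_zero, ← key]
      congr 1
      funext l
      by_cases hl : l = 0
      · subst hl; simp [Fin.tail]
      · simp [hl, Fin.tail]
    rw [e1, e2]
    have f1 : ∀ w u : E, fderiv ℝ (fun y => fderiv ℝ (fun y => iteratedFDeriv ℝ k ψ y
        (fun _ => v)) y w) x u = fderiv ℝ (fderiv ℝ (fun y => iteratedFDeriv ℝ k ψ y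
        (fun _ => v))) x u w := by
      intro w u
      rw [fderiv_clm_apply (hχ1 x) (differentiableAt_const w)]
      simp
    rw [f1, f1]
    simpa [Function.update_of_ne (Fin.succ_ne_zero j).symm] using hsymm v h

theorem iteratedFDeriv_update_const_eq {k : ℕ} {ψ : E → G} (hψ : ContDiff ℝ (k + 1 : ℕ) ψ)
    (x v h : E) (i : Fin (k + 1)) :
    iteratedFDeriv ℝ (k + 1) ψ x (Function.update (fun _ => v) i h) =
      iteratedFDeriv ℝ k (fderiv ℝ ψ) x (fun _ => v) h := by
  rw [iteratedFDeriv_update_const hψ, ← iteratedFDeriv_update_const hψ x v h (Fin.last k),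
    iteratedFDeriv_succ_apply_right, Fin.init_update_last]
  simp [Fin.init_def]

theorem hasFDerivAt_iteratedFDeriv_diag {k : ℕ} {ψ : E → G} (hψ : ContDiff ℝ (k + 1 : ℕ) ψ)
    (x y : E) :
    HasFDerivAt (fun y => iteratedFDeriv ℝ (k + 1) ψ x (fun _ => y - x))
      (((k + 1 : ℕ) : ℝ) • iteratedFDeriv ℝ k (fderiv ℝ ψ) x (fun _ => y - x)) y := by
  have h1 : HasFDerivAt (fun y : E => (fun _ : Fin (k + 1) => y - x))
      (ContinuousLinearMap.pi fun _ => ContinuousLinearMap.id ℝ E) y :=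
    hasFDerivAt_pi.2 fun _ => (hasFDerivAt_id y).sub_const x
  have h2 := ((iteratedFDeriv ℝ (k + 1) ψ x).hasFDerivAt (fun _ => y - x)).comp y h1
  refine h2.congr_fderiv ?_
  ext h
  simp [iteratedFDeriv_update_const_eq hψ, ContinuousMultilinearMap.linearDeriv_apply,
    ← Nat.cast_smul_eq_nsmul ℝ]

/-- Differentiation lowers the degree and replaces ψ by Dψ. All Taylor estimates below are
inductions on the degree through this fact. -/
theorem hasFDerivAt_tay {q : ℕ} {ψ : E → G} (hψ : ContDiff ℝ (q + 1 : ℕ) ψ) (x y : E) :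
    HasFDerivAt (tay (q + 1) ψ x) (tay q (fderiv ℝ ψ) x y) y := by
  have h0 : tay (q + 1) ψ x = fun y => (∑ k ∈ Finset.range (q + 1),
      (1 / ((k + 1) ! : ℝ)) • iteratedFDeriv ℝ (k + 1) ψ x (fun _ => y - x)) + ψ x := by
    funext y
    rw [tay, Finset.sum_range_succ']
    simp
  rw [h0]
  refine HasFDerivAt.add_const _ ?_
  refine (HasFDerivAt.fun_sum (u := Finset.range (q + 1)) (fun k hk =>
    (hasFDerivAt_iteratedFDeriv_diag (k := k) (ψ := ψ) (hψ.of_le ?_) x y).const_smul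
      (1 / ((k + 1) ! : ℝ)))).congr_fderiv ?_
  · exact_mod_cast (by simpa using hk)
  · unfold tay
    refine Finset.sum_congr rfl fun k _ => ?_
    rw [smul_smul, Nat.factorial_succ]
    congr 1
    push_cast
    have : ((k : ℝ) + 1) ≠ 0 := by positivity
    have : (k ! : ℝ) ≠ 0 := by positivity
    field_simp

theorem fderiv_tay {q : ℕ} {ψ : E → G} (hψ : ContDiff ℝ (q + 1 : ℕ) ψ) (x : E) :
    fderiv ℝ (tay (q + 1) ψ x) = tay q (fderiv ℝ ψ) x :=
  funext fun y => (hasFDerivAt_tay hψ x y).fderiv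

theorem contDiff_tay (q : ℕ) (ψ : E → G) (x : E) {n : WithTop ℕ∞} : ContDiff ℝ n (tay q ψ x) := by
  unfold tay
  refine ContDiff.sum fun k _ => ContDiff.const_smul _ ?_
  exact (iteratedFDeriv ℝ k ψ x).contDiff.comp (contDiff_pi.2 fun _ => contDiff_id.sub contDiff_const)

theorem tay_self (q : ℕ) (ψ : E → G) (x : E) : tay q ψ x x = ψ x := by
  rw [tay, Finset.sum_range_succ']
  simp only [sub_self]
  rw [Finset.sum_eq_zero]
  · simp
  · intro k _
    rw [ContinuousMultilinearMap.map_coord_zero _ 0 rfl, smul_zero]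

@[simp] theorem tay_zero (ψ : E → G) (x y : E) : tay 0 ψ x y = ψ x := by simp [tay]

theorem contDiff_fderiv_nat {q : ℕ} {ψ : E → G} (hψ : ContDiff ℝ (q + 1 : ℕ) ψ) :
    ContDiff ℝ (q : ℕ) (fderiv ℝ ψ) :=
  hψ.fderiv_right (by norm_cast)

theorem norm_iteratedFDeriv_succ_sub {q : ℕ} (ψ : E → G) (x y : E) :
    ‖iteratedFDeriv ℝ (q + 1) ψ x - iteratedFDeriv ℝ (q + 1) ψ y‖ =
      ‖iteratedFDeriv ℝ q (fderiv ℝ ψ) x - iteratedFDeriv ℝ q (fderiv ℝ ψ) y‖ := by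
  rw [iteratedFDeriv_succ_eq_comp_right, iteratedFDeriv_succ_eq_comp_right]
  simp only [Function.comp_apply]
  exact (congrArg norm (LinearIsometryEquiv.map_sub _ _ _).symm).trans
    (LinearIsometryEquiv.norm_map _ _)

/-- Along the segment from x to y, the derivative of r is dominated by that of the monomial C/(n+1)
‖y - x‖^{n+1} t^{n+1}, so a comparison theorem replaces integration. -/
theorem norm_le_pow_of_norm_fderiv_le {r : E → G} {x : E} {C : ℝ} {n : ℕ}
    (hr : Differentiable ℝ r) (h0 : r x = 0) (hb : ∀ w, ‖fderiv ℝ r w‖ ≤ C * ‖w - x‖ ^ n) (y : E) :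
    ‖r y‖ ≤ C / (n + 1) * ‖y - x‖ ^ (n + 1) := by
  have hγ : ∀ t : ℝ, HasDerivAt (fun t : ℝ => x + t • (y - x)) (y - x) t := fun t => by
    simpa using ((hasDerivAt_id t).smul_const (y - x)).const_add x
  have hf : ∀ t : ℝ, HasDerivAt (fun t : ℝ => r (x + t • (y - x)))
      (fderiv ℝ r (x + t • (y - x)) (y - x)) t := fun t =>
    ((hr _).hasFDerivAt).comp_hasDerivAt t (hγ t)
  have hB : ∀ t : ℝ, HasDerivAt (fun t : ℝ => C / (n + 1) * ‖y - x‖ ^ (n + 1) * t ^ (n + 1))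
      (C * ‖y - x‖ ^ (n + 1) * t ^ n) t := fun t => by
    have := (hasDerivAt_pow (n + 1) t).const_mul (C / (n + 1) * ‖y - x‖ ^ (n + 1))
    refine this.congr_deriv ?_
    have : (n : ℝ) + 1 ≠ 0 := by positivity
    push_cast
    field_simp
  have := image_norm_le_of_norm_deriv_right_le_deriv_boundary (a := 0) (b := 1)
    (f := fun t : ℝ => r (x + t • (y - x)))
    (fun t _ => (hf t).continuousAt.continuousWithinAt)
    (fun t _ => (hf t).hasDerivWithinAt) (by simp [h0]) hB (fun t ht => by
      refine (ContinuousLinearMap.le_opNorm _ _).trans ?_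
      have h1 := hb (x + t • (y - x))
      rw [add_sub_cancel_left, norm_smul, Real.norm_of_nonneg ht.1, mul_pow] at h1
      calc _ ≤ C * (t ^ n * ‖y - x‖ ^ n) * ‖y - x‖ := by gcongr
        _ = _ := by ring) (x := 1) (by simp)
  simpa using this

end Taylor

/-! ### Remainder bounds for Taylor polynomials -/

section TaylorBounds

universe u
variable {E : Type u} [NormedAddCommGroup E] [NormedSpace ℝ E]

/-- The induction replaces `G` by `E →L[ℝ] G`, which forces `G` into the universe of `E`.
Real-valued functions are therefore treated separately, by applying this to their derivative. -/
theorem norm_sub_tay_le {q : ℕ} {G : Type u} [NormedAddCommGroup G] [NormedSpace ℝ G] {ψ : E → G}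
    {L : ℝ} (hψ : ContDiff ℝ (q : ℕ) ψ)
    (hL : ∀ x y, ‖iteratedFDeriv ℝ q ψ x - iteratedFDeriv ℝ q ψ y‖ ≤ L * ‖x - y‖) (x y : E) :
    ‖ψ y - tay q ψ x y‖ ≤ L / (q + 1)! * ‖y - x‖ ^ (q + 1) := by
  induction q generalizing G y with
  | zero =>
    have h := hL y x
    rw [iteratedFDeriv_zero_eq_comp] at h
    simp only [Function.comp_apply, ← map_sub, LinearIsometryEquiv.norm_map] at h
    simpa using h
  | succ q ih =>
    have hd : Differentiable ℝ ψ := hψ.differentiable (by simp)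
    have := norm_le_pow_of_norm_fderiv_le (r := fun y => ψ y - tay (q + 1) ψ x y) (x := x)
      (C := L / (q + 1)!) (n := q + 1)
      (hd.sub ((contDiff_tay (n := 1) _ _ _).differentiable (by simp)))
      (by simp [tay_self]) (fun w => by
        rw [fderiv_fun_sub (hd w) (hasFDerivAt_tay hψ x w).differentiableAt,
          (hasFDerivAt_tay hψ x w).fderiv]
        exact ih (contDiff_fderiv_nat hψ)
          (fun a b => by rw [← norm_iteratedFDeriv_succ_sub]; exact hL a b) w) y
    refine this.trans (le_of_eq ?_)
    rw [Nat.factorial_succ (q + 1)]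
    push_cast
    rw [div_div, mul_comm ((q : ℝ) + 1 + 1)]

/-- Real-valued version of `norm_sub_tay_le`. -/
theorem abs_sub_tay_le {q : ℕ} {f : E → ℝ} {L : ℝ} (hf : ContDiff ℝ (q + 1 : ℕ) f)
    (hL : ∀ x y, ‖iteratedFDeriv ℝ (q + 1) f x - iteratedFDeriv ℝ (q + 1) f y‖ ≤ L * ‖x - y‖)
    (x y : E) :
    |f y - tay (q + 1) f x y| ≤ L / (q + 2)! * ‖y - x‖ ^ (q + 2) := by
  have hd : Differentiable ℝ f := hf.differentiable (by simp)
  have := norm_le_pow_of_norm_fderiv_le (r := fun y => f y - tay (q + 1) f x y) (x := x)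
    (C := L / (q + 1)!) (n := q + 1)
    (hd.sub ((contDiff_tay (n := 1) _ _ _).differentiable (by simp)))
    (by simp [tay_self]) (fun w => by
      rw [fderiv_fun_sub (hd w) (hasFDerivAt_tay hf x w).differentiableAt,
        (hasFDerivAt_tay hf x w).fderiv]
      exact norm_sub_tay_le (contDiff_fderiv_nat hf)
        (fun a b => by rw [← norm_iteratedFDeriv_succ_sub]; exact hL a b) x w) y
  refine this.trans (le_of_eq ?_)
  rw [Nat.factorial_succ (q + 1)]
  push_cast
  rw [div_div, mul_comm ((q : ℝ) + 1 + 1)]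

theorem norm_tay_remainder_sub_le {q : ℕ} {G : Type u} [NormedAddCommGroup G] [NormedSpace ℝ G]
    {ψ : E → G} {L : ℝ} (hψ : ContDiff ℝ (q : ℕ) ψ)
    (hL : ∀ x y, ‖iteratedFDeriv ℝ q ψ x - iteratedFDeriv ℝ q ψ y‖ ≤ L * ‖x - y‖) (hL0 : 0 ≤ L)
    (x y z : E) :
    ‖(ψ y - tay q ψ x y) - (ψ z - tay q ψ x z)‖ ≤
      L / q ! * max ‖y - x‖ ‖z - x‖ ^ q * ‖y - z‖ := by
  cases q with
  | zero =>
    have h := hL y z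
    rw [iteratedFDeriv_zero_eq_comp] at h
    simp only [Function.comp_apply, ← map_sub, LinearIsometryEquiv.norm_map] at h
    simpa using h
  | succ q =>
    have hd : Differentiable ℝ ψ := hψ.differentiable (by simp)
    refine (convex_closedBall x (max ‖y - x‖ ‖z - x‖)).norm_image_sub_le_of_norm_fderiv_le (𝕜 := ℝ)
      (f := fun y => ψ y - tay (q + 1) ψ x y) (fun w _ =>
        (hd w).sub (hasFDerivAt_tay hψ x w).differentiableAt) (fun w hw => ?_) ?_ ?_
    · rw [fderiv_fun_sub (hd w) (hasFDerivAt_tay hψ x w).differentiableAt,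
        (hasFDerivAt_tay hψ x w).fderiv]
      refine (norm_sub_tay_le (contDiff_fderiv_nat hψ)
        (fun a b => by rw [← norm_iteratedFDeriv_succ_sub]; exact hL a b) x w).trans ?_
      have : ‖w - x‖ ≤ max ‖y - x‖ ‖z - x‖ := by simpa [dist_eq_norm] using hw
      gcongr
    · simp [dist_eq_norm]
    · simp [dist_eq_norm]

/-- At y = x' the polynomial centred there is exact, so the difference is a Taylor remainder. Away
from x' its derivative is the same difference for Dψ, one degree lower. -/
theorem norm_tay_sub_tay_le {q : ℕ} {G : Type u} [NormedAddCommGroup G] [NormedSpace ℝ G]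
    {ψ : E → G} {L : ℝ} (hψ : ContDiff ℝ (q : ℕ) ψ)
    (hL : ∀ x y, ‖iteratedFDeriv ℝ q ψ x - iteratedFDeriv ℝ q ψ y‖ ≤ L * ‖x - y‖) (hL0 : 0 ≤ L)
    (x x' y : E) :
    ‖tay q ψ x y - tay q ψ x' y‖ ≤ (q + 1) * L * ‖x - x'‖ * (‖x - x'‖ + ‖y - x'‖) ^ q := by
  induction q generalizing G y with
  | zero =>
    have h := hL x x'
    rw [iteratedFDeriv_zero_eq_comp] at h
    simp only [Function.comp_apply, ← map_sub, LinearIsometryEquiv.norm_map] at h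
    simpa using h
  | succ q ih =>
    have hd : Differentiable ℝ fun y => tay (q + 1) ψ x y - tay (q + 1) ψ x' y := fun w =>
      ((hasFDerivAt_tay hψ x w).differentiableAt).sub (hasFDerivAt_tay hψ x' w).differentiableAt
    set d := ‖x - x'‖ with hdd
    have h1 : ‖(tay (q + 1) ψ x y - tay (q + 1) ψ x' y) -
        (tay (q + 1) ψ x x' - tay (q + 1) ψ x' x')‖ ≤
        ((q + 1) * L * d * (d + ‖y - x'‖) ^ q) * ‖y - x'‖ := by
      refine (convex_closedBall x' ‖y - x'‖).norm_image_sub_le_of_norm_fderiv_le (𝕜 := ℝ)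
        (f := fun y => tay (q + 1) ψ x y - tay (q + 1) ψ x' y) (fun w _ => hd w)
        (fun w hw => ?_) ?_ ?_
      · rw [fderiv_fun_sub (hasFDerivAt_tay hψ x w).differentiableAt
          (hasFDerivAt_tay hψ x' w).differentiableAt, (hasFDerivAt_tay hψ x w).fderiv,
          (hasFDerivAt_tay hψ x' w).fderiv]
        refine (ih (contDiff_fderiv_nat hψ)
          (fun a b => by rw [← norm_iteratedFDeriv_succ_sub]; exact hL a b) w).trans ?_
        have : ‖w - x'‖ ≤ ‖y - x'‖ := by simpa [dist_eq_norm] using hw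
        gcongr
      · simp
      · simp [dist_eq_norm]
    have h2 : ‖tay (q + 1) ψ x x' - tay (q + 1) ψ x' x'‖ ≤ L * d * (d + ‖y - x'‖) ^ (q + 1) := by
      rw [tay_self, norm_sub_rev]
      refine (norm_sub_tay_le hψ hL x x').trans ?_
      rw [norm_sub_rev x' x, ← hdd]
      have hf : L / ((q + 1 + 1)! : ℝ) ≤ L :=
        div_le_self hL0 (by exact_mod_cast Nat.succ_le_of_lt (Nat.factorial_pos _))
      have hp : d ^ (q + 1) ≤ (d + ‖y - x'‖) ^ (q + 1) := by
        gcongr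
        linarith [norm_nonneg (y - x')]
      calc _ ≤ L * d ^ (q + 1 + 1) := by gcongr
        _ = L * d * d ^ (q + 1) := by ring
        _ ≤ _ := by gcongr
    have h3 : ‖y - x'‖ ≤ d + ‖y - x'‖ := by linarith [norm_nonneg (x - x')]
    calc ‖tay (q + 1) ψ x y - tay (q + 1) ψ x' y‖
        ≤ ‖(tay (q + 1) ψ x y - tay (q + 1) ψ x' y) -
          (tay (q + 1) ψ x x' - tay (q + 1) ψ x' x')‖ +
          ‖tay (q + 1) ψ x x' - tay (q + 1) ψ x' x'‖ := by
          simpa using norm_add_le ((tay (q + 1) ψ x y - tay (q + 1) ψ x' y) -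
          (tay (q + 1) ψ x x' - tay (q + 1) ψ x' x')) (tay (q + 1) ψ x x' - tay (q + 1) ψ x' x')
      _ ≤ ((q + 1) * L * d * (d + ‖y - x'‖) ^ q) * (d + ‖y - x'‖) +
          L * d * (d + ‖y - x'‖) ^ (q + 1) := by
          gcongr
          exact h1.trans (by gcongr)
      _ = _ := by push_cast; ring

/-- This is why the Taylor part of a subproblem adds nothing to the Lipschitz constant of its top
derivative. -/
theorem iteratedFDeriv_tay_eq {q : ℕ} {G : Type u} [NormedAddCommGroup G] [NormedSpace ℝ G]
    {ψ : E → G} (hψ : ContDiff ℝ (q : ℕ) ψ) (x y z : E) :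
    iteratedFDeriv ℝ q (tay q ψ x) y = iteratedFDeriv ℝ q (tay q ψ x) z := by
  induction q generalizing G with
  | zero =>
    ext m
    simp
  | succ q ih =>
    rw [← sub_eq_zero, ← norm_eq_zero, norm_iteratedFDeriv_succ_sub, fderiv_tay hψ,
      ih (contDiff_fderiv_nat hψ), sub_self, norm_zero]

theorem iteratedFDeriv_tay_real_eq {q : ℕ} {f : E → ℝ} (hf : ContDiff ℝ (q + 1 : ℕ) f) (x y z : E) :
    iteratedFDeriv ℝ (q + 1) (tay (q + 1) f x) y = iteratedFDeriv ℝ (q + 1) (tay (q + 1) f x) z := by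
  rw [← sub_eq_zero, ← norm_eq_zero, norm_iteratedFDeriv_succ_sub, fderiv_tay hf,
    iteratedFDeriv_tay_eq (contDiff_fderiv_nat hf) x y z, sub_self, norm_zero]

end TaylorBounds

end TensorSplit

namespace TensorSplit

/-! ### Powers of the norm: smoothness and uniform monotonicity -/

section NormPow

variable {E : Type*} [NormedAddCommGroup E] [InnerProductSpace ℝ E]

/-- A bound, independent of the space, for all derivatives of order at most `n + 1` of
`‖·‖ ^ (n + 1)` on the unit sphere. -/
noncomputable def normPowBound (n : ℕ) : ℝ :=
  (n + 1)! * (∑ i ∈ Finset.range (n + 2),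
    ‖iteratedFDerivWithin ℝ i (fun s : ℝ => s ^ (((n + 1 : ℕ) : ℝ) / 2)) (Set.Ioi 0) 1‖) *
    2 ^ (n + 1)

theorem normPowBound_nonneg (n : ℕ) : 0 ≤ normPowBound n := by
  unfold normPowBound; positivity

theorem contDiffAt_norm_pow (n : ℕ) {x : E} (hx : x ≠ 0) {m : WithTop ℕ∞} :
    ContDiffAt ℝ m (fun x : E => ‖x‖ ^ n) x :=
  (contDiffAt_norm ℝ hx).pow n

theorem norm_iteratedFDeriv_norm_sq_le {x : E} (hx : x ≠ 0) {i : ℕ} (hi : 1 ≤ i) :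
    ‖iteratedFDeriv ℝ i (fun y : E => (1 / ‖x‖ ^ 2) * ‖y‖ ^ 2) x‖ ≤ (2 / ‖x‖) ^ i := by
  have hx' : 0 < ‖x‖ := norm_pos_iff.2 hx
  obtain ⟨i, rfl⟩ := Nat.exists_eq_add_of_le' hi
  set T : E →L[ℝ] (E →L[ℝ] ℝ) := (2 / ‖x‖ ^ 2) • innerSL ℝ with hT
  have hf : fderiv ℝ (fun y : E => (1 / ‖x‖ ^ 2) * ‖y‖ ^ 2) = T := by
    funext y
    have h := ((hasStrictFDerivAt_norm_sq y).hasFDerivAt.const_mul (1 / ‖x‖ ^ 2)).fderiv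
    refine h.trans ?_
    ext v
    change (1 / ‖x‖ ^ 2) * ((2 : ℕ) • inner ℝ y v) = (2 / ‖x‖ ^ 2) * inner ℝ y v
    rw [nsmul_eq_mul]
    push_cast
    ring
  have hTn : ∀ v, ‖T v‖ ≤ 2 / ‖x‖ ^ 2 * ‖v‖ := fun v => by
    rw [hT, smul_apply, norm_smul, innerSL_apply_norm,
      Real.norm_of_nonneg (by positivity)]
  rw [← norm_iteratedFDeriv_fderiv, hf]
  match i with
  | 0 =>
    simp only [norm_iteratedFDeriv_zero]
    refine (hTn x).trans (le_of_eq ?_)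
    rw [zero_add, pow_one]
    field_simp
  | 1 =>
    rw [norm_iteratedFDeriv_one, ContinuousLinearMap.fderiv]
    refine (ContinuousLinearMap.opNorm_le_bound _ (by positivity) hTn).trans ?_
    rw [div_pow]
    gcongr
    norm_num
  | i + 2 =>
    rw [← norm_iteratedFDeriv_fderiv]
    have : fderiv ℝ (T : E → E →L[ℝ] ℝ) = fun _ => T := funext fun y => T.fderiv
    rw [this, iteratedFDeriv_succ_const]
    simp
    positivity

/-- The power is written as ‖x‖^{n+1} g(f(y)) with f(y) = ‖y‖²/‖x‖² and g(s) = s^{(n+1)/2}. Since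
f(x) = 1 and the i-th derivative of f at x is at most (2/‖x‖)^i, the bound for derivatives of a
composition gives a constant depending on n alone, not on the dimension. -/
theorem norm_iteratedFDeriv_norm_pow_le (n : ℕ) {x : E} (hx : x ≠ 0) {k : ℕ} (hk : k ≤ n + 1) :
    ‖iteratedFDeriv ℝ k (fun y : E => ‖y‖ ^ (n + 1)) x‖ ≤ normPowBound n * ‖x‖ ^ (n + 1 - k) := by
  have hx' : 0 < ‖x‖ := norm_pos_iff.2 hx
  set g : ℝ → ℝ := fun s => s ^ (((n + 1 : ℕ) : ℝ) / 2) with hg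
  set f : E → ℝ := fun y => (1 / ‖x‖ ^ 2) * ‖y‖ ^ 2 with hf
  have hfx : f x = 1 := by simp only [hf]; field_simp
  have heq : (fun y : E => ‖y‖ ^ (n + 1)) = (‖x‖ ^ (n + 1)) • (g ∘ f) := by
    funext y
    simp only [Pi.smul_apply, hg, hf, Function.comp_apply, smul_eq_mul]
    rw [Real.mul_rpow (by positivity) (by positivity), ← Real.rpow_natCast ‖y‖ 2,
      ← Real.rpow_mul (norm_nonneg y), ← one_div_pow, ← Real.rpow_natCast (1 / ‖x‖) 2,
      ← Real.rpow_mul (by positivity)]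
    have : (((2 : ℕ) : ℝ) * (((n + 1 : ℕ) : ℝ) / 2)) = ((n + 1 : ℕ) : ℝ) := by push_cast; ring
    rw [this, Real.rpow_natCast, Real.rpow_natCast, one_div, inv_pow]
    field_simp
  have hs : IsOpen ({0}ᶜ : Set E) := isOpen_compl_singleton
  have hgd : ContDiffOn ℝ (k : ℕ) g (Set.Ioi 0) := fun s hs =>
    (contDiffAt_id.rpow_const_of_ne (ne_of_gt hs)).contDiffWithinAt
  have hfd : ContDiff ℝ (k : ℕ) f := contDiff_const.mul (contDiff_norm_sq ℝ)
  have hst : Set.MapsTo f ({0}ᶜ : Set E) (Set.Ioi 0) := fun y hy => by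
    have : 0 < ‖y‖ := norm_pos_iff.2 hy
    simp only [hf, Set.mem_Ioi]; positivity
  have hmem : x ∈ ({0}ᶜ : Set E) := hx
  have hcd : ContDiffAt ℝ (k : ℕ) (g ∘ f) x :=
    ((contDiffAt_id.rpow_const_of_ne (by rw [hfx]; exact one_ne_zero) :
      ContDiffAt ℝ (k : ℕ) g (f x))).comp x hfd.contDiffAt
  rw [heq, iteratedFDeriv_const_smul_apply hcd, norm_smul, Real.norm_of_nonneg (by positivity)]
  have hmain := norm_iteratedFDerivWithin_comp_le hgd hfd.contDiffOn le_rfl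
    isOpen_Ioi.uniqueDiffOn hs.uniqueDiffOn hst hmem
    (C := ∑ i ∈ Finset.range (n + 2), ‖iteratedFDerivWithin ℝ i g (Set.Ioi 0) 1‖)
    (D := 2 / ‖x‖) (fun i hi => by
      rw [hfx]
      exact Finset.single_le_sum (f := fun i => ‖iteratedFDerivWithin ℝ i g (Set.Ioi 0) 1‖)
        (fun i _ => norm_nonneg _) (Finset.mem_range.2 (by omega)))
    (fun i hi _ => by
      rw [iteratedFDerivWithin_of_isOpen i hs hmem]
      exact norm_iteratedFDeriv_norm_sq_le hx hi)
  rw [iteratedFDerivWithin_of_isOpen k hs hmem] at hmain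
  set C := ∑ i ∈ Finset.range (n + 2), ‖iteratedFDerivWithin ℝ i g (Set.Ioi 0) 1‖ with hC
  have hC0 : 0 ≤ C := Finset.sum_nonneg fun i _ => norm_nonneg _
  have hfac : ((k ! : ℕ) : ℝ) ≤ ((n + 1)! : ℕ) := by exact_mod_cast Nat.factorial_le hk
  have h2 : (2 : ℝ) ^ k ≤ 2 ^ (n + 1) := pow_le_pow_right₀ (by norm_num) hk
  calc ‖x‖ ^ (n + 1) * ‖iteratedFDeriv ℝ k (g ∘ f) x‖
      ≤ ‖x‖ ^ (n + 1) * (k ! * C * (2 / ‖x‖) ^ k) := by gcongr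
    _ = (k ! * C * 2 ^ k) * ‖x‖ ^ (n + 1 - k) := by
      have : ‖x‖ ^ (n + 1) = ‖x‖ ^ (n + 1 - k) * ‖x‖ ^ k := by
        rw [← pow_add]; congr 1; omega
      rw [this, div_pow]
      field_simp
    _ ≤ ((n + 1)! * C * 2 ^ (n + 1)) * ‖x‖ ^ (n + 1 - k) := by gcongr

/-- Inductively, the k-th derivative is O(‖x‖^{n+1-k}) at 0. For k < n the exponent is at least 2,
so its derivative at 0 exists and vanishes. -/
theorem iteratedFDeriv_norm_pow_zero (n : ℕ) (k : ℕ) (hk : k ≤ n) :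
    iteratedFDeriv ℝ k (fun y : E => ‖y‖ ^ (n + 1)) 0 = 0 := by
  induction k with
  | zero => ext m; simp
  | succ k ih =>
    have h0 := ih (by omega)
    have hO : (iteratedFDeriv ℝ k (fun y : E => ‖y‖ ^ (n + 1))) =O[nhds 0]
        fun x => ‖x - 0‖ ^ (n + 1 - k) := by
      refine Asymptotics.IsBigO.of_bound (normPowBound n) (Filter.Eventually.of_forall fun x => ?_)
      by_cases hx : x = 0
      · subst hx
        rw [h0]
        simp only [norm_zero]
        have := normPowBound_nonneg n
        positivity
      · simpa using norm_iteratedFDeriv_norm_pow_le n hx (by omega : k ≤ n + 1)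
    have hd := hO.hasFDerivAt (𝕜 := ℝ) (by omega)
    rw [← norm_eq_zero, ← norm_fderiv_iteratedFDeriv, hd.fderiv]
    exact ContinuousLinearMap.opNorm_zero

theorem norm_iteratedFDeriv_norm_pow_le' (n : ℕ) (x : E) {k : ℕ} (hk : k ≤ n) :
    ‖iteratedFDeriv ℝ k (fun y : E => ‖y‖ ^ (n + 1)) x‖ ≤ normPowBound n * ‖x‖ ^ (n + 1 - k) := by
  by_cases hx : x = 0
  · subst hx
    rw [iteratedFDeriv_norm_pow_zero n k hk, norm_zero]
    have := normPowBound_nonneg n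
    positivity
  · exact norm_iteratedFDeriv_norm_pow_le n hx (by omega)

theorem contDiff_norm_pow (n : ℕ) : ContDiff ℝ (n : ℕ) (fun y : E => ‖y‖ ^ (n + 1)) := by
  rw [contDiff_nat_iff_continuous_differentiable]
  refine ⟨fun k hk => continuous_iff_continuousAt.2 fun x => ?_, fun k hk x => ?_⟩
  · by_cases hx : x = 0
    · subst hx
      rw [ContinuousAt, iteratedFDeriv_norm_pow_zero n k hk]
      refine squeeze_zero_norm (fun x => norm_iteratedFDeriv_norm_pow_le' n x hk) ?_
      have : Continuous fun x : E => normPowBound n * ‖x‖ ^ (n + 1 - k) := by fun_prop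
      simpa [zero_pow (by omega : n + 1 - k ≠ 0)] using this.tendsto 0
    · exact ((contDiffAt_norm_pow (n + 1) hx (m := (k + 1 : ℕ))).differentiableAt_iteratedFDeriv
        (by exact_mod_cast Nat.lt_succ_self k)).continuousAt
  · by_cases hx : x = 0
    · subst hx
      have hO : (iteratedFDeriv ℝ k (fun y : E => ‖y‖ ^ (n + 1))) =O[nhds 0]
          fun x => ‖x - 0‖ ^ (n + 1 - k) := by
        refine Asymptotics.IsBigO.of_bound (normPowBound n)
          (Filter.Eventually.of_forall fun x => ?_)
        simpa using norm_iteratedFDeriv_norm_pow_le' n x hk.le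
      exact (hO.hasFDerivAt (𝕜 := ℝ) (by omega)).differentiableAt
    · exact (contDiffAt_norm_pow (n + 1) hx (m := (k + 1 : ℕ))).differentiableAt_iteratedFDeriv
        (by exact_mod_cast Nat.lt_succ_self k)

/-- Off the origin this is the mean value inequality. If the segment passes through 0, the n-th
derivative is bounded by a multiple of the norm and ‖x‖ + ‖y‖ = ‖x - y‖. -/
theorem lipschitz_iteratedFDeriv_norm_pow (n : ℕ) (x y : E) :
    ‖iteratedFDeriv ℝ n (fun y : E => ‖y‖ ^ (n + 1)) x -
      iteratedFDeriv ℝ n (fun y : E => ‖y‖ ^ (n + 1)) y‖ ≤ normPowBound n * ‖x - y‖ := by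
  by_cases h0 : (0 : E) ∈ segment ℝ x y
  · have h1 := dist_add_dist_of_mem_segment h0
    rw [dist_zero_right, dist_zero_left, dist_eq_norm] at h1
    have hx := norm_iteratedFDeriv_norm_pow_le' n x le_rfl
    have hy := norm_iteratedFDeriv_norm_pow_le' n y le_rfl
    rw [Nat.add_sub_cancel_left, pow_one] at hx hy
    calc _ ≤ _ := norm_sub_le _ _
      _ ≤ _ := add_le_add hx hy
      _ = _ := by rw [← mul_add, h1]
  · rw [norm_sub_rev, norm_sub_rev x y]
    refine (convex_segment x y).norm_image_sub_le_of_norm_fderiv_le (𝕜 := ℝ)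
      (fun w hw => ?_) (fun w hw => ?_) (left_mem_segment ℝ x y) (right_mem_segment ℝ x y)
    · have hw0 : w ≠ 0 := fun h => h0 (h ▸ hw)
      exact (contDiffAt_norm_pow (n + 1) hw0 (m := (n + 1 : ℕ))).differentiableAt_iteratedFDeriv
        (by exact_mod_cast Nat.lt_succ_self n)
    · have hw0 : w ≠ 0 := fun h => h0 (h ▸ hw)
      rw [norm_fderiv_iteratedFDeriv]
      simpa using norm_iteratedFDeriv_norm_pow_le n hw0 le_rfl

/-- The inner product splits into a symmetric quadratic term and (‖a‖^q - ‖b‖^q)(‖a‖² - ‖b‖²), whose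
factors have the same sign. The factor 1/2 does not degrade with q, which is what lets H = 2L
suffice. -/
theorem inner_norm_pow_smul_sub_ge (q : ℕ) (a b : E) :
    1 / 2 * max ‖a‖ ‖b‖ ^ q * ‖a - b‖ ^ 2 ≤
      inner ℝ (‖a‖ ^ q • a - ‖b‖ ^ q • b) (a - b) := by
  have h1 : inner ℝ (‖a‖ ^ q • a - ‖b‖ ^ q • b) (a - b) =
      1 / 2 * (‖a‖ ^ q + ‖b‖ ^ q) * ‖a - b‖ ^ 2 +
        1 / 2 * ((‖a‖ ^ q - ‖b‖ ^ q) * (‖a‖ ^ 2 - ‖b‖ ^ 2)) := by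
    rw [norm_sub_sq_real]
    simp only [inner_sub_left, inner_sub_right, real_inner_smul_left, real_inner_self_eq_norm_sq,
      real_inner_comm b a]
    ring
  have h2 : 0 ≤ (‖a‖ ^ q - ‖b‖ ^ q) * (‖a‖ ^ 2 - ‖b‖ ^ 2) := by
    rcases le_total ‖a‖ ‖b‖ with h | h
    · exact mul_nonneg_of_nonpos_of_nonpos (sub_nonpos.2 (by gcongr)) (sub_nonpos.2 (by gcongr))
    · exact mul_nonneg (sub_nonneg.2 (by gcongr)) (sub_nonneg.2 (by gcongr))
  have h3 : max ‖a‖ ‖b‖ ^ q ≤ ‖a‖ ^ q + ‖b‖ ^ q := by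
    rcases le_total ‖a‖ ‖b‖ with h | h
    · rw [max_eq_right h]; linarith [pow_nonneg (norm_nonneg a) q]
    · rw [max_eq_left h]; linarith [pow_nonneg (norm_nonneg b) q]
  rw [h1]
  have : 1 / 2 * max ‖a‖ ‖b‖ ^ q * ‖a - b‖ ^ 2 ≤ 1 / 2 * (‖a‖ ^ q + ‖b‖ ^ q) * ‖a - b‖ ^ 2 := by
    gcongr
  linarith

theorem norm_norm_pow_smul_sub_le (q : ℕ) (a b : E) :
    ‖‖a‖ ^ q • a - ‖b‖ ^ q • b‖ ≤ (q + 1) * max ‖a‖ ‖b‖ ^ q * ‖a - b‖ := by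
  have h1 : ‖a‖ ^ q • a - ‖b‖ ^ q • b = ‖a‖ ^ q • (a - b) + (‖a‖ ^ q - ‖b‖ ^ q) • b := by
    rw [smul_sub, sub_smul]; abel
  have h2 : |‖a‖ ^ q - ‖b‖ ^ q| * ‖b‖ ≤ q * max ‖a‖ ‖b‖ ^ q * ‖a - b‖ := by
    cases q with
    | zero => simp
    | succ q =>
      have h := abs_pow_sub_pow_le ‖a‖ ‖b‖ (q + 1)
      rw [abs_norm, abs_norm, Nat.add_sub_cancel] at h
      calc |‖a‖ ^ (q + 1) - ‖b‖ ^ (q + 1)| * ‖b‖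
          ≤ (|‖a‖ - ‖b‖| * ((q + 1 : ℕ) : ℝ) * max ‖a‖ ‖b‖ ^ q) * max ‖a‖ ‖b‖ := by
            gcongr; exact le_max_right _ _
        _ ≤ (‖a - b‖ * ((q + 1 : ℕ) : ℝ) * max ‖a‖ ‖b‖ ^ q) * max ‖a‖ ‖b‖ := by
            gcongr; exact abs_norm_sub_norm_le a b
        _ = _ := by ring
  rw [h1]
  refine (norm_add_le _ _).trans ?_
  rw [norm_smul, norm_smul, Real.norm_of_nonneg (by positivity), Real.norm_eq_abs]
  have h3 : ‖a‖ ^ q * ‖a - b‖ ≤ max ‖a‖ ‖b‖ ^ q * ‖a - b‖ := by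
    gcongr; exact le_max_left _ _
  linarith

theorem hasGradientAt_norm_sub_pow [CompleteSpace E] (q : ℕ) (x y : E) :
    HasGradientAt (fun y : E => ‖y - x‖ ^ (q + 2)) (((q : ℝ) + 2) • ‖y - x‖ ^ q • (y - x)) y := by
  rw [hasGradientAt_iff_hasFDerivAt]
  have h := (hasFDerivAt_norm_rpow (y - x) (p := ((q + 2 : ℕ) : ℝ))
    (by push_cast; linarith [(q.cast_nonneg : (0 : ℝ) ≤ q)])).comp y ((hasFDerivAt_id y).sub_const x)
  have h2 : (((q + 2 : ℕ) : ℝ) - 2) = (q : ℝ) := by push_cast; ring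
  simp only [h2, Real.rpow_natCast] at h
  refine h.congr_fderiv ?_
  ext v
  simp
  ring

end NormPow

end TensorSplit

namespace TensorSplit

/-! ### Convexity and gradients -/

section Convexity

variable {E : Type*} [NormedAddCommGroup E] [InnerProductSpace ℝ E] [CompleteSpace E]

theorem hasDerivAt_line {s : E → ℝ} {G : E → E} (hG : ∀ y, HasGradientAt s (G y) y) (x v : E)
    (t : ℝ) : HasDerivAt (fun t : ℝ => s (x + t • v)) (inner ℝ (G (x + t • v)) v) t := by
  have hγ : HasDerivAt (fun t : ℝ => x + t • v) v t := by
    simpa using ((hasDerivAt_id t).smul_const v).const_add x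
  exact ((hG (x + t • v)).hasFDerivAt.comp_hasDerivAt t hγ).congr_deriv (by simp)

theorem convexOn_of_gradient_monotone {s : E → ℝ} {G : E → E}
    (hG : ∀ y, HasGradientAt s (G y) y) (hmono : ∀ y z, 0 ≤ inner ℝ (G y - G z) (y - z)) :
    ConvexOn ℝ Set.univ s := by
  refine ⟨convex_univ, fun x _ y _ a b ha hb hab => ?_⟩
  have hd := hasDerivAt_line hG x (y - x)
  have hconv : ConvexOn ℝ Set.univ (fun t : ℝ => s (x + t • (y - x))) := by
    refine MonotoneOn.convexOn_of_deriv convex_univ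
      (fun t _ => (hd t).continuousAt.continuousWithinAt)
      (fun t _ => (hd t).differentiableAt.differentiableWithinAt) ?_
    intro t _ t' _ htt
    rw [(hd t).deriv, (hd t').deriv]
    rcases htt.eq_or_lt with rfl | hlt
    · exact le_rfl
    · have h := hmono (x + t' • (y - x)) (x + t • (y - x))
      have e : (x + t' • (y - x)) - (x + t • (y - x)) = (t' - t) • (y - x) := by
        rw [sub_smul]; abel
      rw [e, real_inner_smul_right, inner_sub_left] at h
      have := nonneg_of_mul_nonneg_right h (sub_pos.2 hlt)
      linarith
  have h := hconv.2 (Set.mem_univ (0 : ℝ)) (Set.mem_univ (1 : ℝ)) ha hb hab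
  simp only [smul_eq_mul, mul_zero, mul_one, zero_add, zero_smul, add_zero, one_smul,
    add_sub_cancel] at h
  have e : a • x + b • y = x + b • (y - x) := by
    obtain rfl : a = 1 - b := by linarith
    module
  rw [e]
  exact h

theorem ConvexOn.gradient_le {s : E → ℝ} (hs : ConvexOn ℝ Set.univ s) {G x : E}
    (hG : HasGradientAt s G x) (y : E) : s x + inner ℝ G (y - x) ≤ s y := by
  have hγ : HasDerivAt (fun t : ℝ => x + t • (y - x)) (y - x) 0 := by
    simpa using ((hasDerivAt_id (0 : ℝ)).smul_const (y - x)).const_add x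
  have hd : HasDerivAt (fun t : ℝ => s (x + t • (y - x))) (inner ℝ G (y - x)) 0 := by
    have hG' : HasGradientAt s G (x + (0 : ℝ) • (y - x)) := by simpa using hG
    exact (hG'.hasFDerivAt.comp_hasDerivAt (0 : ℝ) hγ).congr_deriv (by simp)
  have hc : ConvexOn ℝ Set.univ (fun t : ℝ => s (x + t • (y - x))) := by
    have := hs.comp_affineMap (AffineMap.lineMap x y)
    simpa [Function.comp_def, AffineMap.lineMap_apply, add_comm] using this
  have h := hc.le_slope_of_hasDerivAt (Set.mem_univ 0) (Set.mem_univ 1) one_pos hd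
  simp [slope_def_field] at h
  linarith

theorem ConvexOn.gradient_monotone {s : E → ℝ} (hs : ConvexOn ℝ Set.univ s) {y z Gy Gz : E}
    (hy : HasGradientAt s Gy y) (hz : HasGradientAt s Gz z) :
    0 ≤ inner ℝ (Gy - Gz) (y - z) := by
  have h1 := ConvexOn.gradient_le hs hy z
  have h2 := ConvexOn.gradient_le hs hz y
  have e : inner ℝ Gy (z - y) = - inner ℝ Gy (y - z) := by rw [← inner_neg_right, neg_sub]
  rw [inner_sub_left]
  linarith

theorem gradient_eq_zero_of_forall_le {s : E → ℝ} {G x : E} (hG : HasGradientAt s G x)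
    (h : ∀ y, s x ≤ s y) : G = 0 := by
  have h1 : IsLocalMin s x := Filter.Eventually.of_forall h
  have h2 := h1.hasFDerivAt_eq_zero hG.hasFDerivAt
  simpa using h2

end Convexity

/-! ### The regularized Taylor model -/

section Model

universe u
variable {E : Type u} [NormedAddCommGroup E] [InnerProductSpace ℝ E]

/-- The regularized Taylor model of `h` at `x`. -/
noncomputable def model (q : ℕ) (h : E → ℝ) (H : ℝ) (x y : E) : ℝ :=
  tay (q + 1) h x y + H / ((q + 1)! : ℝ) * ‖y - x‖ ^ (q + 2)

/-- The gradient of the Taylor polynomial. -/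
noncomputable def tayGrad [CompleteSpace E] (q : ℕ) (h : E → ℝ) (x y : E) : E :=
  (InnerProductSpace.toDual ℝ E).symm (tay q (fderiv ℝ h) x y)

/-- The gradient of the regularized Taylor model plus the gradient of `g`. -/
noncomputable def sgrad [CompleteSpace E] (q : ℕ) (h g : E → ℝ) (H : ℝ) (x y : E) : E :=
  tayGrad q h x y + (H * (q + 2) / ((q + 1)! : ℝ)) • ‖y - x‖ ^ q • (y - x) + gradient g y

theorem ConvexLip.contDiff_succ {q : ℕ} {L : ℝ} {h : E → ℝ} (hh : ConvexLip (q + 1) L h) :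
    ContDiff ℝ (q + 1 : ℕ) h := hh.contDiff

theorem ConvexLip.differentiable {q : ℕ} {L : ℝ} {h : E → ℝ} (hh : ConvexLip (q + 1) L h) :
    Differentiable ℝ h := hh.contDiff_succ.differentiable (by simp)

theorem ConvexLip.lip_fderiv {q : ℕ} {L : ℝ} {h : E → ℝ} (hh : ConvexLip (q + 1) L h) (x y : E) :
    ‖iteratedFDeriv ℝ q (fderiv ℝ h) x - iteratedFDeriv ℝ q (fderiv ℝ h) y‖ ≤ L * ‖x - y‖ := by
  rw [← norm_iteratedFDeriv_succ_sub]; exact hh.lip x y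

theorem contDiff_model (q : ℕ) (h : E → ℝ) (H : ℝ) (x : E) :
    ContDiff ℝ (q + 1 : ℕ) (model q h H x) := by
  refine (contDiff_tay _ _ _).add (contDiff_const.mul ?_)
  exact (contDiff_norm_pow (E := E) (q + 1)).comp (contDiff_id.sub contDiff_const)

/-- The data of a composite problem `h + g`, with a model of `h` regularized by `H`. -/
structure Composite (q : ℕ) (L H : ℝ) (h g : E → ℝ) : Prop where
  lip : ConvexLip (q + 1) L h
  L_nonneg : 0 ≤ L
  two_L_le : 2 * L ≤ H
  H_pos : 0 < H
  convex : ConvexOn ℝ Set.univ g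
  diff : Differentiable ℝ g

variable [CompleteSpace E]

theorem HasGradientAt.add' {s r : E → ℝ} {a b x : E} (hs : HasGradientAt s a x)
    (hr : HasGradientAt r b x) : HasGradientAt (fun y => s y + r y) (a + b) x := by
  rw [hasGradientAt_iff_hasFDerivAt] at *
  exact (hs.add hr).congr_fderiv (map_add _ _ _).symm

theorem hasGradientAt_model {q : ℕ} {h : E → ℝ} (hh : ContDiff ℝ (q + 1 : ℕ) h) (H : ℝ) (x y : E) :
    HasGradientAt (model q h H x)
      (tayGrad q h x y + (H * (q + 2) / ((q + 1)! : ℝ)) • ‖y - x‖ ^ q • (y - x)) y := by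
  refine HasGradientAt.add' ?_ ?_
  · rw [hasGradientAt_iff_hasFDerivAt, tayGrad, LinearIsometryEquiv.apply_symm_apply]
    exact hasFDerivAt_tay hh x y
  · have h1 := (hasGradientAt_norm_sub_pow q x y).hasFDerivAt.const_mul (H / ((q + 1)! : ℝ))
    rw [hasGradientAt_iff_hasFDerivAt]
    refine h1.congr_fderiv ?_
    rw [← map_smul, smul_smul]
    congr 2
    ring

namespace Composite

variable {q : ℕ} {L H : ℝ} {h g : E → ℝ}

omit [CompleteSpace E] in
theorem L_le (hC : Composite q L H h g) : L ≤ H := by linarith [hC.two_L_le, hC.L_nonneg]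

theorem hasGradientAt_sum (hC : Composite q L H h g) (y : E) :
    HasGradientAt (fun y => h y + g y) (gradient h y + gradient g y) y :=
  HasGradientAt.add' (hC.lip.differentiable y).hasGradientAt (hC.diff y).hasGradientAt

theorem hasGradientAt (hC : Composite q L H h g) (x y : E) :
    HasGradientAt (fun y => model q h H x y + g y) (sgrad q h g H x y) y :=
  HasGradientAt.add' (hasGradientAt_model hC.lip.contDiff_succ H x y) (hC.diff y).hasGradientAt

omit [CompleteSpace E] in
theorem convex_sum (hC : Composite q L H h g) : ConvexOn ℝ Set.univ (fun y => h y + g y) :=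
  hC.lip.convex.add hC.convex

theorem norm_tayGrad_sub_le (hC : Composite q L H h g) (x y : E) :
    ‖tayGrad q h x y - gradient h y‖ ≤ L / ((q + 1)! : ℝ) * ‖y - x‖ ^ (q + 1) := by
  rw [tayGrad, gradient, ← map_sub, LinearIsometryEquiv.norm_map, norm_sub_rev]
  exact norm_sub_tay_le (contDiff_fderiv_nat hC.lip.contDiff_succ) hC.lip.lip_fderiv x y

theorem norm_gradient_sum_le (hC : Composite q L H h g) (x y : E) :
    ‖gradient h y + gradient g y‖ ≤ ‖sgrad q h g H x y‖ + H * (q + 3) * ‖y - x‖ ^ (q + 1) := by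
  have h1 := hC.norm_tayGrad_sub_le x y
  have hH := hC.H_pos
  set c := H * (q + 2) / ((q + 1)! : ℝ) with hc
  have hP : (1 : ℝ) ≤ ((q + 1)! : ℝ) := by exact_mod_cast Nat.succ_le_of_lt (Nat.factorial_pos _)
  have e : gradient h y + gradient g y = sgrad q h g H x y - (tayGrad q h x y - gradient h y) -
      c • ‖y - x‖ ^ q • (y - x) := by
    rw [sgrad]; abel
  have h2 : ‖c • ‖y - x‖ ^ q • (y - x)‖ = c * ‖y - x‖ ^ (q + 1) := by
    rw [norm_smul, norm_smul, Real.norm_of_nonneg (by positivity),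
      Real.norm_of_nonneg (by positivity), pow_succ]
  have hcle : c ≤ H * (q + 2) := div_le_self (by positivity) hP
  have hLle : L / ((q + 1)! : ℝ) ≤ H := (div_le_self hC.L_nonneg hP).trans hC.L_le
  rw [e]
  refine (norm_sub_le _ _).trans ?_
  rw [h2]
  have := norm_sub_le (sgrad q h g H x y) (tayGrad q h x y - gradient h y)
  have h3 : L / ((q + 1)! : ℝ) * ‖y - x‖ ^ (q + 1) ≤ H * ‖y - x‖ ^ (q + 1) := by gcongr
  have h4 : c * ‖y - x‖ ^ (q + 1) ≤ H * (q + 2) * ‖y - x‖ ^ (q + 1) := by gcongr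
  linarith

theorem norm_sgrad_le (hC : Composite q L H h g) (x y : E) :
    ‖sgrad q h g H x y‖ ≤ ‖gradient h y + gradient g y‖ + H * (q + 3) * ‖y - x‖ ^ (q + 1) := by
  have h1 := hC.norm_tayGrad_sub_le x y
  have hH := hC.H_pos
  set c := H * (q + 2) / ((q + 1)! : ℝ) with hc
  have hP : (1 : ℝ) ≤ ((q + 1)! : ℝ) := by exact_mod_cast Nat.succ_le_of_lt (Nat.factorial_pos _)
  have e : sgrad q h g H x y = (gradient h y + gradient g y) + (tayGrad q h x y - gradient h y) +
      c • ‖y - x‖ ^ q • (y - x) := by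
    rw [sgrad]; abel
  have h2 : ‖c • ‖y - x‖ ^ q • (y - x)‖ = c * ‖y - x‖ ^ (q + 1) := by
    rw [norm_smul, norm_smul, Real.norm_of_nonneg (by positivity),
      Real.norm_of_nonneg (by positivity), pow_succ]
  have hcle : c ≤ H * (q + 2) := div_le_self (by positivity) hP
  have hLle : L / ((q + 1)! : ℝ) ≤ H := (div_le_self hC.L_nonneg hP).trans hC.L_le
  rw [e]
  refine (norm_add_le _ _).trans ?_
  rw [h2]
  have := norm_add_le (gradient h y + gradient g y) (tayGrad q h x y - gradient h y)
  have h3 : L / ((q + 1)! : ℝ) * ‖y - x‖ ^ (q + 1) ≤ H * ‖y - x‖ ^ (q + 1) := by gcongr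
  have h4 : c * ‖y - x‖ ^ (q + 1) ≤ H * (q + 2) * ‖y - x‖ ^ (q + 1) := by gcongr
  linarith

/-- The gradient of a Taylor polynomial need not be monotone. It differs from the monotone gradient
of `h` by a remainder whose Lipschitz constant is controlled by the distance to the centre. -/
theorem inner_tayGrad_sub_ge (hC : Composite q L H h g) (x y z : E) :
    -(L / (q ! : ℝ) * max ‖y - x‖ ‖z - x‖ ^ q * ‖y - z‖ ^ 2) ≤
      inner ℝ (tayGrad q h x y - tayGrad q h x z) (y - z) := by
  have h1 := norm_tay_remainder_sub_le (contDiff_fderiv_nat hC.lip.contDiff_succ)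
    hC.lip.lip_fderiv hC.L_nonneg x y z
  have h2 : ‖(gradient h y - tayGrad q h x y) - (gradient h z - tayGrad q h x z)‖ ≤
      L / (q ! : ℝ) * max ‖y - x‖ ‖z - x‖ ^ q * ‖y - z‖ := by
    rw [tayGrad, tayGrad, gradient, gradient, ← map_sub, ← map_sub, ← map_sub,
      LinearIsometryEquiv.norm_map]
    exact h1
  have h3 := ConvexOn.gradient_monotone hC.lip.convex (hC.lip.differentiable y).hasGradientAt
    (hC.lip.differentiable z).hasGradientAt
  have h4 := real_inner_le_norm ((gradient h y - tayGrad q h x y) -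
    (gradient h z - tayGrad q h x z)) (y - z)
  have e : inner ℝ (tayGrad q h x y - tayGrad q h x z) (y - z) =
      inner ℝ (gradient h y - gradient h z) (y - z) -
        inner ℝ ((gradient h y - tayGrad q h x y) - (gradient h z - tayGrad q h x z)) (y - z) := by
    rw [← inner_sub_left]; congr 1; abel
  have h5 : ‖(gradient h y - tayGrad q h x y) - (gradient h z - tayGrad q h x z)‖ * ‖y - z‖ ≤
      L / (q ! : ℝ) * max ‖y - x‖ ‖z - x‖ ^ q * ‖y - z‖ * ‖y - z‖ := by gcongr
  rw [e]
  nlinarith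

/-- Uniform convexity of the model: the regularizer outweighs the failure of monotonicity of the
Taylor part. The maximum is kept because stability of the step length needs the curvature at the
scale of the step, not at that of ‖y - z‖. -/
theorem inner_sgrad_sub_ge (hC : Composite q L H h g) (x y z : E) :
    H / (2 * ((q + 1)! : ℝ)) * max ‖y - x‖ ‖z - x‖ ^ q * ‖y - z‖ ^ 2 ≤
      inner ℝ (sgrad q h g H x y - sgrad q h g H x z) (y - z) := by
  set c := H * (q + 2) / ((q + 1)! : ℝ) with hc
  have hH := hC.H_pos
  have hc0 : 0 ≤ c := by positivity
  have h1 := hC.inner_tayGrad_sub_ge x y z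
  have h2 := inner_norm_pow_smul_sub_ge q (y - x) (z - x)
  rw [sub_sub_sub_cancel_right] at h2
  have h3 := ConvexOn.gradient_monotone hC.convex (hC.diff y).hasGradientAt
    (hC.diff z).hasGradientAt
  have e : sgrad q h g H x y - sgrad q h g H x z = (tayGrad q h x y - tayGrad q h x z) +
      c • (‖y - x‖ ^ q • (y - x) - ‖z - x‖ ^ q • (z - x)) + (gradient g y - gradient g z) := by
    rw [sgrad, sgrad, ← hc, smul_sub c (‖y - x‖ ^ q • (y - x))]; abel
  rw [e, inner_add_left, inner_add_left, real_inner_smul_left]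
  have h4 := mul_le_mul_of_nonneg_left h2 hc0
  set B := max ‖y - x‖ ‖z - x‖ ^ q * ‖y - z‖ ^ 2 with hB
  have hB0 : 0 ≤ B := by positivity
  have hfac : ((q + 1)! : ℝ) = (q + 1) * (q ! : ℝ) := by rw [Nat.factorial_succ]; push_cast; ring
  -- The surplus is exactly (H - 2L)/(2 q!); this is where H ≥ 2L enters.
  have hcoef : H / (2 * ((q + 1)! : ℝ)) ≤ c * (1 / 2) - L / (q ! : ℝ) := by
    have hq : (0 : ℝ) < (q ! : ℝ) := by positivity
    rw [hc, hfac, ← sub_nonneg]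
    have : H * (q + 2) / ((q + 1) * (q ! : ℝ)) * (1 / 2) - L / (q ! : ℝ) -
        H / (2 * ((q + 1) * (q ! : ℝ))) = (H - 2 * L) / (2 * (q ! : ℝ)) := by
      field_simp; ring
    rw [this]
    have := hC.two_L_le
    exact div_nonneg (by linarith) (by positivity)
  have h5 := mul_le_mul_of_nonneg_right hcoef hB0
  have e1 : L / (q ! : ℝ) * max ‖y - x‖ ‖z - x‖ ^ q * ‖y - z‖ ^ 2 = L / (q ! : ℝ) * B := by
    rw [hB]; ring
  have e2 : c * (1 / 2 * max ‖y - x‖ ‖z - x‖ ^ q * ‖y - z‖ ^ 2) = c * (1 / 2) * B := by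
    rw [hB]; ring
  have e3 : H / (2 * ((q + 1)! : ℝ)) * max ‖y - x‖ ‖z - x‖ ^ q * ‖y - z‖ ^ 2 =
      H / (2 * ((q + 1)! : ℝ)) * B := by rw [hB]; ring
  rw [e1] at h1
  rw [e2] at h4
  rw [e3]
  linarith

theorem inner_sgrad_sub_ge_pow (hC : Composite q L H h g) (x y z : E) :
    H / (2 * ((q + 1)! : ℝ)) * (‖y - z‖ / 2) ^ q * ‖y - z‖ ^ 2 ≤
      inner ℝ (sgrad q h g H x y - sgrad q h g H x z) (y - z) := by
  refine le_trans ?_ (hC.inner_sgrad_sub_ge x y z)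
  have hH := hC.H_pos
  gcongr
  have h1 : ‖y - z‖ ≤ ‖y - x‖ + ‖z - x‖ := by
    rw [← sub_sub_sub_cancel_right y z x]; exact norm_sub_le _ _
  have := le_max_left ‖y - x‖ ‖z - x‖
  have := le_max_right ‖y - x‖ ‖z - x‖
  linarith

theorem norm_sgrad_center_sub_le (hC : Composite q L H h g) (x x' y : E) :
    ‖sgrad q h g H x y - sgrad q h g H x' y‖ ≤
      (q + 1) * (q + 3) * H * ‖x - x'‖ * (‖x - x'‖ + ‖y - x'‖) ^ q := by
  set c := H * (q + 2) / ((q + 1)! : ℝ) with hc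
  have hH := hC.H_pos
  have hP : (1 : ℝ) ≤ ((q + 1)! : ℝ) := by exact_mod_cast Nat.succ_le_of_lt (Nat.factorial_pos _)
  have hcle : c ≤ H * (q + 2) := div_le_self (by positivity) hP
  have e : sgrad q h g H x y - sgrad q h g H x' y = (tayGrad q h x y - tayGrad q h x' y) +
      c • (‖y - x‖ ^ q • (y - x) - ‖y - x'‖ ^ q • (y - x')) := by
    rw [sgrad, sgrad, ← hc, smul_sub c (‖y - x‖ ^ q • (y - x))]; abel
  have h1 : ‖tayGrad q h x y - tayGrad q h x' y‖ ≤
      (q + 1) * L * ‖x - x'‖ * (‖x - x'‖ + ‖y - x'‖) ^ q := by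
    rw [tayGrad, tayGrad, ← map_sub, LinearIsometryEquiv.norm_map]
    exact norm_tay_sub_tay_le (contDiff_fderiv_nat hC.lip.contDiff_succ) hC.lip.lip_fderiv
      hC.L_nonneg x x' y
  have h2 := norm_norm_pow_smul_sub_le q (y - x) (y - x')
  have hyx : ‖y - x‖ ≤ ‖x - x'‖ + ‖y - x'‖ := by
    have : y - x = (y - x') - (x - x') := by abel
    rw [this, add_comm]; exact norm_sub_le _ _
  have hmax : max ‖y - x‖ ‖y - x'‖ ≤ ‖x - x'‖ + ‖y - x'‖ :=
    max_le hyx (by linarith [norm_nonneg (x - x')])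
  have e2 : ‖(y - x) - (y - x')‖ = ‖x - x'‖ := by
    rw [sub_sub_sub_cancel_left, norm_sub_rev]
  rw [e2] at h2
  rw [e]
  refine (norm_add_le _ _).trans ?_
  rw [norm_smul, Real.norm_of_nonneg (by positivity)]
  have h3 : (q + 1) * L * ‖x - x'‖ * (‖x - x'‖ + ‖y - x'‖) ^ q ≤
      (q + 1) * H * ‖x - x'‖ * (‖x - x'‖ + ‖y - x'‖) ^ q := by
    gcongr; exact hC.L_le
  have h4 : c * ‖‖y - x‖ ^ q • (y - x) - ‖y - x'‖ ^ q • (y - x')‖ ≤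
      (H * (q + 2)) * ((q + 1) * (‖x - x'‖ + ‖y - x'‖) ^ q * ‖x - x'‖) := by
    gcongr
    exact h2.trans (by gcongr)
  have e3 : (q + 1 : ℝ) * (q + 3) * H * ‖x - x'‖ * (‖x - x'‖ + ‖y - x'‖) ^ q =
      (q + 1) * H * ‖x - x'‖ * (‖x - x'‖ + ‖y - x'‖) ^ q +
      (H * (q + 2)) * ((q + 1) * (‖x - x'‖ + ‖y - x'‖) ^ q * ‖x - x'‖) := by ring
  rw [e3]
  linarith

/-- The step is an approximate implicit gradient step. With s the tested quantity, the upper bound s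
≤ p/(p+1) makes the coefficient 1 - s(p+1)/p nonnegative. Adding the Taylor and inexactness errors
leaves (1 - s)‖y - x‖, and the lower bound s ≥ 1/2 finishes. -/
theorem norm_step_le (hC : Composite q L H h g) {x y : E} {lam : ℝ}
    (hs : StepOK (q + 1) H lam ‖y - x‖)
    (hlam : 0 ≤ lam)
    (hg : ‖sgrad q h g H x y‖ ≤ H / (2 * ((q + 1)! : ℝ)) * ‖y - x‖ ^ (q + 1)) :
    ‖y - x + lam • (gradient h y + gradient g y)‖ ≤ 1 / 2 * ‖y - x‖ := by
  have h1 := hC.norm_tayGrad_sub_le x y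
  have hH := hC.H_pos
  obtain ⟨hs1, hs2⟩ := hs
  rw [Nat.add_sub_cancel] at hs1 hs2
  set d := ‖y - x‖ with hd
  have hd0 : 0 ≤ d := norm_nonneg _
  set c := H * (q + 2) / ((q + 1)! : ℝ) with hc
  set s := lam * (H * d ^ q / (q ! : ℝ)) with hsdef
  have hq : (0 : ℝ) < (q ! : ℝ) := by positivity
  have hfac : ((q + 1)! : ℝ) = (q + 1) * (q ! : ℝ) := by rw [Nat.factorial_succ]; push_cast; ring
  have e : y - x + lam • (gradient h y + gradient g y) =
      (1 - lam * c * d ^ q) • (y - x) +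
        lam • (sgrad q h g H x y - (tayGrad q h x y - gradient h y)) := by
    rw [sgrad, ← hc, ← hd]
    module
  have hsc : lam * c * d ^ q = s * (q + 2) / (q + 1) := by
    rw [hsdef, hc, hfac]; field_simp
  have hs1' : s * (q + 2) / (q + 1) ≤ 1 := by
    rw [div_le_one (by positivity)]
    push_cast at hs2
    rw [le_div_iff₀ (by positivity)] at hs2
    linarith
  have h2 : ‖sgrad q h g H x y - (tayGrad q h x y - gradient h y)‖ ≤
      H / ((q + 1)! : ℝ) * d ^ (q + 1) := by
    refine (norm_sub_le _ _).trans ?_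
    have h3 : L / ((q + 1)! : ℝ) * d ^ (q + 1) ≤ (H / 2) / ((q + 1)! : ℝ) * d ^ (q + 1) := by
      gcongr; linarith [hC.two_L_le]
    have h4 : H / (2 * ((q + 1)! : ℝ)) = (H / 2) / ((q + 1)! : ℝ) := by rw [div_div]
    have h5 : H / ((q + 1)! : ℝ) * d ^ (q + 1) = (H / 2) / ((q + 1)! : ℝ) * d ^ (q + 1) +
      (H / 2) / ((q + 1)! : ℝ) * d ^ (q + 1) := by ring
    rw [h4] at hg
    linarith
  rw [e]
  refine (norm_add_le _ _).trans ?_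
  rw [norm_smul, norm_smul, Real.norm_of_nonneg hlam, Real.norm_of_nonneg (by rw [hsc]; linarith),
    hsc, ← hd]
  have h6 : lam * ‖sgrad q h g H x y - (tayGrad q h x y - gradient h y)‖ ≤ s / (q + 1) * d := by
    calc _ ≤ lam * (H / ((q + 1)! : ℝ) * d ^ (q + 1)) := by gcongr
      _ = s / (q + 1) * d := by rw [hsdef, hfac]; field_simp; ring
  have h7 : (1 - s * (q + 2) / (q + 1)) * d + s / (q + 1) * d = (1 - s) * d := by
    field_simp; ring
  have h8 : (1 - s) * d ≤ 1 / 2 * d := by gcongr; linarith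
  linarith

theorem convexOn_model (hC : Composite q L H h g) (x : E) :
    ConvexOn ℝ Set.univ (fun y => model q h H x y + g y) := by
  refine convexOn_of_gradient_monotone (hC.hasGradientAt x) fun y z => ?_
  refine le_trans ?_ (hC.inner_sgrad_sub_ge x y z)
  have := hC.H_pos
  positivity

/-- The slope at the midpoint m of y and z, in the direction y - m = m - z, is bounded below by
uniform monotonicity against the zero gradient at z; convexity carries it on to y. -/
theorem growth (hC : Composite q L H h g) {x z : E}
    (hz : ∀ y, model q h H x z + g z ≤ model q h H x y + g y) (y : E) :
    H / (2 * ((q + 1)! : ℝ) * 4 ^ (q + 2)) * ‖y - z‖ ^ (q + 2) ≤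
      (model q h H x y + g y) - (model q h H x z + g z) := by
  set m : E := (1 / 2 : ℝ) • (y + z) with hm
  have hH := hC.H_pos
  have hz0 : sgrad q h g H x z = 0 := gradient_eq_zero_of_forall_le (hC.hasGradientAt x z) hz
  have h1 := ConvexOn.gradient_le (hC.convexOn_model x) (hC.hasGradientAt x m) y
  have h2 := hC.inner_sgrad_sub_ge_pow x m z
  have e1 : y - m = (1 / 2 : ℝ) • (y - z) := by rw [hm]; module
  have e2 : m - z = (1 / 2 : ℝ) • (y - z) := by rw [hm]; module
  have e3 : ‖(1 / 2 : ℝ) • (y - z)‖ = ‖y - z‖ / 2 := by rw [norm_smul]; norm_num; ring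
  rw [hz0, sub_zero, e2, e3] at h2
  rw [e1] at h1
  have h3 := hz m
  have h4 : H / (2 * ((q + 1)! : ℝ) * 4 ^ (q + 2)) * ‖y - z‖ ^ (q + 2) ≤
      H / (2 * ((q + 1)! : ℝ)) * (‖y - z‖ / 2 / 2) ^ q * (‖y - z‖ / 2) ^ 2 := by
    have : H / (2 * ((q + 1)! : ℝ) * 4 ^ (q + 2)) * ‖y - z‖ ^ (q + 2) =
      H / (2 * ((q + 1)! : ℝ)) * (‖y - z‖ / 2 / 2) ^ q * (‖y - z‖ / 4) ^ 2 := by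
      rw [div_div, div_pow, div_pow]
      have : (2 * 2 : ℝ) = 4 := by norm_num
      rw [this, pow_add, pow_add]
      field_simp
    rw [this]
    have : ‖y - z‖ / 4 ≤ ‖y - z‖ / 2 := by linarith [norm_nonneg (y - z)]
    gcongr
  linarith

theorem exists_minimizer [FiniteDimensional ℝ E] (hC : Composite q L H h g) (x : E) :
    ∃ z, ∀ y, model q h H x z + g z ≤ model q h H x y + g y := by
  have hcont : Continuous (fun y => model q h H x y + g y) :=
    continuous_iff_continuousAt.2 fun y => (hC.hasGradientAt x y).continuousAt
  have : ProperSpace E := FiniteDimensional.proper ℝ E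
  have hH := hC.H_pos
  set c := H / (2 * ((q + 1)! : ℝ)) with hc
  have hc0 : 0 < c := by positivity
  -- Once the midpoint is farther than ρ from x, the curvature beats the slope at x; the summand 1
  -- makes the q-th power of the distance at least 1.
  set ρ := 1 + 2 * ‖sgrad q h g H x x‖ / c with hρ
  refine hcont.exists_forall_le' x ?_
  filter_upwards [(isCompact_closedBall x (2 * ρ)).compl_mem_cocompact] with y hy
  have hy' : 2 * ρ < ‖y - x‖ := by simpa [dist_eq_norm] using hy
  set m : E := (1 / 2 : ℝ) • (y + x) with hm
  have e1 : y - m = (1 / 2 : ℝ) • (y - x) := by rw [hm]; module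
  have e2 : m - x = (1 / 2 : ℝ) • (y - x) := by rw [hm]; module
  have e3 : ‖m - x‖ = ‖y - x‖ / 2 := by rw [e2, norm_smul]; norm_num; ring
  have hr : ρ < ‖m - x‖ := by rw [e3]; linarith
  have h1 := ConvexOn.gradient_le (hC.convexOn_model x) (hC.hasGradientAt x m) y
  have h2 := ConvexOn.gradient_le (hC.convexOn_model x) (hC.hasGradientAt x x) m
  have h3 := hC.inner_sgrad_sub_ge x m x
  rw [sub_self, norm_zero, max_eq_left (norm_nonneg _), inner_sub_left, ← hc] at h3
  rw [e1, ← e2] at h1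
  have h4 := abs_le.1 (abs_real_inner_le_norm (sgrad q h g H x x) (m - x))
  have hρ1 : 1 ≤ ρ := by rw [hρ]; have := norm_nonneg (sgrad q h g H x x); linarith [div_nonneg (by linarith : 0 ≤ 2 * ‖sgrad q h g H x x‖) hc0.le]
  have hq : 1 ≤ ‖m - x‖ ^ q := one_le_pow₀ (by linarith)
  have h5 : 2 * ‖sgrad q h g H x x‖ ≤ c * ‖m - x‖ := by
    have : 2 * ‖sgrad q h g H x x‖ / c ≤ ‖m - x‖ := by linarith
    rw [div_le_iff₀ hc0] at this
    linarith
  have h6 : c * ‖m - x‖ ^ 2 ≤ c * ‖m - x‖ ^ q * ‖m - x‖ ^ 2 := by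
    have : c * 1 * ‖m - x‖ ^ 2 ≤ c * ‖m - x‖ ^ q * ‖m - x‖ ^ 2 := by gcongr
    linarith
  have h7 : 2 * ‖sgrad q h g H x x‖ * ‖m - x‖ ≤ c * ‖m - x‖ * ‖m - x‖ := by gcongr
  nlinarith

/-- The model gradient at the minimizer of `h + g` is pure Taylor and regularization error, of order
H e^{q+1}. Uniform monotonicity turns two gradients of that size into a distance of order e. -/
theorem norm_sub_minimizer_le (hC : Composite q L H h g) {x y xs : E} {e : ℝ}
    (hxs : ∀ z, h xs + g xs ≤ h z + g z) (he : ‖x - xs‖ ≤ e)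
    (hy : ‖sgrad q h g H x y‖ ≤ H * e ^ (q + 1)) :
    ‖y - xs‖ ≤ (2 * ((q + 1)! : ℝ) * 2 ^ q * (q + 4)) * e := by
  have hH := hC.H_pos
  have he0 : 0 ≤ e := (norm_nonneg _).trans he
  have h0 := gradient_eq_zero_of_forall_le (hC.hasGradientAt_sum xs) hxs
  have h1 := hC.norm_sgrad_le x xs
  rw [h0, norm_zero, zero_add, norm_sub_rev] at h1
  have h2 : ‖sgrad q h g H x xs‖ ≤ H * (q + 3) * e ^ (q + 1) := h1.trans (by gcongr)
  have h3 := hC.inner_sgrad_sub_ge_pow x y xs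
  have h4 := real_inner_le_norm (sgrad q h g H x y - sgrad q h g H x xs) (y - xs)
  have h5 := norm_sub_le (sgrad q h g H x y) (sgrad q h g H x xs)
  set K := 2 * ((q + 1)! : ℝ) * 2 ^ q * (q + 4) with hK
  have hP : (1 : ℝ) ≤ ((q + 1)! : ℝ) := by exact_mod_cast Nat.succ_le_of_lt (Nat.factorial_pos _)
  have hK1 : 1 ≤ K := by
    have : (1 : ℝ) ≤ 2 ^ q := one_le_pow₀ (by norm_num)
    have hq0 : (0 : ℝ) ≤ q := Nat.cast_nonneg _
    have h8 : (1 : ℝ) ≤ 2 * ((q + 1)! : ℝ) := by linarith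
    have h9 : (1 : ℝ) ≤ 2 * ((q + 1)! : ℝ) * 2 ^ q := one_le_mul_of_one_le_of_one_le h8 this
    exact one_le_mul_of_one_le_of_one_le h9 (by linarith)
  by_contra hlt
  push Not at hlt
  set r := ‖y - xs‖ with hr
  have hr0 : 0 < r := lt_of_le_of_lt (by positivity) hlt
  have h6 : H / (2 * ((q + 1)! : ℝ)) * (r / 2) ^ q * r ^ 2 ≤ (H * (q + 4) * e ^ (q + 1)) * r := by
    refine (h3.trans h4).trans ?_
    gcongr
    linarith
  have h7 : r ^ (q + 1) ≤ K * e ^ (q + 1) := by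
    have : H / (2 * ((q + 1)! : ℝ)) * (r / 2) ^ q * r ^ 2 =
        (H * r / (2 * ((q + 1)! : ℝ) * 2 ^ q)) * r ^ (q + 1) := by
      rw [div_pow]; field_simp; ring
    rw [this, div_mul_eq_mul_div, div_le_iff₀ (by positivity)] at h6
    have h8 : (H * r) * r ^ (q + 1) ≤ (H * r) * (K * e ^ (q + 1)) := by
      rw [hK]; linarith
    exact le_of_mul_le_mul_left h8 (by positivity)
  have h8 : (K * e) ^ (q + 1) < r ^ (q + 1) := pow_lt_pow_left₀ hlt (by positivity) (by omega)
  have h9 : K * e ^ (q + 1) ≤ (K * e) ^ (q + 1) := by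
    rw [mul_pow]
    gcongr
    exact le_self_pow₀ hK1 (by omega)
  linarith

omit [CompleteSpace E] in
theorem sum_le_model (hC : Composite q L H h g) (x y : E) :
    h y + g y ≤ model q h H x y + g y := by
  have h1 := (abs_le.1 (abs_sub_tay_le hC.lip.contDiff_succ hC.lip.lip x y)).2
  have hL := hC.L_nonneg
  have hH := hC.H_pos
  have h2 : L / ((q + 2)! : ℝ) ≤ H / ((q + 1)! : ℝ) := by
    have := hC.L_le
    have h3 : ((q + 1)! : ℝ) ≤ ((q + 2)! : ℝ) := by exact_mod_cast Nat.factorial_le (by omega)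
    gcongr
  have h4 : L / ((q + 2)! : ℝ) * ‖y - x‖ ^ (q + 2) ≤ H / ((q + 1)! : ℝ) * ‖y - x‖ ^ (q + 2) := by
    gcongr
  rw [model]
  linarith

omit [CompleteSpace E] in
theorem model_le_sum (hC : Composite q L H h g) (x y : E) :
    model q h H x y + g y ≤ h y + g y + 2 * H * ‖y - x‖ ^ (q + 2) := by
  have h1 := (abs_le.1 (abs_sub_tay_le hC.lip.contDiff_succ hC.lip.lip x y)).1
  have hL := hC.L_nonneg
  have hH := hC.H_pos
  have hP : (1 : ℝ) ≤ ((q + 1)! : ℝ) := by exact_mod_cast Nat.succ_le_of_lt (Nat.factorial_pos _)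
  have hP' : (1 : ℝ) ≤ ((q + 2)! : ℝ) := by exact_mod_cast Nat.succ_le_of_lt (Nat.factorial_pos _)
  have h2 : L / ((q + 2)! : ℝ) ≤ H := (div_le_self hL hP').trans hC.L_le
  have h3 : H / ((q + 1)! : ℝ) ≤ H := div_le_self hH.le hP
  have h4 : L / ((q + 2)! : ℝ) * ‖y - x‖ ^ (q + 2) ≤ H * ‖y - x‖ ^ (q + 2) := by gcongr
  have h5 : H / ((q + 1)! : ℝ) * ‖y - x‖ ^ (q + 2) ≤ H * ‖y - x‖ ^ (q + 2) := by gcongr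
  rw [model]
  linarith

/-- This lets the inner method treat the whole subproblem objective as its smooth part: the class is
stable under passing to subproblems, and `L` does not appear in the new constant. -/
theorem convexLip_model {Lg : ℝ} (hC : Composite q L H h g) (hg : ConvexLip (q + 1) Lg g) (x : E) :
    ConvexLip (q + 1) (H * normPowBound (q + 1) + Lg) (fun y => model q h H x y + g y) := by
  have hH := hC.H_pos
  have hN : ContDiff ℝ (q + 1 : ℕ) fun y : E => ‖y - x‖ ^ (q + 2) :=
    (contDiff_norm_pow (E := E) (q + 1)).comp (contDiff_id.sub contDiff_const)
  refine ⟨hC.convexOn_model x, (contDiff_model q h H x).add hg.contDiff_succ, fun y z => ?_⟩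
  have e : ∀ y, iteratedFDeriv ℝ (q + 1) (fun y => model q h H x y + g y) y =
      iteratedFDeriv ℝ (q + 1) (tay (q + 1) h x) y +
      (H / ((q + 1)! : ℝ)) • iteratedFDeriv ℝ (q + 1) (fun y : E => ‖y‖ ^ (q + 1 + 1)) (y - x) +
      iteratedFDeriv ℝ (q + 1) g y := by
    intro y
    have e1 : (fun y => model q h H x y + g y) =
        (tay (q + 1) h x + (H / ((q + 1)! : ℝ)) • (fun y : E => ‖y - x‖ ^ (q + 2))) + g := rfl
    rw [e1, iteratedFDeriv_add_apply, iteratedFDeriv_add_apply, iteratedFDeriv_const_smul_apply,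
      iteratedFDeriv_comp_sub (f := fun y : E => ‖y‖ ^ (q + 2))]
    · exact hN.contDiffAt
    · exact (contDiff_tay _ _ _).contDiffAt
    · exact (contDiff_const.smul hN).contDiffAt
    · exact ((contDiff_tay _ _ _).add (contDiff_const.smul hN)).contDiffAt
    · exact hg.contDiff_succ.contDiffAt
  rw [e, e, iteratedFDeriv_tay_real_eq hC.lip.contDiff_succ x y z]
  have hlip := lipschitz_iteratedFDeriv_norm_pow (q + 1) (y - x) (z - x)
  rw [sub_sub_sub_cancel_right] at hlip
  set A := iteratedFDeriv ℝ (q + 1) (fun y : E => ‖y‖ ^ (q + 1 + 1)) (y - x)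
  set B := iteratedFDeriv ℝ (q + 1) (fun y : E => ‖y‖ ^ (q + 1 + 1)) (z - x)
  set c := H / ((q + 1)! : ℝ) with hc
  have hcle : c ≤ H := div_le_self hH.le
    (by exact_mod_cast Nat.succ_le_of_lt (Nat.factorial_pos _))
  have hc0 : 0 ≤ c := by positivity
  have e2 : iteratedFDeriv ℝ (q + 1) (tay (q + 1) h x) z + c • A + iteratedFDeriv ℝ (q + 1) g y -
      (iteratedFDeriv ℝ (q + 1) (tay (q + 1) h x) z + c • B + iteratedFDeriv ℝ (q + 1) g z) =
      c • (A - B) + (iteratedFDeriv ℝ (q + 1) g y - iteratedFDeriv ℝ (q + 1) g z) := by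
    rw [smul_sub]; abel
  rw [e2]
  refine (norm_add_le _ _).trans ?_
  rw [norm_smul, Real.norm_of_nonneg hc0]
  have h1 : c * ‖A - B‖ ≤ H * (normPowBound (q + 1) * ‖y - z‖) := by gcongr
  have h2 := hg.lip y z
  linarith

end Composite

end Model

end TensorSplit

namespace TensorSplit

/-! ### Growth of the weight A -/

section Progress

/-- Put w = (A + a)^{1/(q+2)}. From a ≤ (q+2) w^{q+1}(w - t) and a² = λ(A + a) one gets λ ≤ (q+2)²
w^q (w - t)². Inserted in the step-size condition, this bounds w - t below in terms of H and (wd)^q,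
and H(wd)^{q+2} ≤ e bounds the latter. -/
theorem add_pow_le_of_progress {q : ℕ} {A a lam d H e b t : ℝ} (hA : 0 ≤ A) (ha : 0 < a)
    (haa : a ^ 2 = lam * (A + a)) (hd : 0 ≤ d) (hH : 0 < H) (hlam : 1 ≤ lam * (2 * H * d ^ q))
    (he : 0 < e) (hde : (A + a) * H * d ^ (q + 2) ≤ e) (hb : 0 ≤ b)
    (hb' : b ^ (2 * (q + 2)) * ((2 * (q + 2) ^ 2) ^ (q + 2) * H ^ 2 * e ^ q) ≤ 1)
    (ht : 0 ≤ t) (htA : t ^ (q + 2) ≤ A) : (t + b) ^ (q + 2) ≤ A + a := by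
  set w : ℝ := (A + a) ^ (((q + 2 : ℕ) : ℝ)⁻¹) with hw
  have hw0 : 0 < w := Real.rpow_pos_of_pos (by linarith) _
  have hwp : w ^ (q + 2) = A + a := Real.rpow_inv_natCast_pow (by linarith) (by omega)
  have htw : t ≤ w := by
    by_contra hlt
    push Not at hlt
    have := pow_lt_pow_left₀ hlt hw0.le (by omega : q + 2 ≠ 0)
    linarith
  suffices h : b ≤ w - t by
    rw [← hwp]
    gcongr
    linarith
  by_contra hlt
  push Not at hlt
  have h1 : a ≤ (q + 2) * w ^ (q + 1) * (w - t) := by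
    have h2 := abs_pow_sub_pow_le w t (q + 2)
    rw [abs_of_nonneg hw0.le, abs_of_nonneg ht, max_eq_left htw, abs_of_nonneg (by linarith : 0 ≤ w - t)] at h2
    have h3 := (le_abs_self _).trans h2
    have h4 : q + 2 - 1 = q + 1 := by omega
    rw [h4] at h3
    push_cast at h3
    nlinarith
  have hlam0 : 0 < lam := by
    by_contra hneg
    push Not at hneg
    have : lam * (A + a) ≤ 0 := mul_nonpos_of_nonpos_of_nonneg hneg (by linarith)
    nlinarith
  have h2 : lam ≤ (q + 2) ^ 2 * w ^ q * (w - t) ^ 2 := by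
    have h3 : a ^ 2 ≤ ((q + 2) * w ^ (q + 1) * (w - t)) ^ 2 := by gcongr
    rw [haa, ← hwp] at h3
    have h4 : ((q + 2) * w ^ (q + 1) * (w - t)) ^ 2 =
        ((q + 2) ^ 2 * w ^ q * (w - t) ^ 2) * w ^ (q + 2) := by ring
    rw [h4] at h3
    exact le_of_mul_le_mul_right h3 (by positivity)
  have h3 : 1 ≤ 2 * (q + 2) ^ 2 * H * (w * d) ^ q * (w - t) ^ 2 := by
    calc (1 : ℝ) ≤ lam * (2 * H * d ^ q) := hlam
      _ ≤ ((q + 2) ^ 2 * w ^ q * (w - t) ^ 2) * (2 * H * d ^ q) := by gcongr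
      _ = _ := by rw [mul_pow]; ring
  have h4 : 1 ≤ (2 * (q + 2) ^ 2 * H * (w * d) ^ q * (w - t) ^ 2) ^ (q + 2) := one_le_pow₀ h3
  have h5 : H * (w * d) ^ (q + 2) ≤ e := by
    rw [mul_pow, hwp]; linarith
  have h6 : (2 * (q + 2 : ℝ) ^ 2 * H * (w * d) ^ q * (w - t) ^ 2) ^ (q + 2) =
      (w - t) ^ (2 * (q + 2)) *
        ((2 * (q + 2) ^ 2) ^ (q + 2) * H ^ 2 * (H * (w * d) ^ (q + 2)) ^ q) := by
    rw [mul_pow, mul_pow, mul_pow, mul_pow H, ← pow_mul, ← pow_mul, ← pow_mul, mul_comm q (q + 2),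
      pow_add H q 2]
    ring
  have h7 : (w - t) ^ (2 * (q + 2)) < b ^ (2 * (q + 2)) :=
    pow_lt_pow_left₀ hlt (by linarith) (by omega)
  have h8 : (w - t) ^ (2 * (q + 2)) *
        ((2 * (q + 2) ^ 2) ^ (q + 2) * H ^ 2 * (H * (w * d) ^ (q + 2)) ^ q) ≤
      (w - t) ^ (2 * (q + 2)) * ((2 * (q + 2) ^ 2) ^ (q + 2) * H ^ 2 * e ^ q) := by
    have : 0 ≤ w - t := by linarith
    gcongr
  have h9 : (w - t) ^ (2 * (q + 2)) * ((2 * (q + 2) ^ 2) ^ (q + 2) * H ^ 2 * e ^ q) <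
      b ^ (2 * (q + 2)) * ((2 * (q + 2) ^ 2) ^ (q + 2) * H ^ 2 * e ^ q) := by
    gcongr
  linarith

theorem exists_progress_constant {q : ℕ} {H e : ℝ} (hH : 0 < H) (he : 0 < e) :
    ∃ b : ℝ, 0 < b ∧
      b ^ (2 * (q + 2)) * ((2 * (q + 2) ^ 2) ^ (q + 2) * H ^ 2 * e ^ q) = 1 := by
  set B : ℝ := (2 * (q + 2 : ℝ) ^ 2) ^ (q + 2) * H ^ 2 * e ^ q with hB
  have hB0 : 0 < B := by positivity
  refine ⟨(B⁻¹) ^ (((2 * (q + 2) : ℕ) : ℝ)⁻¹), Real.rpow_pos_of_pos (by positivity) _, ?_⟩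
  rw [Real.rpow_inv_natCast_pow (by positivity) (by omega)]
  exact inv_mul_cancel₀ hB0.ne'

/-- The number of accelerated steps sufficient for accuracy `ε` is governed by
`N ^ (3q + 4) ≥ stepConst q * X ^ 2`. -/
noncomputable def stepConst (q : ℕ) : ℝ :=
  2 ^ (2 * q + 4) * (2 * (q + 2) ^ 2) ^ (q + 2) * (3 * (q ! : ℝ)) ^ q

theorem stepConst_pos (q : ℕ) : 0 < stepConst q := by unfold stepConst; positivity

/-- The energy budget leaves at least N/2 short steps, so A ≥ (Nb/2)^{q+2}. In A² this gives
N^{2q+4}, and the threshold e = 3 q! D²/N hidden in b gives another N^q. -/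
theorem final_weight_ge {q N n1 n2 : ℕ} {D H ε X A b : ℝ} (hN : 0 < N) (hD : 0 < D) (hH : 0 < H)
    (hε : 0 < ε) (hX : H * D ^ (q + 2) / ε ≤ X) (hNX : stepConst q * X ^ 2 ≤ (N : ℝ) ^ (3 * q + 4))
    (hn : n1 + n2 = N) (h1 : n1 * (D ^ 2 / N) ≤ D ^ 2 / 2) (hb : 0 < b)
    (hb' : b ^ (2 * (q + 2)) *
      ((2 * (q + 2) ^ 2) ^ (q + 2) * H ^ 2 * (3 * (q ! : ℝ) * D ^ 2 / N) ^ q) = 1)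
    (h2 : (n2 * b) ^ (q + 2) ≤ A) : D ^ 2 / (2 * ε) ≤ A := by
  have hN' : (0 : ℝ) < N := by exact_mod_cast hN
  have hn1 : (n1 : ℝ) ≤ N / 2 := by
    rw [mul_div_assoc', div_le_div_iff₀ hN' (by norm_num)] at h1
    have : (n1 : ℝ) * 2 * D ^ 2 ≤ N * D ^ 2 := by linarith
    have := le_of_mul_le_mul_right this (by positivity)
    linarith
  have hn2 : (N : ℝ) / 2 ≤ n2 := by
    have : (n1 : ℝ) + n2 = N := by exact_mod_cast hn
    linarith
  have hA : (N / 2 * b) ^ (q + 2) ≤ A := le_trans (by gcongr) h2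
  have hA0 : 0 ≤ A := le_trans (by positivity) hA
  refine le_of_sq_le_sq ?_ hA0
  set K : ℝ := (2 * (q + 2 : ℝ) ^ 2) ^ (q + 2) with hK
  have hK0 : 0 < K := by positivity
  have hA2 : ((N / 2 * b) ^ (q + 2)) ^ 2 ≤ A ^ 2 := by gcongr
  have e1 : ((N / 2 * b) ^ (q + 2)) ^ 2 = (N / 2) ^ (2 * q + 4) * b ^ (2 * (q + 2)) := by
    rw [← pow_mul, mul_pow]; ring_nf
  have hbe : b ^ (2 * (q + 2)) = (K * H ^ 2 * (3 * (q ! : ℝ) * D ^ 2 / N) ^ q)⁻¹ :=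
    eq_inv_of_mul_eq_one_left hb'
  rw [e1, hbe] at hA2
  refine le_trans ?_ hA2
  have hX2 : (H * D ^ (q + 2) / ε) ^ 2 ≤ X ^ 2 := by gcongr
  have h3 : stepConst q * (H * D ^ (q + 2) / ε) ^ 2 ≤ (N : ℝ) ^ (3 * q + 4) :=
    le_trans (by have := stepConst_pos q; gcongr) hNX
  have e2 : (N / 2 : ℝ) ^ (2 * q + 4) * (K * H ^ 2 * (3 * (q ! : ℝ) * D ^ 2 / N) ^ q)⁻¹ =
      (N : ℝ) ^ (3 * q + 4) / (stepConst q * H ^ 2 * D ^ (2 * q)) := by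
    rw [stepConst, ← hK, div_pow, div_pow, mul_pow _ (D ^ 2), ← pow_mul,
      show 3 * q + 4 = 2 * q + 4 + q by ring, pow_add (N : ℝ) (2 * q + 4) q]
    field_simp
  rw [e2, le_div_iff₀ (by have := stepConst_pos q; positivity)]
  refine le_trans ?_ h3
  have := stepConst_pos q
  have e3 : (D ^ 2 / (2 * ε)) ^ 2 * (stepConst q * H ^ 2 * D ^ (2 * q)) =
      1 / 4 * (stepConst q * (H * D ^ (q + 2) / ε) ^ 2) := by
    field_simp; ring
  rw [e3]
  have : 0 ≤ stepConst q * (H * D ^ (q + 2) / ε) ^ 2 := by positivity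
  linarith

end Progress

/-! ### Elementary properties of the recursion -/

section CatdStep

variable {E : Type*}

theorem Catd.a_pos {c : Catd E} {lam : ℝ} (hlam : 0 < lam) : 0 < c.a lam := by
  unfold Catd.a
  have := Real.sqrt_nonneg (lam ^ 2 + 4 * lam * c.A)
  linarith

theorem Catd.a_sq {c : Catd E} {lam : ℝ} (hlam : 0 < lam) (hA : 0 ≤ c.A) :
    c.a lam ^ 2 = lam * (c.A + c.a lam) := by
  unfold Catd.a
  have := Real.sq_sqrt (show 0 ≤ lam ^ 2 + 4 * lam * c.A by positivity)
  nlinarith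

theorem Catd.a_mono {c : Catd E} {lam lam' : ℝ} (hlam : 0 < lam) (hA : 0 ≤ c.A)
    (h : lam ≤ lam') : c.a lam ≤ c.a lam' := by
  unfold Catd.a
  gcongr

theorem Catd.a_le {c : Catd E} {lam lam' r : ℝ} (hlam : 0 < lam) (hA : 0 ≤ c.A) (hr : 1 ≤ r)
    (hl : lam ≤ lam') (h : lam' ≤ r * lam) : c.a lam' ≤ r * c.a lam := by
  unfold Catd.a
  have h1 : Real.sqrt (lam' ^ 2 + 4 * lam' * c.A) ≤ r * Real.sqrt (lam ^ 2 + 4 * lam * c.A) := by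
    have hr0 : 0 ≤ r := by linarith
    rw [← Real.sqrt_sq hr0, ← Real.sqrt_mul (by positivity)]
    refine Real.sqrt_le_sqrt ?_
    have h2 : lam' ^ 2 ≤ (r * lam) ^ 2 := by gcongr; linarith
    have h3 : lam' * c.A ≤ r * lam * c.A := by gcongr
    have h4 : r * lam * c.A ≤ r ^ 2 * lam * c.A := by
      have : r ≤ r ^ 2 := by nlinarith
      gcongr
    nlinarith
  linarith

variable [NormedAddCommGroup E] [InnerProductSpace ℝ E]

theorem Catd.mid_start (z : E) {lam : ℝ} (hlam : 0 < lam) : (Catd.start z).mid lam = z := by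
  have ha : (Catd.start z).a lam ≠ 0 := (Catd.a_pos hlam).ne'
  have hA : (Catd.start z).A = 0 := rfl
  rw [Catd.mid, hA, zero_add, zero_div, zero_smul, zero_add, div_self ha, one_smul]
  rfl

theorem Catd.mid_eq {c : Catd E} {lam : ℝ} (hlam : 0 < lam) (hA : 0 ≤ c.A) :
    c.mid lam = c.y + (c.a lam / (c.A + c.a lam)) • (c.x - c.y) := by
  have h := Catd.a_pos (c := c) hlam
  have : c.A / (c.A + c.a lam) = 1 - c.a lam / (c.A + c.a lam) := by
    field_simp
    ring
  rw [Catd.mid, this]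
  module

theorem Catd.norm_mid_sub_le {c : Catd E} {lam : ℝ} (hlam : 0 < lam) (hA : 0 ≤ c.A) (z : E) :
    ‖c.mid lam - z‖ ≤ c.A / (c.A + c.a lam) * ‖c.y - z‖ +
      c.a lam / (c.A + c.a lam) * ‖c.x - z‖ := by
  have h := Catd.a_pos (c := c) hlam
  have h1 : c.mid lam - z = (c.A / (c.A + c.a lam)) • (c.y - z) +
      (c.a lam / (c.A + c.a lam)) • (c.x - z) := by
    have : c.A / (c.A + c.a lam) = 1 - c.a lam / (c.A + c.a lam) := by
      field_simp
      ring
    rw [Catd.mid, this]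
    module
  rw [h1]
  refine (norm_add_le _ _).trans ?_
  rw [norm_smul, norm_smul, Real.norm_of_nonneg (by positivity), Real.norm_of_nonneg (by positivity)]

theorem Catd.norm_mid_sub_le_max {c : Catd E} {lam D : ℝ} (hlam : 0 < lam) (hA : 0 ≤ c.A) {z : E}
    (hy : ‖c.y - z‖ ≤ D) (hx : ‖c.x - z‖ ≤ D) : ‖c.mid lam - z‖ ≤ D := by
  have h := Catd.a_pos (c := c) hlam
  refine (Catd.norm_mid_sub_le hlam hA z).trans ?_
  calc _ ≤ c.A / (c.A + c.a lam) * D + c.a lam / (c.A + c.a lam) * D := by gcongr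
    _ = D := by field_simp

/-- The centre depends on the step size only through the weight a/(A + a), which varies by at most
the relative change of the step size. -/
theorem Catd.norm_mid_sub_mid_le {c : Catd E} {lam lam' δ : ℝ} (hlam : 0 < lam) (hA : 0 ≤ c.A)
    (hδ : 0 ≤ δ) (hl : lam ≤ lam') (h : lam' ≤ (1 + δ) * lam) :
    ‖c.mid lam - c.mid lam'‖ ≤ δ * ‖c.x - c.y‖ := by
  have hlam' : 0 < lam' := hlam.trans_le hl
  have ha := Catd.a_pos (c := c) hlam
  have ha' := Catd.a_pos (c := c) hlam'
  have h1 := Catd.a_mono (c := c) hlam hA hl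
  have h2 := Catd.a_le (c := c) hlam hA (by linarith : 1 ≤ 1 + δ) hl h
  rw [Catd.mid_eq hlam hA, Catd.mid_eq hlam' hA, add_sub_add_left_eq_sub, ← sub_smul, norm_smul]
  gcongr
  rw [Real.norm_eq_abs, abs_le]
  set a := c.a lam
  set a' := c.a lam'
  constructor
  · have h3 : a' / (c.A + a') ≤ (1 + δ) * a / (c.A + a) := by
      gcongr
    have h4 : a / (c.A + a) ≤ 1 := by rw [div_le_one (by linarith)]; linarith
    have h5 : (1 + δ) * a / (c.A + a) = a / (c.A + a) + δ * (a / (c.A + a)) := by ring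
    have h6 : δ * (a / (c.A + a)) ≤ δ * 1 := by gcongr
    linarith
  · have h3 : a / (c.A + a) ≤ a' / (c.A + a') := by
      rw [div_le_div_iff₀ (by linarith) (by linarith)]
      nlinarith
    linarith

end CatdStep

/-! ### The energy inequality -/

section Energy

universe u
variable {E : Type u} [NormedAddCommGroup E] [InnerProductSpace ℝ E]

/-- The convexity inequalities at y towards the old y and the minimizer, with weights A and a,
combine through the definition of the centre. The term a²‖G‖² equals λ(A + a)‖G‖² and is absorbed by
expanding the squared step condition; 3/8 is ½(1 - ¼). -/
theorem Catd.energy_step {F : E → ℝ} (hF : ConvexOn ℝ Set.univ F) [CompleteSpace E]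
    {c : Catd E} {lam : ℝ} (hlam : 0 < lam) (hA : 0 ≤ c.A) {y G xs : E} (hG : HasGradientAt F G y)
    (hstep : ‖y - c.mid lam + lam • G‖ ≤ 1 / 2 * ‖y - c.mid lam‖) :
    (c.A + c.a lam) * (F y - F xs) + 1 / 2 * ‖c.x - c.a lam • G - xs‖ ^ 2 +
      3 / 8 * ((c.A + c.a lam) / lam) * ‖y - c.mid lam‖ ^ 2 ≤
      c.A * (F c.y - F xs) + 1 / 2 * ‖c.x - xs‖ ^ 2 := by
  have ha := Catd.a_pos (c := c) hlam
  have haa := Catd.a_sq (c := c) hlam hA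
  set a := c.a lam with hadef
  set A' := c.A + a with hA'
  have hA'0 : 0 < A' := by linarith
  set u := y - c.mid lam with hu
  have h1 := ConvexOn.gradient_le hF hG xs
  have h2 := ConvexOn.gradient_le hF hG c.y
  have h3 : ‖u + lam • G‖ ^ 2 ≤ 1 / 4 * ‖u‖ ^ 2 := by
    calc _ ≤ (1 / 2 * ‖u‖) ^ 2 := by gcongr
      _ = _ := by ring
  have h4 : ‖u + lam • G‖ ^ 2 = ‖u‖ ^ 2 + 2 * lam * inner ℝ G u + lam ^ 2 * ‖G‖ ^ 2 := by
    rw [norm_add_sq_real, real_inner_smul_right, norm_smul, Real.norm_of_nonneg hlam.le,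
      real_inner_comm]
    ring
  have h5 : ‖c.x - a • G - xs‖ ^ 2 = ‖c.x - xs‖ ^ 2 - 2 * a * inner ℝ G (c.x - xs) +
      a ^ 2 * ‖G‖ ^ 2 := by
    have : c.x - a • G - xs = (c.x - xs) - a • G := by abel
    rw [this, norm_sub_sq_real, real_inner_smul_right, norm_smul, Real.norm_of_nonneg ha.le,
      real_inner_comm]
    ring
  have hmid : A' • c.mid lam = c.A • c.y + a • c.x := by
    rw [Catd.mid, ← hadef, ← hA', smul_add, smul_smul, smul_smul]
    congr 2 <;> field_simp
  have h6 : A' * inner ℝ G u + a * inner ℝ G (c.x - xs) =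
      -(c.A * inner ℝ G (c.y - y) + a * inner ℝ G (xs - y)) := by
    rw [← real_inner_smul_right, ← real_inner_smul_right, ← real_inner_smul_right,
      ← real_inner_smul_right, ← inner_add_right, ← inner_add_right, ← inner_neg_right]
    congr 1
    rw [hu, smul_sub, hmid, hA']
    module
  have h7 : A' * (F y - F xs) - c.A * (F c.y - F xs) ≤
      -(c.A * inner ℝ G (c.y - y) + a * inner ℝ G (xs - y)) := by
    have k1 := mul_le_mul_of_nonneg_left h1 ha.le
    have k2 := mul_le_mul_of_nonneg_left h2 hA
    rw [hA']
    linarith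
  have h8 : A' / lam * (2 * lam * inner ℝ G u + lam ^ 2 * ‖G‖ ^ 2) ≤
      A' / lam * (-(3 / 4) * ‖u‖ ^ 2) := by
    gcongr
    linarith
  have h9 : A' / lam * (2 * lam * inner ℝ G u + lam ^ 2 * ‖G‖ ^ 2) =
      2 * (A' * inner ℝ G u) + a ^ 2 * ‖G‖ ^ 2 := by
    rw [haa]; field_simp
  rw [h9] at h8
  rw [h5]
  linarith

end Energy

end TensorSplit

namespace TensorSplit

/-! ### Composing rules as programs in continuation-passing style -/

section Programs

variable {E : Type*} [NormedAddCommGroup E] [InnerProductSpace ℝ E] {p : ℕ}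

/-- A piece of a rule that hands a value over to the rest of the rule. -/
def Prog (p : ℕ) (E : Type*) [NormedAddCommGroup E] [InnerProductSpace ℝ E] (α : Type) : Type _ :=
  (α → State p E → Rule p E) → State p E → Rule p E

namespace Prog

variable {α β : Type}

/-- The program that makes no move and returns `a`. -/
def pure (a : α) : Prog p E α := fun k s => k a s

/-- Sequential composition. -/
def bind (P : Prog p E α) (Q : α → Prog p E β) : Prog p E β := fun k s => P (fun a => Q a k) s

/-- A single move. -/
def move (m : Move) : Prog p E Unit := fun k _ => .next m (k ())

/-- A program that inspects the current state. -/
def inspect (Q : State p E → Prog p E α) : Prog p E α := fun k s => Q s k s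

variable [CompleteSpace E]

/-- Run from `s`, the program `P` returns a value and arrives at a state that satisfy `Q`. -/
def Spec (H M : ℝ) (OF OG : E → Jet p E) (P : Prog p E α) (s : State p E)
    (Q : α → State p E → Prop) : Prop :=
  ∃ a s', Q a s' ∧ ∀ k, (P k s).run H M OF OG s = (k a s').run H M OF OG s'

variable {H M : ℝ} {OF OG : E → Jet p E}

theorem Spec.pure {a : α} {s : State p E} {Q : α → State p E → Prop} (h : Q a s) :
    Spec H M OF OG (Prog.pure a) s Q := ⟨a, s, h, fun _ => rfl⟩

/-- Composition works because a specification gives one value and one state that serve every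
continuation at once. -/
theorem Spec.bind {P : Prog p E α} {Q : α → Prog p E β} {s : State p E}
    {R : α → State p E → Prop} {S : β → State p E → Prop} (hP : Spec H M OF OG P s R)
    (hQ : ∀ a s', R a s' → Spec H M OF OG (Q a) s' S) : Spec H M OF OG (P.bind Q) s S := by
  obtain ⟨a, s', hR, hrun⟩ := hP
  obtain ⟨b, s'', hS, hrun'⟩ := hQ a s' hR
  exact ⟨b, s'', hS, fun k => (hrun _).trans (hrun' k)⟩

theorem Spec.mono {P : Prog p E α} {s : State p E} {Q R : α → State p E → Prop}
    (hP : Spec H M OF OG P s Q) (h : ∀ a s', Q a s' → R a s') : Spec H M OF OG P s R := by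
  obtain ⟨a, s', hQ, hrun⟩ := hP
  exact ⟨a, s', h a s' hQ, hrun⟩

theorem Spec.move {m : Move} {s : State p E} {Q : Unit → State p E → Prop}
    (h : Q () (exec H M OF OG s m)) : Spec H M OF OG (Prog.move m) s Q :=
  ⟨(), _, h, fun _ => rfl⟩

theorem Spec.inspect {F : State p E → Prog p E α} {s : State p E} {Q : α → State p E → Prop}
    (h : Spec H M OF OG (F s) s Q) : Spec H M OF OG (Prog.inspect F) s Q := h

end Prog

end Programs

/-! ### Stability of the step length -/

section Constants

/-- Tolerance for approximate stationarity and for moving the centre. -/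
noncomputable def stab (q : ℕ) : ℝ :=
  1 / (4 ^ q * 1024 * (q + 1) ^ 2 * (q + 3) * ((q + 1)! : ℝ))

/-- Bound for the length of a step, relative to the distance to a minimizer. -/
noncomputable def reach (q : ℕ) : ℝ := 3 * (2 * ((q + 1)! : ℝ) * 2 ^ q * (q + 4) + 1)

theorem stab_pos (q : ℕ) : 0 < stab q := by unfold stab; positivity

theorem reach_pos (q : ℕ) : 0 < reach q := by unfold reach; positivity

theorem one_le_factorial_real (n : ℕ) : (1 : ℝ) ≤ (n ! : ℝ) := by
  exact_mod_cast Nat.succ_le_of_lt (Nat.factorial_pos _)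

theorem stab_mul_le (q : ℕ) : stab q * (2 * ((q + 1)! : ℝ)) ≤ 1 := by
  have h4 : (1 : ℝ) ≤ 4 ^ q := one_le_pow₀ (by norm_num)
  have hP := one_le_factorial_real (q + 1)
  have hq : (0 : ℝ) ≤ q := Nat.cast_nonneg _
  rw [stab, div_mul_eq_mul_div, one_mul, div_le_one (by positivity)]
  have h5 : (2 : ℝ) ≤ 4 ^ q * 1024 * (q + 1) ^ 2 * (q + 3) := by
    have : (1 : ℝ) * 2 * 1 * 1 ≤ 4 ^ q * 1024 * (q + 1) ^ 2 * (q + 3) := by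
      gcongr <;> nlinarith
    linarith
  exact mul_le_mul_of_nonneg_right h5 (by positivity)

theorem stab_le (q : ℕ) : stab q ≤ 1 / (1024 * (q + 1)) := by
  have h4 : (1 : ℝ) ≤ 4 ^ q := one_le_pow₀ (by norm_num)
  have hP := one_le_factorial_real (q + 1)
  have hq : (0 : ℝ) ≤ q := Nat.cast_nonneg _
  rw [stab]
  refine one_div_le_one_div_of_le (by positivity) ?_
  have a1 : (1 : ℝ) * 1024 * (q + 1) ≤ 4 ^ q * 1024 * (q + 1) ^ 2 := by
    have : (q + 1 : ℝ) ≤ (q + 1) ^ 2 := by nlinarith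
    gcongr
  have a2 := mul_le_mul a1 (by linarith : (1 : ℝ) ≤ q + 3) zero_le_one (by positivity)
  have a3 := mul_le_mul a2 hP zero_le_one (by positivity)
  linarith

end Constants

namespace Composite

universe u
variable {E : Type u} [NormedAddCommGroup E] [InnerProductSpace ℝ E] [CompleteSpace E]
variable {q : ℕ} {L H : ℝ} {h g : E → ℝ}

/-- Seen from the centre x, both candidates are nearly stationary: y by assumption, y' after paying
for the move of the centre. Uniform monotonicity at scale d' bounds ‖y - y'‖ by d'/(64(q+1)), with
`stab` small enough to absorb all factors. The allowed loss 1/(16(q+1)) costs at most a factor 15/16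
in a q-th power. -/
theorem norm_sub_ge_of_center_close (hC : Composite q L H h g) {x x' y y' : E} {dm τ : ℝ}
    (hdm : 0 < dm) (hτ : τ ≤ stab q * H * dm ^ (q + 1)) (hy : ‖sgrad q h g H x y‖ ≤ τ)
    (hy' : ‖sgrad q h g H x' y'‖ ≤ τ) (hd : dm ≤ ‖y' - x'‖) (hx : ‖x - x'‖ ≤ stab q * dm) :
    (1 - 1 / (16 * (q + 1))) * ‖y' - x'‖ ≤ ‖y - x‖ := by
  have hH := hC.H_pos
  have hst := stab_pos q
  have hst' := stab_le q
  set d' := ‖y' - x'‖ with hd'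
  set δ := ‖x - x'‖ with hδ
  set r := ‖y - y'‖ with hr
  have hd'0 : 0 < d' := hdm.trans_le hd
  have hq : (0 : ℝ) ≤ q := Nat.cast_nonneg _
  have hδ1 : δ ≤ stab q * d' := hx.trans (by gcongr)
  have hδ2 : δ ≤ d' / (1024 * (q + 1)) := by
    refine hδ1.trans ?_
    calc stab q * d' ≤ 1 / (1024 * (q + 1)) * d' := by gcongr
      _ = _ := by ring
  have hδ3 : δ ≤ d' / 2 := by
    refine hδ2.trans ?_
    gcongr
    linarith
  have h1 := hC.inner_sgrad_sub_ge x y y'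
  have h2 := real_inner_le_norm (sgrad q h g H x y - sgrad q h g H x y') (y - y')
  have h3 : d' / 2 ≤ max ‖y - x‖ ‖y' - x‖ := by
    refine le_trans ?_ (le_max_right _ _)
    have : y' - x' = (y' - x) + (x - x') := by abel
    have h4 : d' ≤ ‖y' - x‖ + δ := by rw [hd', this]; exact norm_add_le _ _
    linarith
  have h4 : ‖sgrad q h g H x y - sgrad q h g H x y'‖ ≤
      2 * τ + (q + 1) * (q + 3) * H * δ * (2 * d') ^ q := by
    have e : sgrad q h g H x y - sgrad q h g H x y' = (sgrad q h g H x y - sgrad q h g H x' y') -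
      (sgrad q h g H x y' - sgrad q h g H x' y') := by abel
    rw [e]
    refine (norm_sub_le _ _).trans ?_
    have h5 := norm_sub_le (sgrad q h g H x y) (sgrad q h g H x' y')
    have h6 := hC.norm_sgrad_center_sub_le x x' y'
    have h7 : (q + 1) * (q + 3) * H * δ * (δ + d') ^ q ≤
        (q + 1) * (q + 3) * H * δ * (2 * d') ^ q := by
      gcongr
      linarith
    linarith
  have h5 : 2 * τ ≤ 2 * stab q * H * d' ^ (q + 1) := by
    have : stab q * H * dm ^ (q + 1) ≤ stab q * H * d' ^ (q + 1) := by gcongr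
    linarith
  have hr1 : r ≤ d' / (64 * (q + 1)) := by
    rcases (norm_nonneg (y - y')).eq_or_lt with h0 | h0
    · rw [hr, ← h0]; positivity
    · have h6 : H / (2 * ((q + 1)! : ℝ)) * (d' / 2) ^ q * r ≤
          2 * stab q * H * d' ^ (q + 1) + (q + 1) * (q + 3) * H * (stab q * d') * (2 * d') ^ q := by
        have h7 : H / (2 * ((q + 1)! : ℝ)) * (d' / 2) ^ q * r * r ≤
            (2 * stab q * H * d' ^ (q + 1) +
              (q + 1) * (q + 3) * H * (stab q * d') * (2 * d') ^ q) * r := by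
          calc H / (2 * ((q + 1)! : ℝ)) * (d' / 2) ^ q * r * r
              = H / (2 * ((q + 1)! : ℝ)) * (d' / 2) ^ q * r ^ 2 := by ring
            _ ≤ H / (2 * ((q + 1)! : ℝ)) * max ‖y - x‖ ‖y' - x‖ ^ q * r ^ 2 := by gcongr
            _ ≤ _ := h1.trans h2
            _ ≤ _ := by
              gcongr
              refine h4.trans (add_le_add h5 ?_)
              gcongr
        exact le_of_mul_le_mul_right h7 h0
      set P : ℝ := ((q + 1)! : ℝ) with hP
      have hP1 : 1 ≤ P := one_le_factorial_real _
      have h8 : r ≤ (2 * P * 2 ^ q) * (2 * stab q + (q + 1) * (q + 3) * stab q * 2 ^ q) * d' := by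
        have e1 : H / (2 * P) * (d' / 2) ^ q * r = (H * d' ^ q) * (r / (2 * P * 2 ^ q)) := by
          rw [div_pow]; field_simp
        have e2 : 2 * stab q * H * d' ^ (q + 1) +
            (q + 1) * (q + 3) * H * (stab q * d') * (2 * d') ^ q =
            (H * d' ^ q) * ((2 * stab q + (q + 1) * (q + 3) * stab q * 2 ^ q) * d') := by
          rw [mul_pow]; ring
        rw [e1, e2] at h6
        have h9 := le_of_mul_le_mul_left h6 (by positivity)
        rw [div_le_iff₀ (by positivity)] at h9
        linarith
      refine h8.trans ?_
      have h2q : (1 : ℝ) ≤ 2 ^ q := one_le_pow₀ (by norm_num)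
      have h10 : (2 : ℝ) ≤ (q + 1) * (q + 3) * 2 ^ q := by
        have : (1 : ℝ) * 2 * 1 ≤ (q + 1) * (q + 3) * 2 ^ q := by gcongr <;> linarith
        linarith
      have h11 : (2 * P * 2 ^ q) * (2 * stab q + (q + 1) * (q + 3) * stab q * 2 ^ q) ≤
          1 / (64 * (q + 1)) := by
        calc _ = (2 * P * 2 ^ q) * stab q * (2 + (q + 1) * (q + 3) * 2 ^ q) := by ring
          _ ≤ (2 * P * 2 ^ q) * stab q * ((q + 1) * (q + 3) * 2 ^ q + (q + 1) * (q + 3) * 2 ^ q) := by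
            gcongr
          _ = 4 / 1024 * (1 / (q + 1)) := by
            rw [stab, ← hP, show (4 : ℝ) ^ q = 2 ^ q * 2 ^ q by rw [← mul_pow]; norm_num]
            field_simp
            norm_num
          _ ≤ 1 / (64 * (q + 1)) := by
            rw [← div_div]
            have : (0 : ℝ) < 1 / (q + 1) := by positivity
            have e3 : (1 : ℝ) / 64 / (q + 1) = 1 / 64 * (1 / (q + 1)) := by ring
            rw [e3]
            exact mul_le_mul_of_nonneg_right (by norm_num) this.le
      calc _ ≤ 1 / (64 * (q + 1)) * d' := by gcongr
        _ = _ := by ring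
  have h6 : d' ≤ r + ‖y - x‖ + δ := by
    have : y' - x' = (y - x) + (x - x') - (y - y') := by abel
    rw [hd', this]
    have k1 := norm_sub_le ((y - x) + (x - x')) (y - y')
    have k2 := norm_add_le (y - x) (x - x')
    linarith
  have e1 : (1 - 1 / (16 * (q + 1 : ℝ))) * d' = d' - d' / (64 * (q + 1)) - 3 * (d' / (64 * (q + 1))) := by
    field_simp; ring
  have e2 : d' / (1024 * (q + 1)) ≤ 3 * (d' / (64 * (q + 1))) := by
    have : d' / (1024 * (q + 1)) = 1 / 16 * (d' / (64 * (q + 1))) := by field_simp; ring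
    rw [this]
    have : 0 ≤ d' / (64 * (q + 1)) := by positivity
    linarith
  rw [e1]
  linarith

/-- A short step with small model gradient has true gradient at most H(q+4) dm^{q+1}, and y is
within 4D of the minimizer; convexity concludes. -/
theorem sum_sub_le_of_short_step (hC : Composite q L H h g) {x y xs : E} {D dm τ ε : ℝ}
    (hD : dm ≤ D) (hdm : 0 ≤ dm)
    (hτ : τ ≤ stab q * H * dm ^ (q + 1)) (hε : 4 * (q + 4) * H * D * dm ^ (q + 1) ≤ ε)
    (hx : ‖x - xs‖ ≤ 3 * D) (hy : ‖sgrad q h g H x y‖ ≤ τ) (hyx : ‖y - x‖ ≤ dm) :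
    (h y + g y) - (h xs + g xs) ≤ ε := by
  have hH := hC.H_pos
  have h1 := hC.norm_gradient_sum_le x y
  have h2 := ConvexOn.gradient_le hC.convex_sum (hC.hasGradientAt_sum y) xs
  have h3 := real_inner_le_norm (gradient h y + gradient g y) (y - xs)
  have e : inner ℝ (gradient h y + gradient g y) (xs - y) =
      - inner ℝ (gradient h y + gradient g y) (y - xs) := by rw [← inner_neg_right, neg_sub]
  rw [e] at h2
  have hst : stab q ≤ 1 := (stab_le q).trans (by
    rw [div_le_one (by positivity)]
    have hq : (0 : ℝ) ≤ q := Nat.cast_nonneg _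
    linarith)
  have h4 : ‖y - xs‖ ≤ 4 * D := by
    have : y - xs = (y - x) + (x - xs) := by abel
    rw [this]
    have := norm_add_le (y - x) (x - xs)
    linarith
  have h5 : ‖gradient h y + gradient g y‖ ≤ H * (q + 4) * dm ^ (q + 1) := by
    have h6 : H * (q + 3) * ‖y - x‖ ^ (q + 1) ≤ H * (q + 3) * dm ^ (q + 1) := by gcongr
    have h7 : stab q * H * dm ^ (q + 1) ≤ 1 * H * dm ^ (q + 1) := by gcongr
    linarith
  have h8 : ‖gradient h y + gradient g y‖ * ‖y - xs‖ ≤ (H * (q + 4) * dm ^ (q + 1)) * (4 * D) := by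
    gcongr
  linarith

theorem norm_step_le_reach (hC : Composite q L H h g) {x y xs : E} {D dm τ : ℝ}
    (hxs : ∀ z, h xs + g xs ≤ h z + g z) (hD : dm ≤ D) (hdm : 0 ≤ dm)
    (hτ : τ ≤ stab q * H * dm ^ (q + 1)) (hx : ‖x - xs‖ ≤ 3 * D)
    (hy : ‖sgrad q h g H x y‖ ≤ τ) : ‖y - x‖ ≤ reach q * D := by
  have hH := hC.H_pos
  have hst : stab q ≤ 1 := (stab_le q).trans (by
    rw [div_le_one (by positivity)]
    have hq : (0 : ℝ) ≤ q := Nat.cast_nonneg _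
    linarith)
  have h1 := hC.norm_sub_minimizer_le hxs hx (y := y) (hy.trans (hτ.trans (by
    calc stab q * H * dm ^ (q + 1) ≤ 1 * H * (3 * D) ^ (q + 1) := by
          have := stab_pos q
          gcongr
          linarith
      _ = _ := by ring)))
  have h2 : ‖y - x‖ ≤ ‖y - xs‖ + ‖x - xs‖ := by
    rw [← sub_sub_sub_cancel_right y x xs]; exact norm_sub_le _ _
  rw [reach]
  linarith

end Composite

/-- Numerically, (17/16)(16/15)(1/2) = 17/30 is below 2/3 ≤ (q+1)/(q+2). The last inequality is
where q ≥ 1 is needed. -/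
theorem no_jump {q : ℕ} (hq : 1 ≤ q) {H lam lam' d d' : ℝ} (hH : 0 < H) (hlam : 0 < lam)
    (hl : lam' ≤ (1 + 1 / 16) * lam) (hd' : 0 < d')
    (hd : (1 - 1 / (16 * (q + 1))) * d' ≤ d)
    (h1 : lam * (H * d ^ q / (q ! : ℝ)) < 1 / 2)
    (h2 : ((q : ℝ) + 1) / (q + 2) < lam' * (H * d' ^ q / (q ! : ℝ))) : False := by
  have hq' : (1 : ℝ) ≤ q := by exact_mod_cast hq
  have hν : (1 : ℝ) / (16 * (q + 1)) ≤ 1 := by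
    rw [div_le_one (by positivity)]; linarith
  have h3 : (15 / 16 : ℝ) ≤ (1 - 1 / (16 * (q + 1))) ^ q := by
    have h4 := one_add_mul_le_pow (a := -(1 / (16 * (q + 1 : ℝ)))) (by linarith) q
    have h5 : (q : ℝ) * (1 / (16 * (q + 1))) ≤ 1 / 16 := by
      rw [mul_one_div, div_le_div_iff₀ (by positivity) (by norm_num)]
      linarith
    rw [← sub_eq_add_neg] at h4
    linarith
  have h4 : 15 / 16 * d' ^ q ≤ d ^ q := by
    calc 15 / 16 * d' ^ q ≤ (1 - 1 / (16 * (q + 1))) ^ q * d' ^ q := by gcongr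
      _ = ((1 - 1 / (16 * (q + 1))) * d') ^ q := by rw [mul_pow]
      _ ≤ d ^ q := by
        have : (0 : ℝ) ≤ 1 - 1 / (16 * (q + 1)) := by linarith
        gcongr
  have h5 : lam * (H * (15 / 16 * d' ^ q) / (q ! : ℝ)) < 1 / 2 := lt_of_le_of_lt (by gcongr) h1
  have h6 : lam' * (H * d' ^ q / (q ! : ℝ)) ≤ (1 + 1 / 16) * lam * (H * d' ^ q / (q ! : ℝ)) := by
    gcongr
  have h7 : lam * (H * (15 / 16 * d' ^ q) / (q ! : ℝ)) =
      15 / 16 * (lam * (H * d' ^ q / (q ! : ℝ))) := by ring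
  have h8 : (2 / 3 : ℝ) ≤ ((q : ℝ) + 1) / (q + 2) := by
    rw [div_le_div_iff₀ (by norm_num) (by positivity)]
    linarith
  rw [h7] at h5
  linarith

end TensorSplit

/-! ### Line search and accelerated descent at an abstract level -/

namespace TensorSplit

/-- The outcome of a trial step: the candidate is good enough because the step is short, the step
was carried out, or the step size was too small or too large. -/
inductive Verdict where
  | exit
  | accept
  | small
  | big

universe u
variable {E : Type u} [NormedAddCommGroup E] [InnerProductSpace ℝ E]

section Defs

variable {q : ℕ}

/-- Bisection for the step size; the value tells whether a short step was met. -/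
noncomputable def bisect (T : ℝ → Prog (q + 1) E Verdict) : ℕ → ℝ → ℝ → Prog (q + 1) E Bool
  -- A default value: under the gap assumption of `Level.bisect_spec` this branch is never reached.
  | 0, _, _ => Prog.pure true
  | n + 1, lo, hi => (T ((lo + hi) / 2)).bind fun v =>
      match v with
      | .exit => Prog.pure true
      | .accept => Prog.pure false
      | .small => bisect T n ((lo + hi) / 2) hi
      | .big => bisect T n lo ((lo + hi) / 2)

/-- One step of accelerated Taylor descent, with line search by bisection. -/
noncomputable def lineSearch (T : ℝ → Prog (q + 1) E Verdict) (Hr D dm : ℝ) (K : ℕ) :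
    Prog (q + 1) E Bool :=
  -- For p = 1 the admissible window is the single value 1/2, attained by this step size whatever
  -- the step length.
  if q = 0 then (T (1 / (2 * Hr))).bind fun v =>
      match v with
      | .accept => Prog.pure false
      | _ => Prog.pure true
  -- With this step size, any step at least `dm` long has tested quantity at least 1, so the verdict
  -- cannot be `small`.
  else (T ((q ! : ℝ) / (Hr * dm ^ q))).bind fun v =>
      match v with
      | .big => bisect T K ((q ! : ℝ) / (4 * Hr * (reach q * D) ^ q)) ((q ! : ℝ) / (Hr * dm ^ q))
      | .accept => Prog.pure false
      | _ => Prog.pure true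

/-- At most `N` steps of accelerated Taylor descent. -/
noncomputable def descend (LS : Prog (q + 1) E Bool) : ℕ → Prog (q + 1) E Unit
  | 0 => Prog.pure ()
  | n + 1 => LS.bind fun b => if b then Prog.pure () else descend LS n

end Defs

variable [CompleteSpace E]

/-- What the verdict of a trial with step size `lam` from the variables `c` means. -/
def Outcome (q : ℕ) (h g : E → ℝ) (Hr dm τ : ℝ) (Inv : State (q + 1) E → Catd E → Prop)
    (c : Catd E) (lam : ℝ) (v : Verdict) (s : State (q + 1) E) : Prop :=
  ∃ y, ‖sgrad q h g Hr (c.mid lam) y‖ ≤ τ ∧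
    match v with
    | .exit => s.cand = y ∧ ‖y - c.mid lam‖ ≤ dm
    | .accept => s.cand = y ∧ dm ≤ ‖y - c.mid lam‖ ∧ StepOK (q + 1) Hr lam ‖y - c.mid lam‖ ∧
        Inv s (c.update lam y (gradient h y + gradient g y))
    | .small => dm ≤ ‖y - c.mid lam‖ ∧ lam * (Hr * ‖y - c.mid lam‖ ^ q / (q ! : ℝ)) < 1 / 2 ∧ Inv s c
    | .big => dm ≤ ‖y - c.mid lam‖ ∧
        ((q : ℝ) + 1) / (q + 2) < lam * (Hr * ‖y - c.mid lam‖ ^ q / (q ! : ℝ)) ∧ Inv s c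

/-- The bookkeeping of a program: numbers of new calls, and an invariant. -/
def Costs {q : ℕ} (cf cg : ℕ) (W : State (q + 1) E → Prop) (s s' : State (q + 1) E) : Prop :=
  s'.fLog.length ≤ s.fLog.length + cf ∧ s'.gLog.length ≤ s.gLog.length + cg ∧ W s'

/-- All that is assumed about the level at which accelerated Taylor descent is run: the problem,
the numerical parameters, and the program that tries a step. -/
structure Level (q : ℕ) (H M : ℝ) (OF OG : E → Jet (q + 1) E) (L Hr : ℝ) (h g : E → ℝ) (xs : E)
    (D dm τ : ℝ) (cf cg : ℕ) (Inv : State (q + 1) E → Catd E → Prop)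
    (W : State (q + 1) E → Prop) (T : ℝ → Prog (q + 1) E Verdict) : Prop where
  comp : Composite q L Hr h g
  min : ∀ z, h xs + g xs ≤ h z + g z
  dm_pos : 0 < dm
  dm_le : dm ≤ D
  τ_nonneg : 0 ≤ τ
  τ_le : τ ≤ stab q * Hr * dm ^ (q + 1)
  trial : ∀ (s : State (q + 1) E) (c : Catd E) (lam : ℝ), 0 < lam → Inv s c → 0 ≤ c.A →
    ‖c.x - xs‖ ≤ D → ‖c.y - xs‖ ≤ 3 * D →
    Prog.Spec H M OF OG (T lam) s fun v s' =>
      Costs cf cg W s s' ∧ Outcome q h g Hr dm τ Inv c lam v s'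

omit [CompleteSpace E] in
theorem Costs.trans {q cf cg cf' cg' : ℕ} {W W' : State (q + 1) E → Prop}
    {s s' s'' : State (q + 1) E} (h : Costs cf cg W s s') (h' : Costs cf' cg' W' s' s'') :
    Costs (cf + cf') (cg + cg') W' s s'' :=
  ⟨by have := h.1; have := h'.1; omega, by have := h.2.1; have := h'.2.1; omega, h'.2.2⟩

omit [CompleteSpace E] in
theorem Costs.mono {q cf cg cf' cg' : ℕ} {W : State (q + 1) E → Prop}
    {s s' : State (q + 1) E} (h : Costs cf cg W s s') (hf : cf ≤ cf') (hg : cg ≤ cg') :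
    Costs cf' cg' W s s' :=
  ⟨by have := h.1; omega, by have := h.2.1; omega, h.2.2⟩

/-! ### Correctness and cost of accelerated descent -/

namespace Level

variable {q : ℕ} {H M : ℝ} {OF OG : E → Jet (q + 1) E} {L Hr : ℝ} {h g : E → ℝ} {xs : E}
  {D dm τ : ℝ} {cf cg : ℕ} {Inv : State (q + 1) E → Catd E → Prop} {W : State (q + 1) E → Prop}
  {T : ℝ → Prog (q + 1) E Verdict}

/-- The result of a line search: either a short step was met, or a step was carried out. -/
def Found (q : ℕ) (h g : E → ℝ) (Hr dm τ : ℝ) (Inv : State (q + 1) E → Catd E → Prop)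
    (c : Catd E) (b : Bool) (s : State (q + 1) E) : Prop :=
  ∃ lam y, 0 < lam ∧ ‖sgrad q h g Hr (c.mid lam) y‖ ≤ τ ∧ s.cand = y ∧
    ((b = true ∧ ‖y - c.mid lam‖ ≤ dm) ∨
      (b = false ∧ dm ≤ ‖y - c.mid lam‖ ∧ StepOK (q + 1) Hr lam ‖y - c.mid lam‖ ∧
        Inv s (c.update lam y (gradient h y + gradient g y))))

theorem D_pos (hL : Level q H M OF OG L Hr h g xs D dm τ cf cg Inv W T) : 0 < D :=
  hL.dm_pos.trans_le hL.dm_le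

/-- The invariant is a witness below 1/2 at the left end and a witness above the window, with a step
that is not short, at the right end. These are nearly stationary points, not necessarily computed
ones, so continuity of the computed step in the step size is never used. -/
theorem bisect_spec (hL : Level q H M OF OG L Hr h g xs D dm τ cf cg Inv W T) (hq : 1 ≤ q)
    {c : Catd E} (hA : 0 ≤ c.A) (hx : ‖c.x - xs‖ ≤ D) (hy : ‖c.y - xs‖ ≤ 3 * D) {lo0 : ℝ}
    (hlo0 : 0 < lo0) (n : ℕ) (s : State (q + 1) E) (lo hi : ℝ) (hs : Inv s c) (hW : W s)
    (hlo : lo0 ≤ lo) (hlh : lo ≤ hi)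
    (hgap : hi - lo ≤ stab q * dm / (4 * D) * lo0 * 2 ^ n)
    (hsmall : ∃ y, ‖sgrad q h g Hr (c.mid lo) y‖ ≤ τ ∧
      lo * (Hr * ‖y - c.mid lo‖ ^ q / (q ! : ℝ)) < 1 / 2)
    (hbig : ∃ y, ‖sgrad q h g Hr (c.mid hi) y‖ ≤ τ ∧ dm ≤ ‖y - c.mid hi‖ ∧
      ((q : ℝ) + 1) / (q + 2) < hi * (Hr * ‖y - c.mid hi‖ ^ q / (q ! : ℝ))) :
    Prog.Spec H M OF OG (bisect T n lo hi) s fun b s' =>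
      Costs (n * cf) (n * cg) W s s' ∧ Found q h g Hr dm τ Inv c b s' := by
  induction n generalizing s lo hi with
  | zero =>
    -- The interval is now so short that the two centres are within `stab q * dm`, since x and y are
    -- at most 4D apart; stability of the length contradicts the invariant.
    exfalso
    have hlopos : 0 < lo := hlo0.trans_le hlo
    obtain ⟨y, hy1, hy2⟩ := hsmall
    obtain ⟨y', hy1', hd', hy2'⟩ := hbig
    have hD := hL.D_pos
    have hst := stab_pos q
    have hdm := hL.dm_pos
    set δ := stab q * dm / (4 * D) with hδ
    have hδ0 : 0 < δ := by positivity
    have hgap' : hi ≤ (1 + δ) * lo := by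
      have : δ * lo0 ≤ δ * lo := by gcongr
      rw [pow_zero, mul_one] at hgap
      linarith
    have hxy : ‖c.x - c.y‖ ≤ 4 * D := by
      have : c.x - c.y = (c.x - xs) - (c.y - xs) := by abel
      rw [this]
      have := norm_sub_le (c.x - xs) (c.y - xs)
      linarith
    have hmid : ‖c.mid lo - c.mid hi‖ ≤ stab q * dm := by
      refine (Catd.norm_mid_sub_mid_le hlopos hA hδ0.le hlh hgap').trans ?_
      calc δ * ‖c.x - c.y‖ ≤ δ * (4 * D) := by gcongr
        _ = stab q * dm := by rw [hδ]; field_simp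
    have hstable := hL.comp.norm_sub_ge_of_center_close hdm hL.τ_le hy1 hy1' hd' hmid
    have hδ16 : δ ≤ 1 / 16 := by
      rw [hδ, div_le_div_iff₀ (by positivity) (by norm_num)]
      have h1 : stab q ≤ 1 / 4 := (stab_le q).trans (by
        rw [div_le_div_iff₀ (by positivity) (by norm_num)]
        have hq : (0 : ℝ) ≤ q := Nat.cast_nonneg _
        linarith)
      have h2 := mul_le_mul h1 hL.dm_le hdm.le (by norm_num)
      linarith
    exact no_jump hq hL.comp.H_pos hlopos (hgap'.trans (by gcongr)) (hdm.trans_le hd') hstable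
      hy2 hy2'
  | succ n ih =>
    have hm0 : lo0 ≤ (lo + hi) / 2 := by linarith
    refine (hL.trial s c ((lo + hi) / 2) (by linarith) hs hA hx hy).bind fun v s' hv => ?_
    obtain ⟨hcost, y, hτ, hv⟩ := hv
    cases v with
    | exit =>
      refine Prog.Spec.pure ⟨hcost.mono (Nat.le_mul_of_pos_left _ (by omega))
        (Nat.le_mul_of_pos_left _ (by omega)), _, y, by linarith, hτ, hv.1, Or.inl ⟨rfl, hv.2⟩⟩
    | accept =>
      refine Prog.Spec.pure ⟨hcost.mono (Nat.le_mul_of_pos_left _ (by omega))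
        (Nat.le_mul_of_pos_left _ (by omega)), _, y, by linarith, hτ, hv.1, Or.inr ⟨rfl, hv.2⟩⟩
    | small =>
      refine (ih s' _ _ hv.2.2 hcost.2.2 hm0 (by linarith) ?_ ⟨y, hτ, hv.2.1⟩ hbig).mono
        fun b s'' hb => ⟨(hcost.trans hb.1).mono (by ring_nf; omega) (by ring_nf; omega), hb.2⟩
      rw [pow_succ] at hgap
      linarith
    | big =>
      refine (ih s' _ _ hv.2.2 hcost.2.2 hlo (by linarith) ?_ hsmall ⟨y, hτ, hv.1, hv.2.1⟩).mono
        fun b s'' hb => ⟨(hcost.trans hb.1).mono (by ring_nf; omega) (by ring_nf; omega), hb.2⟩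
      rw [pow_succ] at hgap
      linarith

theorem lineSearch_spec [FiniteDimensional ℝ E]
    (hL : Level q H M OF OG L Hr h g xs D dm τ cf cg Inv W T) {K : ℕ}
    (hK : 16 * reach q ^ q * D ^ (q + 1) ≤ stab q * dm ^ (q + 1) * 2 ^ K)
    {c : Catd E} (hA : 0 ≤ c.A) (hx : ‖c.x - xs‖ ≤ D) (hy : ‖c.y - xs‖ ≤ 3 * D)
    (s : State (q + 1) E) (hs : Inv s c) :
    Prog.Spec H M OF OG (lineSearch T Hr D dm K) s fun b s' =>
      Costs ((K + 1) * cf) ((K + 1) * cg) W s s' ∧ Found q h g Hr dm τ Inv c b s' := by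
  have hHr := hL.comp.H_pos
  have hdm := hL.dm_pos
  have hD := hL.D_pos
  unfold lineSearch
  by_cases hq : q = 0
  · rw [if_pos hq]
    subst hq
    refine (hL.trial s c (1 / (2 * Hr)) (by positivity) hs hA hx hy).bind fun v s' hv => ?_
    obtain ⟨hcost, y, hτ, hv⟩ := hv
    have hval : ∀ r : ℝ, 1 / (2 * Hr) * (Hr * r ^ 0 / ((0 ! : ℕ) : ℝ)) = 1 / 2 := by
      intro r; rw [Nat.factorial_zero]; field_simp; simp
    cases v with
    | exit =>
      refine Prog.Spec.pure ⟨hcost.mono (Nat.le_mul_of_pos_left _ (by omega))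
        (Nat.le_mul_of_pos_left _ (by omega)), _, y, by positivity, hτ, hv.1, Or.inl ⟨rfl, hv.2⟩⟩
    | accept =>
      refine Prog.Spec.pure ⟨hcost.mono (Nat.le_mul_of_pos_left _ (by omega))
        (Nat.le_mul_of_pos_left _ (by omega)), _, y, by positivity, hτ, hv.1, Or.inr ⟨rfl, hv.2⟩⟩
    | small =>
      have := hv.2.1
      rw [hval] at this
      exact absurd this (lt_irrefl _)
    | big =>
      have := hv.2.1
      rw [hval] at this
      norm_num at this
  · rw [if_neg hq]
    set hi := (q ! : ℝ) / (Hr * dm ^ q) with hhi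
    set lo := (q ! : ℝ) / (4 * Hr * (reach q * D) ^ q) with hlo
    have hr := reach_pos q
    have hr1 : 1 ≤ reach q := by
      unfold reach
      have : (0 : ℝ) ≤ 2 * ((q + 1)! : ℝ) * 2 ^ q * (q + 4) := by positivity
      linarith
    have hhi0 : 0 < hi := by positivity
    have hlo0 : 0 < lo := by positivity
    refine (hL.trial s c hi hhi0 hs hA hx hy).bind fun v s' hv => ?_
    obtain ⟨hcost, y, hτ, hv⟩ := hv
    cases v with
    | exit =>
      refine Prog.Spec.pure ⟨hcost.mono (Nat.le_mul_of_pos_left _ (by omega))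
        (Nat.le_mul_of_pos_left _ (by omega)), _, y, by positivity, hτ, hv.1, Or.inl ⟨rfl, hv.2⟩⟩
    | accept =>
      refine Prog.Spec.pure ⟨hcost.mono (Nat.le_mul_of_pos_left _ (by omega))
        (Nat.le_mul_of_pos_left _ (by omega)), _, y, by positivity, hτ, hv.1, Or.inr ⟨rfl, hv.2⟩⟩
    | small =>
      exfalso
      have h1 : (1 : ℝ) ≤ hi * (Hr * ‖y - c.mid hi‖ ^ q / (q ! : ℝ)) := by
        calc (1 : ℝ) = hi * (Hr * dm ^ q / (q ! : ℝ)) := by rw [hhi]; field_simp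
          _ ≤ _ := by
            have := hv.1
            gcongr
      linarith [hv.2.1]
    | big =>
      -- The lower end is never tried. Its witness is the exact model minimizer, whose step is at
      -- most `reach q * D`, so the tested quantity is at most 1/4.
      obtain ⟨z, hz⟩ := hL.comp.exists_minimizer (c.mid lo)
      have hz0 : sgrad q h g Hr (c.mid lo) z = 0 :=
        gradient_eq_zero_of_forall_le (hL.comp.hasGradientAt (c.mid lo) z) hz
      have hzτ : ‖sgrad q h g Hr (c.mid lo) z‖ ≤ τ := by rw [hz0, norm_zero]; exact hL.τ_nonneg
      have hmid : ‖c.mid lo - xs‖ ≤ 3 * D := Catd.norm_mid_sub_le_max hlo0 hA hy (by linarith)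
      have hzr := hL.comp.norm_step_le_reach hL.min hL.dm_le hdm.le hL.τ_le hmid hzτ
      refine (hL.bisect_spec (Nat.one_le_iff_ne_zero.2 hq) hA hx hy hlo0 K s' lo hi hv.2.2
        hcost.2.2 le_rfl ?_ ?_ ⟨z, hzτ, ?_⟩ ⟨y, hτ, hv.1, hv.2.1⟩).mono fun b s'' hb =>
        ⟨(hcost.trans hb.1).mono (by ring_nf; omega) (by ring_nf; omega), hb.2⟩
      · have h1 : dm ≤ reach q * D := by
          calc dm ≤ 1 * D := by linarith [hL.dm_le]
            _ ≤ reach q * D := by gcongr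
        have h2 : Hr ≤ 4 * Hr := by linarith
        rw [hlo, hhi]
        gcongr
      · refine (sub_le_self hi hlo0.le).trans ?_
        have hst := stab_pos q
        rw [hhi, hlo, mul_pow]
        rw [div_le_iff₀ (by positivity)]
        have e : stab q * dm / (4 * D) * ((q ! : ℝ) / (4 * Hr * (reach q ^ q * D ^ q))) * 2 ^ K *
            (Hr * dm ^ q) = (q ! : ℝ) * ((stab q * dm ^ (q + 1) * 2 ^ K) /
              (16 * reach q ^ q * D ^ (q + 1))) := by
          field_simp; ring
        rw [e]
        have : (1 : ℝ) ≤ (stab q * dm ^ (q + 1) * 2 ^ K) / (16 * reach q ^ q * D ^ (q + 1)) := by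
          rw [le_div_iff₀ (by positivity)]; linarith
        have h2 : (q ! : ℝ) * 1 ≤ (q ! : ℝ) * ((stab q * dm ^ (q + 1) * 2 ^ K) /
              (16 * reach q ^ q * D ^ (q + 1))) := by gcongr
        linarith
      · calc lo * (Hr * ‖z - c.mid lo‖ ^ q / (q ! : ℝ))
            ≤ lo * (Hr * (reach q * D) ^ q / (q ! : ℝ)) := by gcongr
          _ = 1 / 4 := by rw [hlo]; field_simp
          _ < 1 / 2 := by norm_num

/-- The state of accelerated Taylor descent after `n` steps: `n₁` steps were long, and used up
energy; the other `n₂` steps were short, and increased the weight `A`. -/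
def Progressed (h g : E → ℝ) (xs : E) (D b : ℝ) (q N n : ℕ) (c : Catd E) : Prop :=
  ∃ n1 n2 : ℕ, n1 + n2 = n ∧ 0 ≤ c.A ∧
    c.A * ((h c.y + g c.y) - (h xs + g xs)) + 1 / 2 * ‖c.x - xs‖ ^ 2 + n1 * (D ^ 2 / N) ≤
      D ^ 2 / 2 ∧
    (n2 * b) ^ (q + 2) ≤ c.A ∧ ‖c.y - xs‖ ≤ 3 * D

omit [InnerProductSpace ℝ E] [CompleteSpace E] in
theorem Progressed.norm_x_le {D b : ℝ} {N n : ℕ} {c : Catd E} (hD : 0 ≤ D)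
    (hmin : ∀ z, h xs + g xs ≤ h z + g z) (hp : Progressed h g xs D b q N n c) :
    ‖c.x - xs‖ ≤ D := by
  obtain ⟨n1, n2, -, hA, hen, -, -⟩ := hp
  have h1 : 0 ≤ c.A * ((h c.y + g c.y) - (h xs + g xs)) :=
    mul_nonneg hA (by linarith [hmin c.y])
  have h2 : 0 ≤ n1 * (D ^ 2 / N) := by positivity
  exact le_of_sq_le_sq (by linarith) hD

/-- The step condition gives 1/λ ≥ H d^q/q!, so the energy drop is at least (3/8)(A + a) H
d^{q+2}/q!. Comparing (A + a) H d^{q+2} with 3 q! D²/N decides whether the step is charged to the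
energy or to the growth of A. -/
theorem Progressed.update (hL : Level q H M OF OG L Hr h g xs D dm τ cf cg Inv W T) {N n : ℕ}
    {b : ℝ} (hN : 0 < N) (hb : 0 < b)
    (hb' : b ^ (2 * (q + 2)) *
      ((2 * (q + 2) ^ 2) ^ (q + 2) * Hr ^ 2 * (3 * (q ! : ℝ) * D ^ 2 / N) ^ q) = 1)
    {c : Catd E} (hp : Progressed h g xs D b q N n c) {lam : ℝ} (hlam : 0 < lam) {y : E}
    (hτ : ‖sgrad q h g Hr (c.mid lam) y‖ ≤ τ) (hd : dm ≤ ‖y - c.mid lam‖)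
    (hs : StepOK (q + 1) Hr lam ‖y - c.mid lam‖) :
    Progressed h g xs D b q N (n + 1) (c.update lam y (gradient h y + gradient g y)) := by
  have hD := hL.D_pos
  have hHr := hL.comp.H_pos
  have hdm := hL.dm_pos
  have hx := hp.norm_x_le hD.le hL.min
  obtain ⟨n1, n2, hn, hA, hen, hbA, hyD⟩ := hp
  have ha := Catd.a_pos (c := c) hlam
  have haa := Catd.a_sq (c := c) hlam hA
  set a := c.a lam with hadef
  set d := ‖y - c.mid lam‖ with hddef
  have hd0 : 0 < d := hdm.trans_le hd
  have hN' : (0 : ℝ) < N := by exact_mod_cast hN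
  have hgr : ‖sgrad q h g Hr (c.mid lam) y‖ ≤ Hr / (2 * ((q + 1)! : ℝ)) * d ^ (q + 1) := by
    refine hτ.trans (hL.τ_le.trans ?_)
    have h1 : stab q ≤ 1 / (2 * ((q + 1)! : ℝ)) := by
      rw [le_div_iff₀ (by positivity)]; exact stab_mul_le q
    calc stab q * Hr * dm ^ (q + 1) ≤ 1 / (2 * ((q + 1)! : ℝ)) * Hr * d ^ (q + 1) := by gcongr
      _ = _ := by ring
  have hstep := hL.comp.norm_step_le hs hlam.le hgr
  have henergy := Catd.energy_step hL.comp.convex_sum hlam hA (hL.comp.hasGradientAt_sum y)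
    (xs := xs) hstep
  rw [← hadef, ← hddef] at henergy
  obtain ⟨hs1, hs2⟩ := hs
  rw [Nat.add_sub_cancel] at hs1 hs2
  have hs2' : lam * (Hr * d ^ q / (q ! : ℝ)) ≤ 1 := by
    refine hs2.trans ?_
    rw [div_le_one (by positivity)]
    linarith
  set A' := c.A + a with hA'
  have hA'0 : 0 < A' := by linarith
  have hdrop : 3 / 8 * (A' * Hr * d ^ (q + 2) / (q ! : ℝ)) ≤ 3 / 8 * (A' / lam) * d ^ 2 := by
    have h1 : Hr * d ^ q / (q ! : ℝ) ≤ 1 / lam := by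
      rw [le_div_iff₀ hlam]; linarith
    calc 3 / 8 * (A' * Hr * d ^ (q + 2) / (q ! : ℝ))
        = 3 / 8 * A' * (Hr * d ^ q / (q ! : ℝ)) * d ^ 2 := by ring
      _ ≤ 3 / 8 * A' * (1 / lam) * d ^ 2 := by gcongr
      _ = _ := by ring
  have hFy : 0 ≤ (h y + g y) - (h xs + g xs) := by linarith [hL.min y]
  -- The energy drop gives d ≤ 2D a/A', and the centre is within (A/A')3D + (a/A')D of the
  -- minimizer. The sum is exactly 3D, so the bound reproduces itself.
  have hy3 : ‖y - xs‖ ≤ 3 * D := by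
    have h1 : 3 / 8 * (A' / lam) * d ^ 2 ≤ D ^ 2 / 2 := by
      have h2 := mul_nonneg hA'0.le hFy
      have h3 : 0 ≤ n1 * (D ^ 2 / (N : ℝ)) := by positivity
      have h4 : 0 ≤ 1 / 2 * ‖c.x - a • (gradient h y + gradient g y) - xs‖ ^ 2 := by positivity
      linarith
    have h5 : d ≤ 2 * D * (a / A') := by
      refine le_of_sq_le_sq ?_ (by positivity)
      have e : (2 * D * (a / A')) ^ 2 = 4 * D ^ 2 * (lam / A') := by
        rw [mul_pow, div_pow, haa]; field_simp; ring
      rw [e]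
      have h6 : d ^ 2 * (A' / lam) ≤ 4 * D ^ 2 := by
        have : 0 ≤ D ^ 2 := by positivity
        linarith
      have h7 : d ^ 2 = d ^ 2 * (A' / lam) * (lam / A') := by field_simp
      rw [h7]
      gcongr
    have h8 := Catd.norm_mid_sub_le hlam hA xs
    rw [← hadef, ← hA'] at h8
    have h9 : ‖y - xs‖ ≤ d + ‖c.mid lam - xs‖ := by
      rw [hddef, ← sub_add_sub_cancel y (c.mid lam) xs]; exact norm_add_le _ _
    calc ‖y - xs‖ ≤ 2 * D * (a / A') + (c.A / A' * (3 * D) + a / A' * D) := by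
          refine h9.trans (add_le_add h5 (h8.trans ?_))
          gcongr
      _ = 3 * D := by field_simp; rw [hA']; ring
  by_cases hlong : 3 * (q ! : ℝ) * D ^ 2 / N ≤ A' * Hr * d ^ (q + 2)
  · refine ⟨n1 + 1, n2, by omega, hA'0.le, ?_, hbA.trans (by change c.A ≤ c.A + a; linarith), hy3⟩
    change A' * ((h y + g y) - (h xs + g xs)) +
      1 / 2 * ‖c.x - a • (gradient h y + gradient g y) - xs‖ ^ 2 + ((n1 + 1 : ℕ) : ℝ) * (D ^ 2 / N) ≤
      D ^ 2 / 2
    -- The factor 3 in the threshold makes the drop at least (9/8) D²/N.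
    have h1 : D ^ 2 / N ≤ 3 / 8 * (A' * Hr * d ^ (q + 2) / (q ! : ℝ)) := by
      calc D ^ 2 / N ≤ 9 / 8 * (D ^ 2 / N) := by
            have : 0 ≤ D ^ 2 / (N : ℝ) := by positivity
            linarith
        _ = 3 / 8 * ((3 * (q ! : ℝ) * D ^ 2 / N) / (q ! : ℝ)) := by field_simp; ring
        _ ≤ _ := by gcongr
    push_cast
    linarith
  · push Not at hlong
    refine ⟨n1, n2 + 1, by omega, hA'0.le, ?_, ?_, hy3⟩
    · change A' * ((h y + g y) - (h xs + g xs)) +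
        1 / 2 * ‖c.x - a • (gradient h y + gradient g y) - xs‖ ^ 2 + (n1 : ℝ) * (D ^ 2 / N) ≤
        D ^ 2 / 2
      have : 0 ≤ 3 / 8 * (A' / lam) * d ^ 2 := by positivity
      linarith
    · change (((n2 + 1 : ℕ) : ℝ) * b) ^ (q + 2) ≤ c.A + a
      have hl : 1 ≤ lam * (2 * Hr * d ^ q) := by
        have h1 : lam * (Hr * d ^ q / (q ! : ℝ)) ≤ lam * (Hr * d ^ q) := by
          gcongr
          exact div_le_self (by positivity) (one_le_factorial_real q)
        linarith
      have := add_pow_le_of_progress (t := n2 * b) hA ha haa hd0.le hHr hl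
        (by positivity : 0 < 3 * (q ! : ℝ) * D ^ 2 / N) hlong.le hb.le hb'.le (by positivity) hbA
      convert this using 2
      push_cast
      ring

theorem descend_spec [FiniteDimensional ℝ E]
    (hL : Level q H M OF OG L Hr h g xs D dm τ cf cg Inv W T) {ε X b : ℝ} {K N : ℕ} (hε : 0 < ε)
    (hdmε : 4 * (q + 4) * Hr * D * dm ^ (q + 1) ≤ ε)
    (hK : 16 * reach q ^ q * D ^ (q + 1) ≤ stab q * dm ^ (q + 1) * 2 ^ K)
    (hX : Hr * D ^ (q + 2) / ε ≤ X) (hN : 0 < N)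
    (hNX : stepConst q * X ^ 2 ≤ (N : ℝ) ^ (3 * q + 4)) (hb : 0 < b)
    (hb' : b ^ (2 * (q + 2)) *
      ((2 * (q + 2) ^ 2) ^ (q + 2) * Hr ^ 2 * (3 * (q ! : ℝ) * D ^ 2 / N) ^ q) = 1)
    (m n : ℕ) (hmn : n + m = N) (s : State (q + 1) E) (c : Catd E) (hs : Inv s c) (hW : W s)
    (hc : s.cand = c.y) (hp : Progressed h g xs D b q N n c) :
    Prog.Spec H M OF OG (descend (lineSearch T Hr D dm K) m) s fun _ s' =>
      Costs (m * ((K + 1) * cf)) (m * ((K + 1) * cg)) W s s' ∧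
        (h s'.cand + g s'.cand) - (h xs + g xs) ≤ ε := by
  have hD := hL.D_pos
  have hHr := hL.comp.H_pos
  induction m generalizing n s c with
  | zero =>
    refine Prog.Spec.pure ⟨⟨by omega, by omega, hW⟩, ?_⟩
    obtain ⟨n1, n2, hn, hA, hen, hbA, -⟩ := hp
    have hF : 0 ≤ (h c.y + g c.y) - (h xs + g xs) := by linarith [hL.min c.y]
    have h1 := mul_nonneg hA hF
    have h2 : 0 ≤ 1 / 2 * ‖c.x - xs‖ ^ 2 := by positivity
    have h3 : 0 ≤ n1 * (D ^ 2 / (N : ℝ)) := by positivity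
    have hw := final_weight_ge hN hD hHr hε hX hNX (by omega : n1 + n2 = N) (by linarith) hb hb' hbA
    rw [hc]
    have h4 : D ^ 2 / (2 * ε) * ((h c.y + g c.y) - (h xs + g xs)) ≤ D ^ 2 / 2 :=
      (mul_le_mul_of_nonneg_right hw hF).trans (by linarith)
    have h5 : D ^ 2 / 2 = D ^ 2 / (2 * ε) * ε := by field_simp
    rw [h5] at h4
    exact le_of_mul_le_mul_left h4 (by positivity)
  | succ m ih =>
    have hx := hp.norm_x_le hD.le hL.min
    have hA : 0 ≤ c.A := by obtain ⟨_, _, _, hA, _⟩ := hp; exact hA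
    have hy : ‖c.y - xs‖ ≤ 3 * D := by obtain ⟨_, _, _, _, _, _, hy⟩ := hp; exact hy
    refine (hL.lineSearch_spec hK hA hx hy s hs).bind fun v s' hv => ?_
    obtain ⟨hcost, lam, y, hlam, hτ, hcand, hv⟩ := hv
    rcases hv with ⟨rfl, hd⟩ | ⟨rfl, hd, hok, hinv⟩
    · refine Prog.Spec.pure ⟨hcost.mono (Nat.le_mul_of_pos_left _ (by omega))
        (Nat.le_mul_of_pos_left _ (by omega)), ?_⟩
      rw [hcand]
      exact hL.comp.sum_sub_le_of_short_step hL.dm_le hL.dm_pos.le hL.τ_le hdmε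
        (Catd.norm_mid_sub_le_max hlam hA hy (by linarith)) hτ hd
    · refine (ih (n + 1) (by omega) s' _ hinv hcost.2.2 hcand
        (hp.update hL hN hb hb' hlam hτ hd hok)).mono fun _ s'' hs'' =>
        ⟨(hcost.trans hs''.1).mono ?_ ?_, hs''.2⟩
      · exact le_of_eq (by ring)
      · exact le_of_eq (by ring)

/-- Accelerated Taylor descent with line search, started at a point at distance at most `D` from
a minimizer, finds an `ε`-minimizer within `N * (K + 1)` trials. -/
theorem run_spec [FiniteDimensional ℝ E]
    (hL : Level q H M OF OG L Hr h g xs D dm τ cf cg Inv W T) {ε X : ℝ} {K N : ℕ} (hε : 0 < ε)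
    (hdmε : 4 * (q + 4) * Hr * D * dm ^ (q + 1) ≤ ε)
    (hK : 16 * reach q ^ q * D ^ (q + 1) ≤ stab q * dm ^ (q + 1) * 2 ^ K)
    (hX : Hr * D ^ (q + 2) / ε ≤ X) (hN : 0 < N)
    (hNX : stepConst q * X ^ 2 ≤ (N : ℝ) ^ (3 * q + 4)) (s : State (q + 1) E) (z : E)
    (hs : Inv s (Catd.start z)) (hW : W s) (hc : s.cand = z) (hz : ‖z - xs‖ ≤ D) :
    Prog.Spec H M OF OG (descend (lineSearch T Hr D dm K) N) s fun _ s' =>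
      Costs (N * ((K + 1) * cf)) (N * ((K + 1) * cg)) W s s' ∧
        (h s'.cand + g s'.cand) - (h xs + g xs) ≤ ε := by
  have hD := hL.D_pos
  have hN' : (0 : ℝ) < N := by exact_mod_cast hN
  obtain ⟨b, hb, hb'⟩ := exists_progress_constant (q := q) hL.comp.H_pos
    (by positivity : 0 < 3 * (q ! : ℝ) * D ^ 2 / N)
  refine hL.descend_spec hε hdmε hK hX hN hNX hb hb' N 0 (by omega) s (Catd.start z) hs hW hc
    ⟨0, 0, rfl, le_rfl, ?_, ?_, ?_⟩
  · have h1 : ‖z - xs‖ ^ 2 ≤ D ^ 2 := by gcongr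
    change 0 * _ + 1 / 2 * ‖z - xs‖ ^ 2 + _ ≤ _
    push_cast
    linarith
  · simp [Catd.start]
  · change ‖z - xs‖ ≤ 3 * D
    linarith

end Level

end TensorSplit

namespace TensorSplit

/-! ### Translating oracle answers into Taylor models -/

section Oracle

universe u
variable {E : Type u} [NormedAddCommGroup E] [InnerProductSpace ℝ E] {q : ℕ}

theorem Jet.taylor_jet (h : E → ℝ) (x y : E) : (jet (q + 1) h x).taylor x y = tay (q + 1) h x y :=
  Fin.sum_univ_eq_sum_range
    (fun k => (1 / (k ! : ℝ)) * iteratedFDeriv ℝ k h x (fun _ => y - x)) (q + 1 + 1)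

theorem Sub.known_eq_model {sub : Sub (q + 1) E} {f : E → ℝ} (hsub : sub.Jf = jet (q + 1) f sub.xt)
    (H : ℝ) : sub.known H = model q f H sub.xt := by
  funext z
  rw [Sub.known, hsub, Jet.taylor_jet, model]

theorem tay_add {h g : E → ℝ} (hh : ContDiff ℝ (q + 1 : ℕ) h) (hg : ContDiff ℝ (q + 1 : ℕ) g)
    (x y : E) : tay (q + 1) (fun z => h z + g z) x y = tay (q + 1) h x y + tay (q + 1) g x y := by
  rw [tay, tay, tay, ← Finset.sum_add_distrib]
  refine Finset.sum_congr rfl fun k hk => ?_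
  have hk' : ((k : ℕ) : WithTop ℕ∞) ≤ ((q + 1 : ℕ) : WithTop ℕ∞) := by
    exact_mod_cast Nat.lt_succ_iff.1 (Finset.mem_range.1 hk)
  have e : (fun z => h z + g z) = h + g := rfl
  rw [e, iteratedFDeriv_add_apply (hh.contDiffAt.of_le hk') (hg.contDiffAt.of_le hk'),
    _root_.add_apply, smul_add]

theorem innerPoint_eq {H M : ℝ} {sub : Sub (q + 1) E} {f g : E → ℝ}
    (hsub : sub.Jf = jet (q + 1) f sub.xt) (hg : ContDiff ℝ (q + 1 : ℕ) g) (ut : E) :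
    innerPoint H M sub ut (jet (q + 1) g ut) =
      argmin (model q (fun y => model q f H sub.xt y + g y) M ut) := by
  rw [innerPoint, Sub.known_eq_model hsub]
  congr 1
  funext z
  rw [Jet.taylor_jet, Jet.taylor_jet, ← tay_add (contDiff_model q f H sub.xt) hg, model]

omit [InnerProductSpace ℝ E] in
theorem argmin_le {h : E → ℝ} (hh : ∃ y, ∀ z, h y ≤ h z) (z : E) : h (argmin h) ≤ h z :=
  Classical.epsilon_spec hh z

variable [CompleteSpace E]

theorem Jet.grad_jet {h : E → ℝ} (hh : ContDiff ℝ (q + 1 : ℕ) h) (y : E) :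
    (jet (q + 1) h y).grad y = gradient h y := by
  have e : (jet (q + 1) h y).taylor y = tay (q + 1) h y := funext fun z => Jet.taylor_jet h y z
  rw [Jet.grad, e, gradient, gradient, fderiv_tay hh, tay_self]

theorem Composite.gradient_known_add {L H : ℝ} {f g : E → ℝ} (hC : Composite q L H f g)
    (hg : ContDiff ℝ (q + 1 : ℕ) g) {sub : Sub (q + 1) E} (hsub : sub.Jf = jet (q + 1) f sub.xt)
    (v : E) :
    gradient (sub.known H) v + (jet (q + 1) g v).grad v = sgrad q f g H sub.xt v := by
  rw [Jet.grad_jet hg, Sub.known_eq_model hsub,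
    (hasGradientAt_model hC.lip.contDiff_succ H sub.xt v).gradient, sgrad]

theorem Composite.gradient_model_add {L H : ℝ} {f g : E → ℝ} (hC : Composite q L H f g) (x v : E) :
    gradient (fun y => model q f H x y + g y) v + gradient (fun _ : E => (0 : ℝ)) v =
      sgrad q f g H x v := by
  rw [gradient_fun_const, add_zero, (hC.hasGradientAt x v).gradient]

end Oracle

/-! ### Judging a trial step -/

section Judge

universe u
variable {E : Type u} [NormedAddCommGroup E] [InnerProductSpace ℝ E]

open Classical in
/-- The verdict on a trial with step size `lam` that led to a step of length `d`. -/
noncomputable def judge (q : ℕ) (Hr dm lam d : ℝ) : Verdict :=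
  if d < dm then .exit
  else if StepOK (q + 1) Hr lam d then .accept
  else if lam * (Hr * d ^ q / (q ! : ℝ)) < 1 / 2 then .small
  else .big

theorem judge_spec (q : ℕ) (Hr dm lam d : ℝ) :
    match judge q Hr dm lam d with
    | .exit => d ≤ dm
    | .accept => dm ≤ d ∧ StepOK (q + 1) Hr lam d
    | .small => dm ≤ d ∧ ¬ StepOK (q + 1) Hr lam d ∧ lam * (Hr * d ^ q / (q ! : ℝ)) < 1 / 2
    | .big => dm ≤ d ∧ ¬ StepOK (q + 1) Hr lam d ∧
        ((q : ℝ) + 1) / (q + 2) < lam * (Hr * d ^ q / (q ! : ℝ)) := by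
  unfold judge
  by_cases h1 : d < dm
  · simp only [if_pos h1]; exact h1.le
  · have h1' : dm ≤ d := not_lt.1 h1
    by_cases h2 : StepOK (q + 1) Hr lam d
    · simp only [if_neg h1, if_pos h2]; exact ⟨h1', h2⟩
    · by_cases h3 : lam * (Hr * d ^ q / (q ! : ℝ)) < 1 / 2
      · simp only [if_neg h1, if_neg h2, if_pos h3]; exact ⟨h1', h2, h3⟩
      · simp only [if_neg h1, if_neg h2, if_neg h3]
        refine ⟨h1', h2, ?_⟩
        by_contra h4
        refine h2 ⟨by rw [Nat.add_sub_cancel]; exact not_lt.1 h3, ?_⟩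
        rw [Nat.add_sub_cancel]
        push_cast
        have : (q : ℝ) + 1 + 1 = q + 2 := by ring
        rw [this]
        exact not_lt.1 h4

variable [CompleteSpace E]

theorem outcome_judge {q : ℕ} {h g : E → ℝ} {Hr dm τ lam : ℝ} {Inv : State (q + 1) E → Catd E → Prop}
    {c : Catd E} {s : State (q + 1) E} {y : E} (hy : ‖sgrad q h g Hr (c.mid lam) y‖ ≤ τ)
    (hs : s.cand = y)
    (hok : dm ≤ ‖y - c.mid lam‖ → StepOK (q + 1) Hr lam ‖y - c.mid lam‖ →
      Inv s (c.update lam y (gradient h y + gradient g y)))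
    (hno : ¬ StepOK (q + 1) Hr lam ‖y - c.mid lam‖ → Inv s c) :
    Outcome q h g Hr dm τ Inv c lam (judge q Hr dm lam ‖y - c.mid lam‖) s := by
  refine ⟨y, hy, ?_⟩
  have hj := judge_spec q Hr dm lam ‖y - c.mid lam‖
  generalize judge q Hr dm lam ‖y - c.mid lam‖ = v at hj
  cases v with
  | exit => exact ⟨hs, hj⟩
  | accept => exact ⟨hs, hj.1, hj.2, hok hj.1 hj.2⟩
  | small => exact ⟨hj.1, hj.2.2, hno hj.2.1⟩
  | big => exact ⟨hj.1, hj.2.2, hno hj.2.1⟩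

end Judge

/-! ### Choice of the numerical parameters -/

section Parameters

/-- The length of a step that is short enough to stop, relative to the distance to a minimizer. -/
noncomputable def shortFactor (q : ℕ) (X : ℝ) : ℝ :=
  (1 / (4 * (q + 4) * X)) ^ (((q + 1 : ℕ) : ℝ)⁻¹)

/-- The number of steps of accelerated Taylor descent. -/
noncomputable def stepCount (q : ℕ) (X : ℝ) : ℕ :=
  ⌈(stepConst q * X ^ 2) ^ (((3 * q + 4 : ℕ) : ℝ)⁻¹)⌉₊

/-- A factor for the number of bisections. -/
noncomputable def bisectConst (q : ℕ) : ℝ := 64 * (q + 4) * reach q ^ q / stab q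

/-- The number of bisections in a line search. -/
noncomputable def bisectCount (q : ℕ) (X : ℝ) : ℕ := Nat.clog 2 ⌈bisectConst q * X⌉₊

theorem bisectConst_pos (q : ℕ) : 0 < bisectConst q := by
  have := reach_pos q
  have := stab_pos q
  unfold bisectConst; positivity

theorem shortFactor_pos (q : ℕ) {X : ℝ} (hX : 1 ≤ X) : 0 < shortFactor q X := by
  unfold shortFactor; positivity

theorem shortFactor_pow (q : ℕ) {X : ℝ} (hX : 1 ≤ X) :
    shortFactor q X ^ (q + 1) = 1 / (4 * (q + 4) * X) :=
  Real.rpow_inv_natCast_pow (by positivity) (by omega)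

theorem shortFactor_le_one (q : ℕ) {X : ℝ} (hX : 1 ≤ X) : shortFactor q X ≤ 1 := by
  refine Real.rpow_le_one (by positivity) ?_ (by positivity)
  rw [div_le_one (by positivity)]
  have hq : (0 : ℝ) ≤ q := Nat.cast_nonneg _
  nlinarith

theorem stepCount_pos (q : ℕ) {X : ℝ} (hX : 1 ≤ X) : 0 < stepCount q X := by
  have := stepConst_pos q
  rw [stepCount, Nat.ceil_pos]
  positivity

theorem le_stepCount_pow (q : ℕ) {X : ℝ} :
    stepConst q * X ^ 2 ≤ (stepCount q X : ℝ) ^ (3 * q + 4) := by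
  have := stepConst_pos q
  have h0 : 0 ≤ stepConst q * X ^ 2 := by positivity
  calc stepConst q * X ^ 2
      = ((stepConst q * X ^ 2) ^ (((3 * q + 4 : ℕ) : ℝ)⁻¹)) ^ (3 * q + 4) :=
        (Real.rpow_inv_natCast_pow h0 (by omega)).symm
    _ ≤ _ := by
      have := Nat.le_ceil ((stepConst q * X ^ 2) ^ (((3 * q + 4 : ℕ) : ℝ)⁻¹))
      rw [stepCount]
      gcongr

theorem le_two_pow_clog (x : ℝ) : x ≤ 2 ^ Nat.clog 2 ⌈x⌉₊ := by
  calc x ≤ (⌈x⌉₊ : ℝ) := Nat.le_ceil x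
    _ ≤ _ := by exact_mod_cast Nat.le_pow_clog (by norm_num) _

/-- Accelerated Taylor descent with all its parameters fixed; `T dm` tries a step, and steps shorter
than `dm` stop the method. -/
noncomputable def atd {E : Type*} [NormedAddCommGroup E] [InnerProductSpace ℝ E] {q : ℕ}
    (T : ℝ → ℝ → Prog (q + 1) E Verdict) (Hr D X : ℝ) : Prog (q + 1) E Unit :=
  descend (lineSearch (T (shortFactor q X * D)) Hr D (shortFactor q X * D) (bisectCount q X))
    (stepCount q X)

/-- The number of trials that `atd` makes. -/
noncomputable def trialCount (q : ℕ) (X : ℝ) : ℕ := stepCount q X * (bisectCount q X + 1)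

theorem Level.atd_spec {E : Type*} [NormedAddCommGroup E] [InnerProductSpace ℝ E] [CompleteSpace E]
    [FiniteDimensional ℝ E] {q : ℕ} {H M : ℝ} {OF OG : E → Jet (q + 1) E} {L Hr : ℝ} {h g : E → ℝ}
    {xs : E} {D τ : ℝ} {cf cg : ℕ} {Inv : State (q + 1) E → Catd E → Prop}
    {W : State (q + 1) E → Prop} {T : ℝ → ℝ → Prog (q + 1) E Verdict} {ε X : ℝ} (hX1 : 1 ≤ X)
    (hL : Level q H M OF OG L Hr h g xs D (shortFactor q X * D) τ cf cg Inv W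
      (T (shortFactor q X * D)))
    (hε : 0 < ε) (hX : Hr * D ^ (q + 2) / ε ≤ X) (s : State (q + 1) E) (z : E)
    (hs : Inv s (Catd.start z)) (hW : W s) (hc : s.cand = z) (hz : ‖z - xs‖ ≤ D) :
    Prog.Spec H M OF OG (atd T Hr D X) s fun _ s' =>
      Costs (trialCount q X * cf) (trialCount q X * cg) W s s' ∧
        (h s'.cand + g s'.cand) - (h xs + g xs) ≤ ε := by
  have hD := hL.D_pos
  have hHr := hL.comp.H_pos
  have hst := stab_pos q
  refine (hL.run_spec (K := bisectCount q X) (N := stepCount q X) hε ?_ ?_ hX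
    (stepCount_pos q hX1) (le_stepCount_pow q) s z hs hW hc hz).mono fun _ s' hs' =>
    ⟨hs'.1.mono (le_of_eq (by rw [trialCount]; ring)) (le_of_eq (by rw [trialCount]; ring)), hs'.2⟩
  -- `shortFactor` is chosen so that the accuracy guaranteed by a short step is H D^{q+2}/X, which
  -- is at most ε.
  · rw [div_le_iff₀ hε] at hX
    rw [mul_pow, shortFactor_pow q hX1]
    have : 4 * (q + 4) * Hr * D * (1 / (4 * (q + 4) * X) * D ^ (q + 1)) = Hr * D ^ (q + 2) / X := by
      field_simp
      ring
    rw [this, div_le_iff₀ (by linarith)]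
    linarith
  · rw [mul_pow, shortFactor_pow q hX1]
    have h1 : bisectConst q * X ≤ 2 ^ bisectCount q X := le_two_pow_clog _
    have h2 : 16 * reach q ^ q * D ^ (q + 1) =
        bisectConst q * X * (stab q * (D ^ (q + 1) / (4 * (q + 4) * X))) := by
      rw [bisectConst]; field_simp; ring
    rw [h2]
    calc _ ≤ 2 ^ bisectCount q X * (stab q * (D ^ (q + 1) / (4 * (q + 4) * X))) :=
          mul_le_mul_of_nonneg_right h1 (by positivity)
      _ = _ := by ring

end Parameters

end TensorSplit

/-! ### The inner method, the subproblem solver and the outer method -/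

namespace TensorSplit

universe u
variable {E : Type u} [NormedAddCommGroup E] [InnerProductSpace ℝ E]

section Programs

variable {q : ℕ}

open Classical in
/-- A trial step of the inner method. -/
noncomputable def innerTrial (M dm mu : ℝ) : Prog (q + 1) E Verdict :=
  if h : 0 < mu then
    Prog.inspect fun s => (Prog.move (.innerTry mu h)).bind fun _ => Prog.inspect fun s' =>
      match s.sub with
      | none => Prog.pure .exit
      | some sub => Prog.pure (judge q M dm mu ‖s'.cand - sub.inner.mid mu‖)
  else Prog.pure .exit

/-- The inner method, restarted `n` times, each time with half the distance to the minimizer. -/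
noncomputable def stages (M X : ℝ) : ℕ → ℝ → Prog (q + 1) E Unit
  | 0, _ => Prog.pure ()
  | n + 1, D => (Prog.move .innerRestart).bind fun _ => (atd (innerTrial M) M D X).bind fun _ =>
      stages M X n (D / 2)

/-- Approximate solution of a tensor subproblem. -/
noncomputable def solve (M X D : ℝ) (J : ℕ) : Prog (q + 1) E Unit :=
  (stages M X J D).bind fun _ => (Prog.move .innerRestart).bind fun _ =>
    -- One tensor step from a fresh start turns closeness to the minimizer into a small gradient.
    -- The step size 1 is arbitrary: with A = 0 the centre does not depend on it, and the candidate
    -- is updated even if the step is rejected.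
    Prog.move (.innerTry 1 one_pos)

open Classical in
/-- A trial step of the outer method; `P` solves the subproblem. -/
noncomputable def outerTrial (P : Prog (q + 1) E Unit) (H dm lam : ℝ) : Prog (q + 1) E Verdict :=
  if h : 0 < lam then
    (Prog.move (.outerTry lam h)).bind fun _ => P.bind fun _ => Prog.inspect fun s =>
      match s.sub with
      | none => Prog.pure .exit
      | some sub =>
        match judge q H dm lam ‖s.cand - sub.xt‖ with
        | .accept => (Prog.move .outerAccept).bind fun _ => Prog.pure .accept
        | v => Prog.pure v
  else Prog.pure .exit

end Programs

variable [CompleteSpace E]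

/-- The assumptions on the two functions and the two regularization parameters. -/
structure TwoLevel (q : ℕ) (Lf Lg H M : ℝ) (f g : E → ℝ) : Prop where
  comp : Composite q Lf H f g
  lip_g : ConvexLip (q + 1) Lg g
  Lg_nonneg : 0 ≤ Lg
  two_le : 2 * (H * normPowBound (q + 1) + Lg) ≤ M
  H_le : H ≤ M

/-- In the subproblem with centre `xt`, the inner method has the variables `c`. -/
def InnerInv {q : ℕ} (f : E → ℝ) (c0 : Catd E) (lam : ℝ) (xt : E) (s : State (q + 1) E)
    (c : Catd E) : Prop :=
  s.outer = c0 ∧ s.sub = some ⟨lam, xt, jet (q + 1) f xt, c⟩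

/-- The method is working on the subproblem with centre `xt`. -/
def InSub {q : ℕ} (f : E → ℝ) (c0 : Catd E) (lam : ℝ) (xt : E) (s : State (q + 1) E) : Prop :=
  ∃ c, InnerInv f c0 lam xt s c

/-- The number `M D^{p+1} / ε` for each stage of the inner method. -/
noncomputable def innerX (q : ℕ) (H M : ℝ) : ℝ := 2 * ((q + 1)! : ℝ) * 8 ^ (q + 2) * (M / H)

/-- The number of oracle calls needed to solve a subproblem. -/
noncomputable def solveCost (q : ℕ) (X : ℝ) (J : ℕ) : ℕ := J * (trialCount q X * 2) + 2

namespace TwoLevel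

variable {q : ℕ} {Lf Lg H M : ℝ} {f g : E → ℝ} {c0 : Catd E} {lam : ℝ} {xt : E}

omit [CompleteSpace E] in
theorem M_pos (hT : TwoLevel q Lf Lg H M f g) : 0 < M := hT.comp.H_pos.trans_le hT.H_le

omit [CompleteSpace E] in
theorem one_le_innerX (hT : TwoLevel q Lf Lg H M f g) : 1 ≤ innerX q H M := by
  have h1 : 1 ≤ M / H := (one_le_div hT.comp.H_pos).2 hT.H_le
  have h2 := one_le_factorial_real (q + 1)
  have h3 : (1 : ℝ) ≤ 8 ^ (q + 2) := one_le_pow₀ (by norm_num)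
  have h4 := one_le_mul_of_one_le_of_one_le (one_le_mul_of_one_le_of_one_le
    (one_le_mul_of_one_le_of_one_le one_le_two h2) h3) h1
  exact h4

/-- The whole subproblem objective becomes the smooth part and the composite part is zero, so the
analysis of the outer method applies unchanged with M in place of H. -/
theorem inner (hT : TwoLevel q Lf Lg H M f g) (x : E) :
    Composite q (H * normPowBound (q + 1) + Lg) M (fun y => model q f H x y + g y)
      (fun _ => 0) where
  lip := hT.comp.convexLip_model hT.lip_g x
  L_nonneg := add_nonneg (mul_nonneg hT.comp.H_pos.le (normPowBound_nonneg _)) hT.Lg_nonneg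
  two_L_le := hT.two_le
  H_pos := hT.M_pos
  convex := convexOn_const 0 convex_univ
  diff := differentiable_const 0

/-- The model has a minimizer, so `argmin` picks a true one and the model gradient vanishes exactly.
Accepted trials cost two calls for `g` and rejected ones one; two is charged for both. -/
theorem innerTry_spec [FiniteDimensional ℝ E] (hT : TwoLevel q Lf Lg H M f g) {mu : ℝ}
    (hmu : 0 < mu) {s : State (q + 1) E} {c : Catd E} (hs : InnerInv f c0 lam xt s c) :
    Prog.Spec H M (jet (q + 1) f) (jet (q + 1) g) (Prog.move (.innerTry mu hmu)) s fun _ s' =>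
      Costs 0 2 (InSub f c0 lam xt) s s' ∧
      sgrad q (fun y => model q f H xt y + g y) (fun _ => 0) M (c.mid mu) s'.cand = 0 ∧
      (StepOK (q + 1) M mu ‖s'.cand - c.mid mu‖ → InnerInv f c0 lam xt s'
        (c.update mu s'.cand (gradient (fun y => model q f H xt y + g y) s'.cand +
          gradient (fun _ : E => (0 : ℝ)) s'.cand))) ∧
      (¬ StepOK (q + 1) M mu ‖s'.cand - c.mid mu‖ → InnerInv f c0 lam xt s' c) := by
  refine Prog.Spec.move ?_
  obtain ⟨ho, hsub⟩ := hs
  have hC := hT.inner xt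
  set v := innerPoint H M ⟨lam, xt, jet (q + 1) f xt, c⟩ (c.mid mu) (jet (q + 1) g (c.mid mu))
    with hv
  have hv0 : sgrad q (fun y => model q f H xt y + g y) (fun _ => 0) M (c.mid mu) v = 0 := by
    refine gradient_eq_zero_of_forall_le (hC.hasGradientAt (c.mid mu) v) fun z => ?_
    rw [add_zero, add_zero, hv, innerPoint_eq rfl hT.lip_g.contDiff_succ]
    refine argmin_le ?_ z
    obtain ⟨z, hz⟩ := hC.exists_minimizer (c.mid mu)
    exact ⟨z, fun y => by simpa using hz y⟩
  have hgrad : gradient (Sub.known (p := q + 1) ⟨lam, xt, jet (q + 1) f xt, c⟩ H) v +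
      (jet (q + 1) g v).grad v = gradient (fun y => model q f H xt y + g y) v +
        gradient (fun _ : E => (0 : ℝ)) v := by
    rw [hT.comp.gradient_known_add hT.lip_g.contDiff_succ rfl, hT.comp.gradient_model_add]
  by_cases hok : StepOK (q + 1) M mu ‖v - c.mid mu‖
  · have he : exec H M (jet (q + 1) f) (jet (q + 1) g) s (.innerTry mu hmu) =
        { s with
          sub := some ⟨lam, xt, jet (q + 1) f xt, c.update mu v
            (gradient (fun y => model q f H xt y + g y) v + gradient (fun _ : E => (0 : ℝ)) v)⟩
          cand := v
          gLog := (v, jet (q + 1) g v) :: (c.mid mu, jet (q + 1) g (c.mid mu)) :: s.gLog } := by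
      simp only [exec, hsub]
      rw [if_pos hok, ← hgrad]
    rw [he]
    exact ⟨⟨le_rfl, le_rfl, _, ho, rfl⟩, hv0, fun _ => ⟨ho, rfl⟩, fun h => absurd hok h⟩
  · have he : exec H M (jet (q + 1) f) (jet (q + 1) g) s (.innerTry mu hmu) =
        { s with
          cand := v
          gLog := (c.mid mu, jet (q + 1) g (c.mid mu)) :: s.gLog } := by
      simp only [exec, hsub]
      rw [if_neg hok]
    rw [he]
    exact ⟨⟨le_rfl, Nat.le_succ _, _, ho, hsub⟩, hv0, fun h => absurd h hok, fun _ => ⟨ho, hsub⟩⟩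

theorem innerRestart_spec {OF OG : E → Jet (q + 1) E} {s : State (q + 1) E}
    (hs : InSub f c0 lam xt s) :
    Prog.Spec H M OF OG (Prog.move .innerRestart) s fun _ s' =>
      Costs 0 0 (InSub f c0 lam xt) s s' ∧ InnerInv f c0 lam xt s' (Catd.start s.cand) ∧
        s'.cand = s.cand := by
  refine Prog.Spec.move ?_
  obtain ⟨c, ho, hsub⟩ := hs
  simp only [exec, hsub]
  exact ⟨⟨le_rfl, le_rfl, Catd.start s.cand, ho, rfl⟩, ⟨ho, rfl⟩, trivial⟩

theorem innerLevel [FiniteDimensional ℝ E] (hT : TwoLevel q Lf Lg H M f g) {z : E}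
    (hz : ∀ y, model q f H xt z + g z ≤ model q f H xt y + g y) {D dm : ℝ} (hdm : 0 < dm)
    (hD : dm ≤ D) :
    Level q H M (jet (q + 1) f) (jet (q + 1) g) (H * normPowBound (q + 1) + Lg) M
      (fun y => model q f H xt y + g y) (fun _ => 0) z D dm 0 0 2 (InnerInv f c0 lam xt)
      (InSub f c0 lam xt) (innerTrial M dm) where
  comp := hT.inner xt
  min y := by simpa using hz y
  dm_pos := hdm
  dm_le := hD
  τ_nonneg := le_rfl
  τ_le := by have := stab_pos q; have := hT.M_pos; positivity
  trial s c mu hmu hs hA hx hy := by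
    rw [innerTrial, dif_pos hmu]
    refine Prog.Spec.inspect ((hT.innerTry_spec hmu hs).bind fun _ s' hs' => Prog.Spec.inspect ?_)
    rw [hs.2]
    exact Prog.Spec.pure ⟨hs'.1, outcome_judge (by rw [hs'.2.1, norm_zero]) rfl
      (fun _ => hs'.2.2.1) hs'.2.2.2⟩

/-- Each stage aims at the accuracy for which the growth of the subproblem forces half the distance.
Target and growth scale alike in D, so `innerX` is a multiple of M/H, the same for all stages. -/
theorem stages_spec [FiniteDimensional ℝ E] (hT : TwoLevel q Lf Lg H M f g) {z : E}
    (hz : ∀ y, model q f H xt z + g z ≤ model q f H xt y + g y) (n : ℕ) {D : ℝ} (hD : 0 < D)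
    (s : State (q + 1) E) (hs : InSub f c0 lam xt s) (hsz : ‖s.cand - z‖ ≤ D) :
    Prog.Spec H M (jet (q + 1) f) (jet (q + 1) g) (stages M (innerX q H M) n D) s fun _ s' =>
      Costs 0 (n * (trialCount q (innerX q H M) * 2)) (InSub f c0 lam xt) s s' ∧
        ‖s'.cand - z‖ ≤ D / 2 ^ n := by
  induction n generalizing s D with
  | zero => exact Prog.Spec.pure ⟨⟨by omega, by omega, hs⟩, by simpa using hsz⟩
  | succ n ih =>
    have hH := hT.comp.H_pos
    have hX := hT.one_le_innerX
    set X := innerX q H M with hXdef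
    have hε : 0 < H / (2 * ((q + 1)! : ℝ) * 4 ^ (q + 2)) * (D / 2) ^ (q + 2) := by positivity
    refine (innerRestart_spec hs).bind fun _ s1 h1 => ?_
    have hL := hT.innerLevel (c0 := c0) (lam := lam) hz (mul_pos (shortFactor_pos q hX) hD)
      (mul_le_of_le_one_left hD.le (shortFactor_le_one q hX))
    refine (hL.atd_spec hX hε ?_ s1 s.cand h1.2.1 h1.1.2.2 h1.2.2 hsz).bind fun _ s2 h2 => ?_
    · rw [hXdef, innerX, div_pow]
      have e : (8 : ℝ) ^ (q + 2) = 4 ^ (q + 2) * 2 ^ (q + 2) := by rw [← mul_pow]; norm_num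
      rw [e]
      refine le_of_eq ?_
      field_simp
    · have h3 := hT.comp.growth hz s2.cand
      have h4 := h2.2
      rw [add_zero, add_zero] at h4
      have h5 : ‖s2.cand - z‖ ≤ D / 2 := by
        have h6 := le_of_mul_le_mul_left (h3.trans h4) (by positivity)
        exact le_of_pow_le_pow_left₀ (by omega) (by positivity) h6
      refine (ih (by positivity) s2 h2.1.2.2 h5).mono fun _ s3 h6 =>
        ⟨((h1.1.trans h2.1).trans h6.1).mono (by omega) (le_of_eq (by ring)), ?_⟩
      refine h6.2.trans (le_of_eq ?_)
      rw [pow_succ]; field_simp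

/-- After J halvings the final tensor step has length at most `reach q` times D/2^J. Its model
gradient is zero, so the gradient of the subproblem is at most M(q+3) times the (q+1)-st power of
that length. -/
theorem solve_spec [FiniteDimensional ℝ E] (hT : TwoLevel q Lf Lg H M f g) {z : E}
    (hz : ∀ y, model q f H xt z + g z ≤ model q f H xt y + g y) {J : ℕ} {D τ : ℝ} (hD : 0 < D)
    (hJ : M * (q + 3) * (reach q * D) ^ (q + 1) ≤ τ * 2 ^ J)
    (s : State (q + 1) E) (hs : InSub f c0 lam xt s) (hsz : ‖s.cand - z‖ ≤ D) :
    Prog.Spec H M (jet (q + 1) f) (jet (q + 1) g) (solve M (innerX q H M) D J) s fun _ s' =>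
      Costs 0 (solveCost q (innerX q H M) J) (InSub f c0 lam xt) s s' ∧
        ‖sgrad q f g H xt s'.cand‖ ≤ τ := by
  have hM := hT.M_pos
  refine (hT.stages_spec hz J hD s hs hsz).bind fun _ s1 h1 => ?_
  refine (innerRestart_spec h1.1.2.2).bind fun _ s2 h2 => ?_
  refine (hT.innerTry_spec one_pos h2.2.1).mono fun _ s3 h3 =>
    ⟨((h1.1.trans h2.1).trans h3.1).mono (by omega) (by rw [solveCost]), ?_⟩
  have h4 := h3.2.1
  rw [Catd.mid_start _ one_pos] at h4
  have hC := hT.inner xt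
  have h5 := hC.norm_gradient_sum_le s1.cand s3.cand
  rw [h4, norm_zero, zero_add, hT.comp.gradient_model_add] at h5
  have he : 0 ≤ D / 2 ^ J := by positivity
  have h6 := hC.norm_sub_minimizer_le (xs := z) (by simpa using hz) h1.2 (y := s3.cand)
    (by rw [h4, norm_zero]; positivity)
  have h7 : ‖s3.cand - s1.cand‖ ≤ reach q * (D / 2 ^ J) := by
    have h8 : ‖s3.cand - s1.cand‖ ≤ ‖s3.cand - z‖ + ‖s1.cand - z‖ := by
      rw [← sub_sub_sub_cancel_right s3.cand s1.cand z]; exact norm_sub_le _ _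
    have h9 : 0 ≤ (2 * ((q + 1)! : ℝ) * 2 ^ q * (q + 4)) * (D / 2 ^ J) := by positivity
    have h10 := h1.2
    rw [reach]
    linarith
  have hr := reach_pos q
  refine h5.trans ?_
  calc M * (q + 3) * ‖s3.cand - s1.cand‖ ^ (q + 1)
      ≤ M * (q + 3) * (reach q * (D / 2 ^ J)) ^ (q + 1) := by gcongr
    _ = M * (q + 3) * (reach q * D) ^ (q + 1) / (2 ^ J) ^ (q + 1) := by
      rw [← mul_div_assoc, div_pow, mul_div_assoc]
    _ ≤ M * (q + 3) * (reach q * D) ^ (q + 1) / 2 ^ J := by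
      gcongr
      -- Only one of the q + 1 factors 2^J is used; this costs just a constant factor in J.
      exact le_self_pow₀ (one_le_pow₀ one_le_two) (by omega)
    _ ≤ τ := by rw [div_le_iff₀ (by positivity)]; exact hJ

theorem outerTry_spec {OG : E → Jet (q + 1) E} (hlam : 0 < lam) (s : State (q + 1) E) :
    Prog.Spec H M (jet (q + 1) f) OG (Prog.move (.outerTry lam hlam)) s fun _ s' =>
      Costs 1 0 (InSub f s.outer lam (s.outer.mid lam)) s s' ∧ s'.cand = s.outer.mid lam ∧
        InnerInv f s.outer lam (s.outer.mid lam) s' (Catd.start (s.outer.mid lam)) :=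
  Prog.Spec.move ⟨⟨le_rfl, le_rfl, _, rfl, rfl⟩, rfl, rfl, rfl⟩

/-- The subproblem minimizer is within `reach q * D` of the centre, which is the starting distance
for the solver; its own last step brings the second factor `reach q` in `hJ`. The tolerance is fixed
by `dm`, so a candidate that is not too close meets the inexactness condition. -/
theorem outerLevel [FiniteDimensional ℝ E] (hT : TwoLevel q Lf Lg H M f g) {xs : E}
    (hmin : ∀ z, f xs + g xs ≤ f z + g z) {D dm : ℝ} (hdm : 0 < dm) (hD : dm ≤ D) {J : ℕ}
    (hJ : M * (q + 3) * (reach q * (reach q * D)) ^ (q + 1) ≤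
      stab q * H * dm ^ (q + 1) * 2 ^ J) :
    Level q H M (jet (q + 1) f) (jet (q + 1) g) Lf H f g xs D dm (stab q * H * dm ^ (q + 1)) 2
      (solveCost q (innerX q H M) J + 1) (fun s c => s.outer = c) (fun _ => True)
      (outerTrial (solve M (innerX q H M) (reach q * D) J) H dm) where
  comp := hT.comp
  min := hmin
  dm_pos := hdm
  dm_le := hD
  τ_nonneg := by have := stab_pos q; have := hT.comp.H_pos; positivity
  τ_le := le_rfl
  trial s c lam hlam hs hA hx hy := by
    have hH := hT.comp.H_pos
    have hst := stab_pos q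
    have hD0 : 0 < D := hdm.trans_le hD
    rw [outerTrial, dif_pos hlam]
    refine (outerTry_spec hlam s).bind fun _ s1 h1 => ?_
    rw [hs] at h1
    obtain ⟨z, hz⟩ := hT.comp.exists_minimizer (c.mid lam)
    have hz0 : sgrad q f g H (c.mid lam) z = 0 :=
      gradient_eq_zero_of_forall_le (hT.comp.hasGradientAt (c.mid lam) z) hz
    have hmid : ‖c.mid lam - xs‖ ≤ 3 * D := Catd.norm_mid_sub_le_max hlam hA hy (by linarith)
    have hzr := hT.comp.norm_step_le_reach hmin hD hdm.le le_rfl hmid (y := z)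
      (by rw [hz0, norm_zero]; positivity)
    rw [norm_sub_rev, ← h1.2.1] at hzr
    refine (hT.solve_spec hz (mul_pos (reach_pos q) hD0) hJ s1 h1.1.2.2 hzr).bind fun _ s2 h2 =>
      Prog.Spec.inspect ?_
    obtain ⟨cin, ho, hsub⟩ := h2.1.2.2
    rw [hsub]
    have hcost : Costs 2 (solveCost q (innerX q H M) J + 1) (fun _ => True) s s2 := by
      have := h1.1.trans h2.1
      exact ⟨by have := this.1; omega, by have := this.2.1; omega, trivial⟩
    have hj := judge_spec q H dm lam ‖s2.cand - c.mid lam‖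
    simp only
    generalize judge q H dm lam ‖s2.cand - c.mid lam‖ = v at hj
    cases v with
    | exit => exact Prog.Spec.pure ⟨hcost, _, h2.2, rfl, hj⟩
    | small => exact Prog.Spec.pure ⟨hcost, _, h2.2, hj.1, hj.2.2, ho⟩
    | big => exact Prog.Spec.pure ⟨hcost, _, h2.2, hj.1, hj.2.2, ho⟩
    | accept =>
      have hgr : ‖gradient (Sub.known (p := q + 1) ⟨lam, c.mid lam, jet (q + 1) f (c.mid lam), cin⟩ H)
          s2.cand + (jet (q + 1) g s2.cand).grad s2.cand‖ ≤
          H / (2 * ((q + 1)! : ℝ)) * ‖s2.cand - c.mid lam‖ ^ (q + 1) := by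
        rw [hT.comp.gradient_known_add hT.lip_g.contDiff_succ rfl]
        refine h2.2.trans ?_
        have h3 : stab q ≤ 1 / (2 * ((q + 1)! : ℝ)) := by
          rw [le_div_iff₀ (by positivity)]; exact stab_mul_le q
        have h4 := hj.1
        calc stab q * H * dm ^ (q + 1)
            ≤ 1 / (2 * ((q + 1)! : ℝ)) * H * ‖s2.cand - c.mid lam‖ ^ (q + 1) := by gcongr
          _ = _ := by ring
      have he : exec H M (jet (q + 1) f) (jet (q + 1) g) s2 .outerAccept =
          { s2 with
            fLog := (s2.cand, jet (q + 1) f s2.cand) :: s2.fLog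
            gLog := (s2.cand, jet (q + 1) g s2.cand) :: s2.gLog
            outer := c.update lam s2.cand (gradient f s2.cand + gradient g s2.cand)
            sub := none } := by
        simp only [exec, hsub]
        rw [if_pos ⟨hj.2, hgr⟩, Jet.grad_jet hT.comp.lip.contDiff_succ,
          Jet.grad_jet hT.lip_g.contDiff_succ, ho]
      refine Prog.Spec.bind (R := fun _ s3 => s3 =
        exec H M (jet (q + 1) f) (jet (q + 1) g) s2 .outerAccept) (Prog.Spec.move rfl)
        fun _ s3 h3 => Prog.Spec.pure ?_
      rw [h3, he]
      have h4 := h1.1.trans h2.1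
      refine ⟨⟨?_, ?_, trivial⟩, s2.cand, h2.2, rfl, hj.1, hj.2, rfl⟩
      · have := h4.1
        simp only [List.length_cons]
        omega
      · have := h4.2.1
        simp only [List.length_cons]
        omega

end TwoLevel

end TensorSplit

namespace TensorSplit

/-! ### Asymptotic bounds for the counts -/

section Counts

theorem exists_stepCount_le (q : ℕ) : ∃ C : ℝ, 0 < C ∧ ∀ X : ℝ, 1 ≤ X →
    (stepCount q X : ℝ) ≤ C * X ^ ((2 : ℝ) / (3 * q + 4)) := by
  have hc := stepConst_pos q
  refine ⟨stepConst q ^ (((3 * q + 4 : ℕ) : ℝ)⁻¹) + 1, by positivity, fun X hX => ?_⟩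
  have hX0 : 0 ≤ X := by linarith
  have h1 : (stepConst q * X ^ 2) ^ (((3 * q + 4 : ℕ) : ℝ)⁻¹) =
      stepConst q ^ (((3 * q + 4 : ℕ) : ℝ)⁻¹) * X ^ ((2 : ℝ) / (3 * q + 4)) := by
    rw [Real.mul_rpow hc.le (by positivity), ← Real.rpow_natCast, ← Real.rpow_mul hX0]
    congr 2
    push_cast
    rw [div_eq_mul_inv]
  have h2 : 1 ≤ X ^ ((2 : ℝ) / (3 * q + 4)) := Real.one_le_rpow hX (by positivity)
  have h3 := (Nat.ceil_lt_add_one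
    (by positivity : 0 ≤ (stepConst q * X ^ 2) ^ (((3 * q + 4 : ℕ) : ℝ)⁻¹))).le
  rw [stepCount]
  rw [h1] at h3 ⊢
  linarith

theorem exists_clog_le {c : ℝ} (hc : 0 ≤ c) : ∃ C : ℝ, 0 < C ∧ ∀ Y : ℝ, 2 ≤ Y → ∀ x : ℝ,
    x ≤ c * Y → (Nat.clog 2 ⌈x⌉₊ : ℝ) + 1 ≤ C * Real.log Y := by
  have hl2 : 0 < Real.log 2 := Real.log_pos one_lt_two
  have hlc : 0 ≤ Real.log (c + 1) := Real.log_nonneg (by linarith)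
  refine ⟨(Real.log (c + 1) / Real.log 2 + 3) / Real.log 2, by positivity, fun Y hY x hx => ?_⟩
  have hlY : Real.log 2 ≤ Real.log Y := Real.log_le_log two_pos hY
  have hN : (⌈x⌉₊ : ℝ) ≤ (c + 1) * Y := by
    have h1 : (⌈x⌉₊ : ℝ) ≤ (⌈c * Y⌉₊ : ℝ) := by exact_mod_cast Nat.ceil_mono hx
    have h2 := (Nat.ceil_lt_add_one (by positivity : 0 ≤ c * Y)).le
    linarith
  have h1 : (Nat.clog 2 ⌈x⌉₊ : ℝ) ≤ (Real.log (c + 1) + Real.log Y) / Real.log 2 + 1 := by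
    rcases Nat.eq_zero_or_pos ⌈x⌉₊ with h0 | h0
    · rw [h0, Nat.clog_zero_right, Nat.cast_zero]
      have : 0 ≤ Real.log Y := by linarith
      positivity
    · have h0' : (1 : ℝ) ≤ (⌈x⌉₊ : ℝ) := by exact_mod_cast h0
      rw [← Real.natCeil_logb_natCast]
      have h2 := (Nat.ceil_lt_add_one (Real.logb_nonneg (b := ((2 : ℕ) : ℝ)) (by norm_num) h0')).le
      refine h2.trans ?_
      rw [Real.logb]
      push_cast
      gcongr
      rw [← Real.log_mul (by positivity) (by positivity)]
      exact Real.log_le_log (by positivity) hN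
  have hL : 1 ≤ Real.log Y / Real.log 2 := (one_le_div hl2).2 hlY
  calc (Nat.clog 2 ⌈x⌉₊ : ℝ) + 1 ≤ Real.log (c + 1) / Real.log 2 + Real.log Y / Real.log 2 + 2 := by
        rw [add_div] at h1; linarith
    _ ≤ Real.log (c + 1) / Real.log 2 * (Real.log Y / Real.log 2) + Real.log Y / Real.log 2 +
          2 * (Real.log Y / Real.log 2) := by
        have : Real.log (c + 1) / Real.log 2 * 1 ≤
          Real.log (c + 1) / Real.log 2 * (Real.log Y / Real.log 2) := by gcongr
        linarith
    _ = _ := by ring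

theorem exists_bisectCount_le (q : ℕ) {c : ℝ} (hc : 0 ≤ c) : ∃ C : ℝ, 0 < C ∧ ∀ Y : ℝ, 2 ≤ Y →
    ∀ X : ℝ, X ≤ c * Y → (bisectCount q X : ℝ) + 1 ≤ C * Real.log Y := by
  have hb := bisectConst_pos q
  obtain ⟨C, hC, h⟩ := exists_clog_le (mul_nonneg hb.le hc)
  refine ⟨C, hC, fun Y hY X hX => h Y hY _ ?_⟩
  rw [mul_assoc]
  gcongr

/-- One logarithm would do; the bound is padded to a cube to share the exponent of the nested count.
-/
theorem exists_trialCount_le (q : ℕ) {c : ℝ} (hc : 1 ≤ c) : ∃ C : ℝ, 0 < C ∧ ∀ Y : ℝ, 2 ≤ Y →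
    (trialCount q (c * Y) : ℝ) * 2 ≤ C * Y ^ ((2 : ℝ) / (3 * q + 4)) * Real.log Y ^ 3 := by
  obtain ⟨C1, hC1, h1⟩ := exists_stepCount_le q
  obtain ⟨C2, hC2, h2⟩ := exists_bisectCount_le q (zero_le_one.trans hc)
  have hl2 : 0 < Real.log 2 := Real.log_pos one_lt_two
  set s := (2 : ℝ) / (3 * q + 4) with hs
  refine ⟨C1 * c ^ s * C2 * 2 / Real.log 2 ^ 2, by positivity, fun Y hY => ?_⟩
  have hlY : Real.log 2 ≤ Real.log Y := Real.log_le_log two_pos hY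
  have hlY0 : 0 < Real.log Y := by linarith
  have h3 := h1 (c * Y) (by nlinarith)
  rw [Real.mul_rpow (by linarith) (by linarith)] at h3
  have h4 := h2 Y hY (c * Y) le_rfl
  rw [trialCount]
  push_cast
  have h5 : (1 : ℝ) ≤ Real.log Y ^ 2 / Real.log 2 ^ 2 := by
    rw [one_le_div (by positivity)]; gcongr
  calc (stepCount q (c * Y) : ℝ) * (bisectCount q (c * Y) + 1) * 2
      ≤ (C1 * (c ^ s * Y ^ s)) * (C2 * Real.log Y) * 2 := by gcongr
    _ = (C1 * (c ^ s * Y ^ s)) * (C2 * Real.log Y) * 2 * 1 := by ring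
    _ ≤ (C1 * (c ^ s * Y ^ s)) * (C2 * Real.log Y) * 2 * (Real.log Y ^ 2 / Real.log 2 ^ 2) := by
      gcongr
    _ = _ := by ring

/-- The two step counts combine into a power of the product X X', which is why that product is
bounded separately. The three logarithms come from outer bisection, inner bisection and restarts. -/
theorem exists_nested_count_le (q : ℕ) {c : ℝ} (hc : 1 ≤ c) : ∃ C : ℝ, 0 < C ∧ ∀ Y : ℝ, 2 ≤ Y →
    ∀ X X' x : ℝ, 1 ≤ X → 1 ≤ X' → X ≤ c * Y → X' ≤ c * Y → X * X' ≤ c * Y → x ≤ c * Y →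
    (trialCount q X : ℝ) * ((solveCost q X' (Nat.clog 2 ⌈x⌉₊) + 1 : ℕ) : ℝ) ≤
      C * Y ^ ((2 : ℝ) / (3 * q + 4)) * Real.log Y ^ 3 := by
  obtain ⟨C1, hC1, h1⟩ := exists_stepCount_le q
  obtain ⟨C2, hC2, h2⟩ := exists_bisectCount_le q (zero_le_one.trans hc)
  obtain ⟨C3, hC3, h3⟩ := exists_clog_le (zero_le_one.trans hc)
  set s := (2 : ℝ) / (3 * q + 4) with hs
  refine ⟨5 * (C1 * C1 * c ^ s) * (C2 * C2 * C3), by positivity,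
    fun Y hY X X' x hX hX' hXY hXY' hXX hx => ?_⟩
  have hlY0 : 0 < Real.log Y := Real.log_pos (by linarith)
  have a1 := h1 X hX
  have a2 := h1 X' hX'
  have a3 := h2 Y hY X hXY
  have a4 := h2 Y hY X' hXY'
  have a5 := h3 Y hY x hx
  have hN' : (1 : ℝ) ≤ stepCount q X' := by exact_mod_cast stepCount_pos q hX'
  have hK' : (1 : ℝ) ≤ bisectCount q X' + 1 := by
    have : (0 : ℝ) ≤ bisectCount q X' := Nat.cast_nonneg _
    linarith
  have hJ : (0 : ℝ) ≤ Nat.clog 2 ⌈x⌉₊ := Nat.cast_nonneg _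
  rw [trialCount, solveCost, trialCount]
  push_cast
  set N := (stepCount q X : ℝ)
  set N' := (stepCount q X' : ℝ)
  set K := (bisectCount q X : ℝ)
  set K' := (bisectCount q X' : ℝ)
  set J := (Nat.clog 2 ⌈x⌉₊ : ℝ)
  have hN0 : 0 ≤ N := Nat.cast_nonneg _
  have hK0 : 0 ≤ K := Nat.cast_nonneg _
  have b1 : 1 ≤ N' * (K' + 1) := one_le_mul_of_one_le_of_one_le hN' hK'
  have b2 : J * (N' * (K' + 1) * 2) + 2 + 1 ≤ 5 * ((J + 1) * (N' * (K' + 1))) := by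
    have : 0 ≤ J * (N' * (K' + 1)) := by positivity
    linarith
  have b3 : N * N' ≤ C1 * C1 * (c ^ s * Y ^ s) := by
    have hs0 : 0 ≤ s := by positivity
    calc N * N' ≤ (C1 * X ^ s) * (C1 * X' ^ s) := by gcongr
      _ = C1 * C1 * (X * X') ^ s := by rw [Real.mul_rpow (by linarith) (by linarith)]; ring
      _ ≤ C1 * C1 * (c * Y) ^ s := by gcongr
      _ = _ := by rw [Real.mul_rpow (by linarith) (by linarith)]
  calc N * (K + 1) * (J * (N' * (K' + 1) * 2) + 2 + 1)
      ≤ N * (K + 1) * (5 * ((J + 1) * (N' * (K' + 1)))) := by gcongr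
    _ = 5 * (N * N') * ((K + 1) * (K' + 1) * (J + 1)) := by ring
    _ ≤ 5 * (C1 * C1 * (c ^ s * Y ^ s)) *
        ((C2 * Real.log Y) * (C2 * Real.log Y) * (C3 * Real.log Y)) := by gcongr
    _ = _ := by ring

end Counts

/-! ### The two complete methods -/

section Runs

universe u
variable {E : Type u} [NormedAddCommGroup E] [InnerProductSpace ℝ E] {q : ℕ}

/-- A single subproblem, solved by a single run of the inner method. -/
noncomputable def singleSubproblem (M D X : ℝ) : Prog (q + 1) E Unit :=
  (Prog.move (.outerTry 1 one_pos)).bind fun _ => atd (innerTrial M) M D X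

/-- The constant in the number of restarts of the inner method. -/
noncomputable def restartConst (q : ℕ) : ℝ :=
  (q + 3) * (reach q * reach q) ^ (q + 1) * (4 * (q + 4)) / stab q

/-- The number of restarts of the inner method in each subproblem. -/
noncomputable def restartCount (q : ℕ) (H M X : ℝ) : ℕ :=
  Nat.clog 2 ⌈restartConst q * (M / H) * X⌉₊

/-- The full two-level method. -/
noncomputable def twoLevel (H M D X : ℝ) : Prog (q + 1) E Unit :=
  atd (outerTrial (solve M (innerX q H M) (reach q * D) (restartCount q H M X)) H) H D X

variable [CompleteSpace E]

theorem Prog.Spec.run {α : Type} {p : ℕ} {H M : ℝ} {OF OG : E → Jet p E} {P : Prog p E α}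
    {s : State p E} {Q : α → State p E → Prop} (h : Prog.Spec H M OF OG P s Q) :
    ∃ a, Q a ((P (fun _ _ => .halt) s).run H M OF OG s) := by
  obtain ⟨a, s', hQ, hrun⟩ := h
  refine ⟨a, ?_⟩
  rw [hrun]
  exact hQ

variable [FiniteDimensional ℝ E] {Lf Lg H M : ℝ} {f g : E → ℝ}

/-- The model dominates F everywhere and exceeds it at the minimizer by at most 2H R^{q+2} ≤ ε/2, so
minimizing the model to accuracy ε/2 is enough. -/
theorem TwoLevel.singleSubproblem_spec (hT : TwoLevel q Lf Lg H M f g) {xs x0 : E}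
    (hmin : ∀ z, f xs + g xs ≤ f z + g z) {R ε X : ℝ} (hR : 0 < R) (hx0 : ‖x0 - xs‖ ≤ R)
    (hε : 0 < ε) (hX1 : 1 ≤ X) (hX : M * (reach q * R) ^ (q + 2) / (ε / 2) ≤ X)
    (hRε : 2 * H * R ^ (q + 2) ≤ ε / 2) :
    Prog.Spec H M (jet (q + 1) f) (jet (q + 1) g) (singleSubproblem M (reach q * R) X)
      (State.init (q + 1) x0) fun _ s =>
        (f s.cand + g s.cand) - (f xs + g xs) ≤ ε ∧ s.fLog.length ≤ 1 ∧
          s.gLog.length ≤ trialCount q X * 2 := by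
  have hH := hT.comp.H_pos
  have hst := stab_pos q
  have hD : 0 < reach q * R := mul_pos (reach_pos q) hR
  refine (outerTry_spec one_pos _).bind fun _ s1 h1 => ?_
  have hmid : (State.init (q + 1) x0).outer.mid 1 = x0 := Catd.mid_start x0 one_pos
  rw [hmid] at h1
  obtain ⟨z, hz⟩ := hT.comp.exists_minimizer x0
  have hz0 : sgrad q f g H x0 z = 0 :=
    gradient_eq_zero_of_forall_le (hT.comp.hasGradientAt x0 z) hz
  have hzr := hT.comp.norm_step_le_reach hmin (le_refl R) hR.le le_rfl
    (hx0.trans (by linarith)) (y := z) (by rw [hz0, norm_zero]; positivity)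
  rw [norm_sub_rev] at hzr
  have hL := hT.innerLevel (c0 := (State.init (q + 1) x0).outer) (lam := 1) hz
    (mul_pos (shortFactor_pos q hX1) hD) (mul_le_of_le_one_left hD.le (shortFactor_le_one q hX1))
  refine (hL.atd_spec hX1 (half_pos hε) hX s1 x0 h1.2.2 h1.1.2.2 h1.2.1 hzr).mono fun _ s2 h2 => ?_
  obtain ⟨hcost, hval⟩ := h2
  have h3 := h1.1.trans hcost
  refine ⟨?_, ?_, ?_⟩
  · have h4 := hT.comp.sum_le_model x0 s2.cand
    have h5 := hT.comp.model_le_sum x0 xs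
    have h6 := hz xs
    have h7 : 2 * H * ‖xs - x0‖ ^ (q + 2) ≤ 2 * H * R ^ (q + 2) := by
      rw [norm_sub_rev]; gcongr
    rw [add_zero, add_zero] at hval
    linarith
  · have := h3.1
    simpa [State.init] using this
  · have := h3.2.1
    simpa [State.init] using this

theorem TwoLevel.twoLevel_spec (hT : TwoLevel q Lf Lg H M f g) {xs x0 : E}
    (hmin : ∀ z, f xs + g xs ≤ f z + g z) {R ε X : ℝ} (hR : 0 < R) (hx0 : ‖x0 - xs‖ ≤ R)
    (hε : 0 < ε) (hX1 : 1 ≤ X) (hX : H * R ^ (q + 2) / ε ≤ X) :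
    Prog.Spec H M (jet (q + 1) f) (jet (q + 1) g) (twoLevel H M R X)
      (State.init (q + 1) x0) fun _ s =>
        (f s.cand + g s.cand) - (f xs + g xs) ≤ ε ∧ s.fLog.length ≤ trialCount q X * 2 ∧
          s.gLog.length ≤
            trialCount q X * (solveCost q (innerX q H M) (restartCount q H M X) + 1) := by
  have hH := hT.comp.H_pos
  have hst := stab_pos q
  have hJ : M * (q + 3) * (reach q * (reach q * R)) ^ (q + 1) ≤
      stab q * H * (shortFactor q X * R) ^ (q + 1) * 2 ^ restartCount q H M X := by
    rw [mul_pow (shortFactor q X), shortFactor_pow q hX1, ← mul_assoc (reach q), mul_pow _ R]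
    have h1 : restartConst q * (M / H) * X ≤ 2 ^ restartCount q H M X := le_two_pow_clog _
    calc M * (q + 3) * ((reach q * reach q) ^ (q + 1) * R ^ (q + 1))
        = restartConst q * (M / H) * X *
            (stab q * H * (1 / (4 * (q + 4) * X) * R ^ (q + 1))) := by
          rw [restartConst]; field_simp
      _ ≤ 2 ^ restartCount q H M X * (stab q * H * (1 / (4 * (q + 4) * X) * R ^ (q + 1))) :=
          mul_le_mul_of_nonneg_right h1 (by positivity)
      _ = _ := by ring
  have hL := hT.outerLevel hmin (mul_pos (shortFactor_pos q hX1) hR)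
    (mul_le_of_le_one_left hR.le (shortFactor_le_one q hX1)) hJ
  refine (hL.atd_spec hX1 hε hX (State.init (q + 1) x0) x0 rfl trivial rfl hx0).mono
    fun _ s2 h2 => ?_
  obtain ⟨hcost, hval⟩ := h2
  refine ⟨hval, ?_, ?_⟩
  · have := hcost.1
    simpa [State.init] using this
  · have := hcost.2.1
    simpa [State.init] using this

end Runs

end TensorSplit

/-! ### Choice of constants and conclusion -/

namespace TensorSplit

theorem one_le_log_two_inv_mul {q : ℕ} {Y : ℝ} (hY : 2 ≤ Y) :
    1 ≤ 1 / Real.log 2 ^ 3 * Y ^ ((2 : ℝ) / (3 * q + 4)) * Real.log Y ^ 3 := by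
  have hl2 : 0 < Real.log 2 := Real.log_pos one_lt_two
  have h1 : Real.log 2 ≤ Real.log Y := Real.log_le_log two_pos hY
  have h2 : 1 ≤ Y ^ ((2 : ℝ) / (3 * q + 4)) := Real.one_le_rpow (by linarith) (by positivity)
  have h3 : 1 ≤ Real.log Y ^ 3 / Real.log 2 ^ 3 := by
    rw [one_le_div (by positivity)]; gcongr
  calc (1 : ℝ) ≤ Y ^ ((2 : ℝ) / (3 * q + 4)) * (Real.log Y ^ 3 / Real.log 2 ^ 3) :=
        one_le_mul_of_one_le_of_one_le h2 h3
    _ = _ := by ring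

theorem exists_rule (q : ℕ) :
    ∃ (C κ : ℝ), 0 < C ∧ 0 < κ ∧
      ∀ (E : Type*) [NormedAddCommGroup E] [InnerProductSpace ℝ E] [FiniteDimensional ℝ E]
        [CompleteSpace E] (Lf Lg R ε : ℝ) (x0 : E), 0 < Lf → Lf < Lg → 0 < ε →
        ∃ rule : Rule (q + 1) E, ∀ (f g : E → ℝ) (xs : E),
          ConvexLip (q + 1) Lf f → ConvexLip (q + 1) Lg g →
          (∀ z, f xs + g xs ≤ f z + g z) → ‖x0 - xs‖ ≤ R →
          let s := rule.run (2 * Lf) (κ * (2 * Lf + Lg)) (jet (q + 1) f) (jet (q + 1) g)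
            (State.init (q + 1) x0)
          (f s.cand + g s.cand) - (f xs + g xs) ≤ ε ∧
            (s.fLog.length : ℝ) ≤ C * (2 + Lf * R ^ (q + 2) / ε) ^ ((2 : ℝ) / (3 * q + 4)) *
              Real.log (2 + Lf * R ^ (q + 2) / ε) ^ 3 ∧
            (s.gLog.length : ℝ) ≤ C * (2 + Lg * R ^ (q + 2) / ε) ^ ((2 : ℝ) / (3 * q + 4)) *
              Real.log (2 + Lg * R ^ (q + 2) / ε) ^ 3 := by
  have hn := normPowBound_nonneg (q + 1)
  have hr := reach_pos q
  have hst := stab_pos q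
  have hP := one_le_factorial_real (q + 1)
  -- This makes M at least twice the Lipschitz constant of the p-th derivative of every subproblem,
  -- and also M ≥ H.
  set κ : ℝ := 2 * (normPowBound (q + 1) + 1) with hκ
  have hκ2 : 2 ≤ κ := by linarith
  have hrc : 0 < restartConst q := by unfold restartConst; positivity
  set B : ℝ := κ * ((q + 1)! : ℝ) * 8 ^ (q + 2) with hB
  have hB0 : 0 < B := by positivity
  set c : ℝ := 2 + 102 * B + 51 * κ * restartConst q with hc
  have hc1 : 1 ≤ c := by
    have : 0 ≤ 51 * κ * restartConst q := by positivity
    linarith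
  set cA : ℝ := 6 * κ * reach q ^ (q + 2) + 1 with hcA
  have hcA1 : 1 ≤ cA := by
    have : 0 ≤ 6 * κ * reach q ^ (q + 2) := by positivity
    linarith
  obtain ⟨C1, hC1, hf⟩ := exists_trialCount_le q (one_le_two : (1 : ℝ) ≤ 2)
  obtain ⟨C2, hC2, hA⟩ := exists_trialCount_le q hcA1
  obtain ⟨C3, hC3, hg⟩ := exists_nested_count_le q hc1
  have hl2 : 0 < Real.log 2 := Real.log_pos one_lt_two
  have hC4 : 0 < 1 / Real.log 2 ^ 3 := by positivity
  set C4 := 1 / Real.log 2 ^ 3 with hC4def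
  refine ⟨C1 + C2 + C3 + C4, κ, by positivity, by linarith, ?_⟩
  intro E _ _ _ _ Lf Lg R ε x0 hLf hLfg hε
  have hLg : 0 < Lg := hLf.trans hLfg
  set s : ℝ := (2 : ℝ) / (3 * q + 4) with hs
  have hbound : ∀ {Y n C' : ℝ}, 2 ≤ Y → C' ≤ C1 + C2 + C3 + C4 →
      n ≤ C' * Y ^ s * Real.log Y ^ 3 → n ≤ (C1 + C2 + C3 + C4) * Y ^ s * Real.log Y ^ 3 := by
    intro Y n C' hY hC' hn
    have : 0 ≤ Real.log Y := Real.log_nonneg (by linarith)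
    have : 0 ≤ Y := by linarith
    exact hn.trans (by gcongr)
  have hTL : ∀ {f g : E → ℝ}, ConvexLip (q + 1) Lf f → ConvexLip (q + 1) Lg g →
      TwoLevel q Lf Lg (2 * Lf) (κ * (2 * Lf + Lg)) f g := fun {f g} hf hg =>
    { comp := ⟨hf, hLf.le, le_rfl, by positivity, hg.convex, hg.differentiable⟩
      lip_g := hg
      Lg_nonneg := hLg.le
      two_le := by
        have : 0 ≤ 2 * Lg * normPowBound (q + 1) := by positivity
        rw [hκ]; linarith
      H_le := by
        have : 1 * (2 * Lf) ≤ κ * (2 * Lf + Lg) := by gcongr <;> linarith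
        linarith }
  -- A nonpositive R leaves only R = 0 with the starting point optimal, or no admissible instance at
  -- all.
  rcases le_or_gt R 0 with hR | hR
  · refine ⟨.halt, fun f g xs _ _ _ hx => ?_⟩
    have h0 : ‖x0 - xs‖ = 0 := le_antisymm (hx.trans hR) (norm_nonneg _)
    have hR0 : R = 0 := le_antisymm hR (h0 ▸ hx)
    have hx0 : x0 = xs := sub_eq_zero.1 (norm_eq_zero.1 h0)
    subst hx0
    have e : ∀ L : ℝ, (2 : ℝ) + L * R ^ (q + 2) / ε = 2 := by
      intro L; rw [hR0, zero_pow (by omega)]; simp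
    simp only [Rule.run, State.init, List.length_nil, Nat.cast_zero, sub_self, e]
    exact ⟨hε.le, by positivity, by positivity⟩
  set t := Lf * R ^ (q + 2) / ε with ht
  set tg := Lg * R ^ (q + 2) / ε with htg
  have ht0 : 0 < t := by positivity
  have htg0 : 0 < tg := by positivity
  have htt : t ≤ tg := by rw [ht, htg]; gcongr
  -- The single subproblem needs 4 L_f R^{p+1} ≤ ε/2, that is t ≤ 1/8. Otherwise 2(2 + t) ≤ 34t and
  -- L_g/L_f ≤ 8 tg, so the additive constants cannot spoil the product of the two counts.
  rcases le_or_gt t (1 / 8) with hcase | hcase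
  · refine ⟨singleSubproblem (κ * (2 * Lf + Lg)) (reach q * R) (cA * (2 + tg)) (fun _ _ => .halt)
      (State.init (q + 1) x0), fun f g xs hfL hgL hmin hx => ?_⟩
    have hT := hTL hfL hgL
    have hX1 : 1 ≤ cA * (2 + tg) := one_le_mul_of_one_le_of_one_le hcA1 (by linarith)
    have hX : κ * (2 * Lf + Lg) * (reach q * R) ^ (q + 2) / (ε / 2) ≤ cA * (2 + tg) := by
      calc κ * (2 * Lf + Lg) * (reach q * R) ^ (q + 2) / (ε / 2)
          ≤ κ * (3 * Lg) * (reach q * R) ^ (q + 2) / (ε / 2) := by gcongr; linarith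
        _ = 6 * κ * reach q ^ (q + 2) * tg := by rw [htg, mul_pow]; field_simp; norm_num
        _ ≤ cA * (2 + tg) := by gcongr <;> linarith
    have hRε : 2 * (2 * Lf) * R ^ (q + 2) ≤ ε / 2 := by
      rw [ht, div_le_iff₀ hε] at hcase
      linarith
    obtain ⟨_, h1, h2, h3⟩ := (hT.singleSubproblem_spec hmin hR hx hε hX1 hX hRε).run
    refine ⟨h1, hbound (by linarith) (by linarith) (le_trans ?_
      (one_le_log_two_inv_mul (by linarith))), hbound (by linarith) (by linarith)
      (le_trans ?_ (hA (2 + tg) (by linarith)))⟩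
    · exact_mod_cast h2
    · exact_mod_cast h3
  · refine ⟨twoLevel (2 * Lf) (κ * (2 * Lf + Lg)) R (2 * (2 + t)) (fun _ _ => .halt)
      (State.init (q + 1) x0), fun f g xs hfL hgL hmin hx => ?_⟩
    have hT := hTL hfL hgL
    obtain ⟨_, h1, h2, h3⟩ := (hT.twoLevel_spec hmin hR hx hε (by linarith : 1 ≤ 2 * (2 + t))
      (by
        have : 2 * Lf * R ^ (q + 2) / ε = 2 * t := by rw [ht]; ring
        linarith)).run
    have hMH : κ * (2 * Lf + Lg) / (2 * Lf) ≤ 3 / 2 * κ * (Lg / Lf) := by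
      calc κ * (2 * Lf + Lg) / (2 * Lf) ≤ κ * (3 * Lg) / (2 * Lf) := by gcongr; linarith
        _ = _ := by field_simp
    have hrt : Lg / Lf * t = tg := by rw [ht, htg]; field_simp
    have hr0 : 0 < Lg / Lf := by positivity
    have hr8 : Lg / Lf ≤ 8 * tg := by
      have : Lg / Lf * (1 / 8) ≤ Lg / Lf * t := by gcongr
      linarith
    have hX' : innerX q (2 * Lf) (κ * (2 * Lf + Lg)) ≤ 3 * B * (Lg / Lf) := by
      calc _ ≤ 2 * ((q + 1)! : ℝ) * 8 ^ (q + 2) * (3 / 2 * κ * (Lg / Lf)) := by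
            rw [innerX]; gcongr
        _ = _ := by rw [hB]; ring
    have hrest : 0 ≤ 51 * κ * restartConst q := by positivity
    have hle : ∀ {a b : ℝ}, a ≤ b * tg → b ≤ c → a ≤ c * (2 + tg) := by
      intro a b hab hbc
      have : b * tg ≤ c * tg := by gcongr
      linarith
    refine ⟨h1, hbound (by linarith) (by linarith) (le_trans ?_ (hf (2 + t) (by linarith))),
      hbound (by linarith) (by linarith) (le_trans ?_ (hg (2 + tg) (by linarith) (2 * (2 + t))
        (innerX q (2 * Lf) (κ * (2 * Lf + Lg)))
        (restartConst q * (κ * (2 * Lf + Lg) / (2 * Lf)) * (2 * (2 + t)))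
        (by linarith) hT.one_le_innerX ?_ ?_ ?_ ?_))⟩
    · exact_mod_cast h2
    · exact_mod_cast h3
    · have : 2 * (2 + tg) ≤ c * (2 + tg) := by gcongr; linarith
      linarith
    · refine hle (b := 24 * B) (hX'.trans ?_) (by linarith)
      have : 3 * B * (Lg / Lf) ≤ 3 * B * (8 * tg) := by gcongr
      linarith
    · refine hle (b := 102 * B) ?_ (by linarith)
      -- Here L_f cancels: the outer factor is of order t, the inner one of order L_g/L_f, and their
      -- product is tg.
      calc 2 * (2 + t) * innerX q (2 * Lf) (κ * (2 * Lf + Lg))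
          ≤ (34 * t) * (3 * B * (Lg / Lf)) :=
            mul_le_mul (by linarith) hX' (zero_le_one.trans hT.one_le_innerX) (by positivity)
        _ = 102 * B * (Lg / Lf * t) := by ring
        _ = _ := by rw [hrt]
    · refine hle (b := 51 * κ * restartConst q) ?_ (by linarith)
      calc restartConst q * (κ * (2 * Lf + Lg) / (2 * Lf)) * (2 * (2 + t))
          ≤ restartConst q * (3 / 2 * κ * (Lg / Lf)) * (34 * t) := by
            have : 2 * (2 + t) ≤ 34 * t := by linarith
            gcongr
        _ = 51 * κ * restartConst q * (Lg / Lf * t) := by ring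
        _ = _ := by rw [hrt]

end TensorSplit

theorem mainTheorem2 (p : ℕ) (hp : 1 ≤ p) :
    ∃ (C κ : ℝ) (m : ℕ), 0 < C ∧ 0 < κ ∧
      ∀ (E : Type*) [NormedAddCommGroup E] [InnerProductSpace ℝ E] [FiniteDimensional ℝ E]
        [CompleteSpace E] (Lf Lg R ε : ℝ) (x0 : E),
        0 < Lf → Lf < Lg → 0 < ε →
        ∃ rule : TensorSplit.Rule p E,
          ∀ (f g : E → ℝ) (xstar : E),
            TensorSplit.ConvexLip p Lf f → TensorSplit.ConvexLip p Lg g →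
            (∀ z, f xstar + g xstar ≤ f z + g z) → ‖x0 - xstar‖ ≤ R →
            let final : TensorSplit.State p E :=
              rule.run (2 * Lf) (κ * (2 * Lf + Lg)) (TensorSplit.jet p f) (TensorSplit.jet p g)
                (TensorSplit.State.init p x0)
            let Xf : ℝ := 2 + Lf * R ^ (p + 1) / ε
            let Xg : ℝ := 2 + Lg * R ^ (p + 1) / ε
            (f final.cand + g final.cand) - (f xstar + g xstar) ≤ ε ∧
            (final.fLog.length : ℝ) ≤ C * Xf ^ ((2 : ℝ) / (3 * p + 1)) * Real.log Xf ^ m ∧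
            (final.gLog.length : ℝ) ≤ C * Xg ^ ((2 : ℝ) / (3 * p + 1)) * Real.log Xg ^ m := by
  obtain ⟨q, rfl⟩ := Nat.exists_eq_add_of_le' hp
  obtain ⟨C, κ, hC, hκ, h⟩ := TensorSplit.exists_rule q
  refine ⟨C, κ, 3, hC, hκ, fun E _ _ _ _ Lf Lg R ε x0 hLf hLfg hε => ?_⟩
  obtain ⟨rule, hrule⟩ := h E Lf Lg R ε x0 hLf hLfg hε
  refine ⟨rule, fun f g xstar hf hg hmin hx => ?_⟩
  have e : (3 * ((q + 1 : ℕ) : ℝ) + 1) = 3 * q + 4 := by push_cast; ring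
  rw [e]
  exact hrule f g xstar hf hg hmin hx
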